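/- Let $k$ be a field and let $F,G\in k[X,Y,Z]$ be homogeneous polynomials of the same degree $d>0$ that are relatively prime. Consider the pencil $\mathcal L=\lambda F+\mu G$ on $\mathbb P^2_k$; its base points are the points $x\in\mathbb P^2_k$ at which both $F$ and $G$ vanish. Call a finite composition $\Pi:W\to\mathbb P^2_k$ of blow-ups of closed points a resolution of $\mathcal L$ if the rational map $(F:G)$ from $\mathbb P^2_k$ to $\mathbb P^1_k$ becomes a morphism $p:W\to\mathbb P^1_k$. The dicritical divisors of $\mathcal L$ (computed on $W$) are the local rings $V=\mathcal O_{W,\eta}\subseteq k(\mathbb P^2_k)$ of $W$ at the generic points $\eta$ of those irreducible components $E$ of the exceptional locus of $\Pi$ for which $p|_E:E\to\mathbb P^1_k$ is surjective. Then a resolution of $\mathcal L$ exists, and for every resolution $\Pi:W\to\mathbb P^2_k$, every base point $x$ of $\mathcal L$ is the center of at least one dicritical divisor: there is a dicritical divisor $V$ of $\mathcal L$ on $W$, with maximal ideal $\mathfrak m_V$, such that $$\mathcal O_{\mathbb P^2_k,x}\subseteq V\qquad\text{and}\qquad \mathfrak m_V\cap\mathcal O_{\mathbb P^2_k,x}=\mathfrak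 m_{\mathbb P^2_k,x}.$$ -/

import Mathlib

open MvPolynomial

namespace PlanePencil

noncomputable section

attribute [local instance] MvPolynomial.gradedAlgebra

/-- The points of the projective space of dimension `n` over `k`, that is, of the scheme
`Proj k[X₀, …, Xₙ]`: the homogeneous prime ideals not containing the irrelevant ideal. -/
abbrev ProjPoint (k : Type*) [Field k] (n : ℕ) : Type _ :=
  ProjectiveSpectrum (homogeneousSubmodule (Fin (n + 1)) k)

/-- The field `Frac k[X, Y, Z]`. The function field of the projective plane is its subfield of
fractions of homogeneous polynomials of the same degree; all local rings below lie in there. -/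
abbrev Ambient (k : Type*) [Field k] : Type _ := FractionRing (MvPolynomial (Fin 3) k)

/-- The inclusion of the (degree zero) homogeneous localization at a point of the plane into
`Frac k[X, Y, Z]`. -/
def stalkEmbedding {k : Type*} [Field k] (x : ProjPoint k 2) :
    HomogeneousLocalization.AtPrime (homogeneousSubmodule (Fin 3) k)
      x.asHomogeneousIdeal.toIdeal →+* Ambient k :=
  (IsLocalization.lift (M := x.asHomogeneousIdeal.toIdeal.primeCompl)
    (S := Localization.AtPrime x.asHomogeneousIdeal.toIdeal)
    (g := algebraMap (MvPolynomial (Fin 3) k) (Ambient k)) (by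
      rintro ⟨y, hy⟩
      have hy0 : y ≠ 0 := fun h => hy (h ▸ Ideal.zero_mem _)
      simpa using hy0)).comp
    (algebraMap (HomogeneousLocalization.AtPrime (homogeneousSubmodule (Fin 3) k)
      x.asHomogeneousIdeal.toIdeal) (Localization.AtPrime x.asHomogeneousIdeal.toIdeal))

/-- The local ring of the projective plane at the point `x`: the fractions `a / b` with `a`, `b`
homogeneous of the same degree and `b` not in the prime ideal `x`. -/
def planeLocalRing {k : Type*} [Field k] (x : ProjPoint k 2) : LocalSubring (Ambient k) :=
  LocalSubring.range (stalkEmbedding x)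

/-- The projective plane as a model in the sense of Zariski: an integral separated surface of
function field `K` is identified with the set of its local rings, which are subrings of `K`.
A point `S` is a specialization of a point `T` if and only if `S ⊆ T`, and a birational morphism
sends `S` to the unique local ring of the target that `S` dominates. -/
def plane (k : Type*) [Field k] : Set (LocalSubring (Ambient k)) :=
  Set.range planeLocalRing

section Model

variable {L : Type*} [Field L]

/-- `R` is a closed point of the model `W`. -/
def IsClosedPoint (W : Set (LocalSubring L)) (R : LocalSubring L) : Prop :=
  R ∈ W ∧ ∀ S ∈ W, S.toSubring ≤ R.toSubring → S = R

/-- The affine chart `R[𝔪 / a]` of the blow-up of the maximal ideal `𝔪` of a local ring `R`. -/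
def blowUpChart (R : LocalSubring L) (a : L) : Subring L :=
  Subring.closure ((R.toSubring : Set L) ∪
    {y | ∃ b ∈ IsLocalRing.maximalIdeal R.toSubring, y = (b : L) / a})

/-- The points of the blow-up of the maximal ideal `𝔪` of `R` that lie over `𝔪`: the localizations,
at primes lying over `𝔪`, of the charts `R[𝔪 / a]`, with `a ∈ 𝔪` nonzero.
(The relation `R ≤ S` on local subrings is domination.) -/
def blowUpFibre (R : LocalSubring L) : Set (LocalSubring L) :=
  {S | R ≤ S ∧ ∃ a ∈ IsLocalRing.maximalIdeal R.toSubring, a ≠ 0 ∧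
    ∃ (P : Ideal (blowUpChart R (a : L))) (_ : P.IsPrime),
      S = LocalSubring.ofPrime (blowUpChart R (a : L)) P}

/-- The blow-up of the model `W` at the closed point `R`. -/
def blowUp (W : Set (LocalSubring L)) (R : LocalSubring L) : Set (LocalSubring L) :=
  (W \ {R}) ∪ blowUpFibre R

/-- `W` is obtained from `W₀` by a finite composition of blow-ups of closed points. -/
inductive IsPointBlowUpSequence (W₀ : Set (LocalSubring L)) : Set (LocalSubring L) → Prop
  | refl : IsPointBlowUpSequence W₀ W₀
  | step (W : Set (LocalSubring L)) (R : LocalSubring L) :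
      IsPointBlowUpSequence W₀ W → IsClosedPoint W R → IsPointBlowUpSequence W₀ (blowUp W R)

/-- For a composition of blow-ups of closed points `W → W₀`: `V` is the local ring of `W` at the
generic point of an irreducible component of the exceptional locus, that is, `V` is a maximal
element, for generization, among the points of `W` at which `W → W₀` is not an isomorphism. -/
def IsExceptionalComponent (W₀ W : Set (LocalSubring L)) (V : LocalSubring L) : Prop :=
  V ∈ W ∧ V ∉ W₀ ∧ ∀ S ∈ W, S ∉ W₀ → V.toSubring ≤ S.toSubring → S = V

end Model

variable {k : Type*} [Field k]

/-- The rational function `a(F, G) / b(F, G)` on the plane, pull-back of `a / b` on the line. -/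
def pullback (F G : MvPolynomial (Fin 3) k) (a b : MvPolynomial (Fin 2) k) : Ambient k :=
  algebraMap _ (Ambient k) (aeval ![F, G] a) / algebraMap _ (Ambient k) (aeval ![F, G] b)

/-- The rational map `(F : G)` to the projective line is defined at the point `S` and sends it to
`q`: pull-back is a local homomorphism from the local ring of the projective line at `q` to `S`. -/
def MapsTo (F G : MvPolynomial (Fin 3) k) (S : LocalSubring (Ambient k)) (q : ProjPoint k 1) :
    Prop :=
  ∀ (n : ℕ) (a b : MvPolynomial (Fin 2) k), a.IsHomogeneous n → b.IsHomogeneous n →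
    b ∉ q.asHomogeneousIdeal →
      ∃ h : pullback F G a b ∈ S.toSubring,
        ((⟨pullback F G a b, h⟩ : S.toSubring) ∈ IsLocalRing.maximalIdeal S.toSubring ↔
          a ∈ q.asHomogeneousIdeal)

/-- `W` is obtained from the projective plane by a composition of blow-ups of closed points, and
the pull-back to `W` of the pencil spanned by `F` and `G` defines a morphism from `W` to the
projective line. -/
structure Resolves (F G : MvPolynomial (Fin 3) k) (W : Set (LocalSubring (Ambient k))) : Prop where
  isPointBlowUpSequence : IsPointBlowUpSequence (plane k) W
  isDefined : ∀ S ∈ W, ∃ q : ProjPoint k 1, MapsTo F G S q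

/-- `V` is a dicritical divisor of the pencil spanned by `F` and `G`, on a surface `W` where the
pencil defines a morphism `p` to the projective line: `V` is the local ring of the generic point of
an exceptional component `E` such that the restriction of `p` to `E` is surjective. -/
def IsDicritical (F G : MvPolynomial (Fin 3) k) (W : Set (LocalSubring (Ambient k)))
    (V : LocalSubring (Ambient k)) : Prop :=
  IsExceptionalComponent (plane k) W V ∧
    ∀ q : ProjPoint k 1, ∃ S ∈ W, S.toSubring ≤ V.toSubring ∧ MapsTo F G S q

/-- `x` is a base point of the pencil: every member `λF + μG` passes through `x`. -/
def IsBasePoint (F G : MvPolynomial (Fin 3) k) (x : ProjPoint k 2) : Prop :=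
  F ∈ x.asHomogeneousIdeal ∧ G ∈ x.asHomogeneousIdeal

end

end PlanePencil

/-! A point of a surface is its local ring inside the function field `K` of the plane, and f = F/G
is the rational function of the pencil. The map (F : G) is undefined at S exactly when neither f nor
1/f lies in S (`exists_mapsTo_iff`). Since F and G are relatively prime, f is indeterminate in this
sense at every base point.

Base points are centers. Let f be indeterminate at x and let S be the local ring there, with maximal
ideal 𝔪. As S is normal, every polynomial relation of f over S has coefficients in 𝔪, so 𝔪S[f] is
prime. The localization of S[f] there dominates S, and f has transcendental residue in it
(`exists_residueTranscendental`). Take a valuation ring V' dominating this localization. Its center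
V on W is not indeterminate for f, and its residue field contains the transcendental residue of f.
The two-dimensional points of W have residue field algebraic over k, so V is a discrete valuation
ring or `K`. Uniqueness of centers on the plane shows that V dominates S, and V is not a point of
the plane because f lies in V but not in S. For a point q of the line, a valuation ring composite
with V' and centered at q has a center on W lying on the component of V and mapping to q. Hence the
component surjects onto the line (`exists_isDicritical`).

Resolutions exist. Blow-ups keep the local rings regular or divisorial
(`isSurfacePoint_of_mem_blowUpFibre`), and a model has only finitely many indeterminate points.
Write f = a/b at such a point S. In a local ring V dominating S where f is residually
transcendental, the partial products of a factorization of a into nonunits are linearly independent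
over k(f, a), so their number is at most [K : k(f, a)] (`exists_bound_of_factorization`). Blowing up
replaces a by a/d with d in 𝔪, which removes one factor, so the best bound drops
(`indeterminacyOrder_lt`). One point is replaced by finitely many of smaller order, and the multiset
order makes this stop. -/

namespace PlanePencil

/-! ### Local subrings of a field, domination, and localizations of a subring. -/

section LocalSubrings

variable {L : Type*} [Field L]

/-- The maximal ideal of a local subring of a field, as a set of elements of the field. -/
def maxSet (S : LocalSubring L) : Set L := {z | z ∈ S.toSubring ∧ (z = 0 ∨ z⁻¹ ∉ S.toSubring)}

lemma isUnit_subring_iff {A : Subring L} {z : A} : IsUnit z ↔ (z : L) ≠ 0 ∧ (z : L)⁻¹ ∈ A := by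
  rw [isUnit_iff_exists_inv]
  constructor
  · rintro ⟨w, hw⟩
    have h : (z : L) * w = 1 := congrArg Subtype.val hw
    refine ⟨left_ne_zero_of_mul_eq_one h, ?_⟩
    rw [← eq_inv_of_mul_eq_one_right h]
    exact w.2
  · rintro ⟨h0, h⟩
    exact ⟨⟨_, h⟩, Subtype.ext (mul_inv_cancel₀ h0)⟩

lemma mem_maxSet_coe {S : LocalSubring L} {z : S.toSubring} :
    (z : L) ∈ maxSet S ↔ z ∈ IsLocalRing.maximalIdeal S.toSubring := by
  rw [IsLocalRing.mem_maximalIdeal, mem_nonunits_iff, isUnit_subring_iff]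
  simp only [maxSet, Set.mem_ofPred_eq, z.2, true_and]
  tauto

lemma mem_maxSet_iff {S : LocalSubring L} {z : L} :
    z ∈ maxSet S ↔ ∃ h : z ∈ S.toSubring, ⟨z, h⟩ ∈ IsLocalRing.maximalIdeal S.toSubring :=
  ⟨fun h => ⟨h.1, mem_maxSet_coe.1 h⟩, fun ⟨h, h'⟩ => mem_maxSet_coe (z := ⟨z, h⟩).2 h'⟩

lemma zero_mem_maxSet (S : LocalSubring L) : (0 : L) ∈ maxSet S := ⟨zero_mem _, .inl rfl⟩

lemma one_notMem_maxSet (S : LocalSubring L) : (1 : L) ∉ maxSet S := by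
  rintro ⟨-, h | h⟩
  · exact one_ne_zero h
  · exact h (by simp)

lemma add_mem_maxSet {S : LocalSubring L} {a b : L} (ha : a ∈ maxSet S) (hb : b ∈ maxSet S) :
    a + b ∈ maxSet S := by
  rw [mem_maxSet_iff] at *
  obtain ⟨h1, h2⟩ := ha
  obtain ⟨h3, h4⟩ := hb
  exact ⟨add_mem h1 h3, Ideal.add_mem _ h2 h4⟩

lemma mul_mem_maxSet {S : LocalSubring L} {a b : L} (ha : a ∈ S.toSubring) (hb : b ∈ maxSet S) :
    a * b ∈ maxSet S := by
  rw [mem_maxSet_iff] at *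
  obtain ⟨h3, h4⟩ := hb
  exact ⟨mul_mem ha h3, Ideal.mul_mem_left _ ⟨a, ha⟩ h4⟩

lemma mul_mem_maxSet' {S : LocalSubring L} {a b : L} (ha : a ∈ maxSet S) (hb : b ∈ S.toSubring) :
    a * b ∈ maxSet S := mul_comm b a ▸ mul_mem_maxSet hb ha

lemma neg_mem_maxSet {S : LocalSubring L} {a : L} (ha : a ∈ maxSet S) : -a ∈ maxSet S := by
  have := mul_mem_maxSet (neg_mem (one_mem S.toSubring)) ha
  simpa using this

lemma sub_mem_maxSet {S : LocalSubring L} {a b : L} (ha : a ∈ maxSet S) (hb : b ∈ maxSet S) :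
    a - b ∈ maxSet S := sub_eq_add_neg a b ▸ add_mem_maxSet ha (neg_mem_maxSet hb)

lemma mem_or_mem_maxSet {S : LocalSubring L} {a b : L} (ha : a ∈ S.toSubring)
    (hb : b ∈ S.toSubring) (h : a * b ∈ maxSet S) : a ∈ maxSet S ∨ b ∈ maxSet S := by
  rw [mem_maxSet_iff] at h
  obtain ⟨_, h⟩ := h
  have := Ideal.IsPrime.mem_or_mem (I := IsLocalRing.maximalIdeal S.toSubring) inferInstance
    (x := ⟨a, ha⟩) (y := ⟨b, hb⟩) h
  exact this.imp (fun h => mem_maxSet_iff.2 ⟨ha, h⟩) (fun h => mem_maxSet_iff.2 ⟨hb, h⟩)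

lemma pow_mem_maxSet {S : LocalSubring L} {a : L} (ha : a ∈ S.toSubring) {n : ℕ}
    (h : a ^ n ∈ maxSet S) : a ∈ maxSet S := by
  induction n with
  | zero => exact absurd (by simpa using h) (one_notMem_maxSet S)
  | succ n ih =>
    rw [pow_succ] at h
    exact (mem_or_mem_maxSet (pow_mem ha n) ha h).elim ih id

lemma ne_zero_of_notMem_maxSet {S : LocalSubring L} {a : L} (h : a ∉ maxSet S) : a ≠ 0 := by
  rintro rfl
  exact h (zero_mem_maxSet S)

lemma inv_mem_of_notMem_maxSet {S : LocalSubring L} {a : L} (ha : a ∈ S.toSubring)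
    (h : a ∉ maxSet S) : a⁻¹ ∈ S.toSubring := by
  by_contra h'
  exact h ⟨ha, .inr h'⟩

lemma notMem_maxSet_of_inv_mem {S : LocalSubring L} {a : L} (h0 : a ≠ 0)
    (h : a⁻¹ ∈ S.toSubring) : a ∉ maxSet S := fun h' => h'.2.elim h0 (fun h'' => h'' h)

lemma inv_notMem_of_mem_maxSet {S : LocalSubring L} {a : L} (h0 : a ≠ 0)
    (h : a ∈ maxSet S) : a⁻¹ ∉ S.toSubring := fun h' => notMem_maxSet_of_inv_mem h0 h' h

/-- An inclusion is local exactly when nonunits stay nonunits. In this form domination is checked on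
elements of `L`, without coercions between subrings. -/
lemma le_iff_maxSet {S S' : LocalSubring L} :
    S ≤ S' ↔ S.toSubring ≤ S'.toSubring ∧ maxSet S ⊆ maxSet S' := by
  rw [LocalSubring.le_def]
  constructor
  · rintro ⟨h, h'⟩
    refine ⟨h, fun z hz => ?_⟩
    by_contra hz'
    have hzS := hz.1
    have hu : IsUnit (Subring.inclusion h ⟨z, hzS⟩) := isUnit_subring_iff.2
      ⟨ne_zero_of_notMem_maxSet hz', inv_mem_of_notMem_maxSet (h hzS) hz'⟩
    have := isUnit_subring_iff.1 (h'.1 _ hu)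
    exact notMem_maxSet_of_inv_mem this.1 this.2 hz
  · rintro ⟨h, h'⟩
    refine ⟨h, ⟨fun z hz => ?_⟩⟩
    by_contra hz'
    have h1 : (z : L) ∈ maxSet S' := h' (mem_maxSet_coe.2 hz')
    have h2 := isUnit_subring_iff.1 hz
    exact notMem_maxSet_of_inv_mem h2.1 h2.2 h1

lemma mem_maxSet_of_le {S S' : LocalSubring L} (h : S ≤ S') {z : L} (hz : z ∈ maxSet S) :
    z ∈ maxSet S' := (le_iff_maxSet.1 h).2 hz

lemma mem_maxSet_of_mem {S S' : LocalSubring L} (h : S.toSubring ≤ S'.toSubring) {z : L}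
    (hz : z ∈ S.toSubring) (hz' : z ∈ maxSet S') : z ∈ maxSet S := by
  by_contra h'
  exact notMem_maxSet_of_inv_mem (ne_zero_of_notMem_maxSet h')
    (h (inv_mem_of_notMem_maxSet hz h')) hz'

lemma comap_maximalIdeal_of_le {S S' : LocalSubring L} (h : S ≤ S') :
    (IsLocalRing.maximalIdeal S'.toSubring).comap (Subring.inclusion h.1) =
      IsLocalRing.maximalIdeal S.toSubring := by
  ext z
  rw [Ideal.mem_comap, ← mem_maxSet_coe, ← mem_maxSet_coe]
  exact ⟨fun h' => mem_maxSet_of_mem h.1 z.2 h', fun h' => mem_maxSet_of_le h h'⟩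

/-- The local subring `S` is the localization at a prime ideal of the subring `T`. -/
def IsLocalizationOf (T : Subring L) (S : LocalSubring L) : Prop :=
  T ≤ S.toSubring ∧ ∀ z ∈ S.toSubring, ∃ a ∈ T, ∃ b ∈ T, b ∉ maxSet S ∧ z = a / b

/-- The contraction of the maximal ideal of `S` to a subring `T` of `S`. -/
noncomputable def contraction {T : Subring L} {S : LocalSubring L} (h : T ≤ S.toSubring) :
    Ideal T := (IsLocalRing.maximalIdeal S.toSubring).comap (Subring.inclusion h)

lemma mem_contraction {T : Subring L} {S : LocalSubring L} (h : T ≤ S.toSubring) {z : T} :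
    z ∈ contraction h ↔ (z : L) ∈ maxSet S := by
  rw [contraction, Ideal.mem_comap, ← mem_maxSet_coe]
  rfl

instance {T : Subring L} {S : LocalSubring L} (h : T ≤ S.toSubring) : (contraction h).IsPrime :=
  Ideal.IsPrime.comap _

lemma mem_ofPrime_iff {T : Subring L} (P : Ideal T) [P.IsPrime] {z : L} :
    z ∈ (LocalSubring.ofPrime T P).toSubring ↔ ∃ a b : T, b ∉ P ∧ z = a / b := by
  constructor
  · intro hz
    obtain ⟨a, b, h⟩ := IsLocalization.exists_mk'_eq P.primeCompl
      (⟨z, hz⟩ : (LocalSubring.ofPrime T P).toSubring)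
    refine ⟨a, b, b.2, ?_⟩
    have hb0 : ((b : T) : L) ≠ 0 := by
      intro h0
      exact b.2 ((Subtype.ext h0 : (b : T) = 0) ▸ P.zero_mem)
    rw [IsLocalization.mk'_eq_iff_eq_mul] at h
    rw [eq_div_iff hb0]
    exact (congrArg Subtype.val h).symm
  · rintro ⟨a, b, hb, rfl⟩
    have hu := IsLocalization.map_units (M := P.primeCompl)
      (LocalSubring.ofPrime T P).toSubring ⟨b, hb⟩
    rw [isUnit_subring_iff] at hu
    rw [div_eq_mul_inv]
    exact mul_mem (LocalSubring.le_ofPrime T P a.2) hu.2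

lemma mem_maxSet_ofPrime {T : Subring L} (P : Ideal T) [P.IsPrime] {z : T} :
    (z : L) ∈ maxSet (LocalSubring.ofPrime T P) ↔ z ∈ P := by
  have h := IsLocalization.AtPrime.to_map_mem_maximal_iff
    (LocalSubring.ofPrime T P).toSubring P z
  rw [← h, ← mem_maxSet_coe]
  rfl

lemma isLocalizationOf_ofPrime {T : Subring L} (P : Ideal T) [P.IsPrime] :
    IsLocalizationOf T (LocalSubring.ofPrime T P) := by
  refine ⟨LocalSubring.le_ofPrime T P, fun z hz => ?_⟩
  obtain ⟨a, b, hb, h⟩ := (mem_ofPrime_iff P).1 hz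
  exact ⟨a, a.2, b, b.2, fun h => hb ((mem_maxSet_ofPrime P).1 h), h⟩

/-- The denominators allowed in `S` remain units in `S'`. -/
lemma IsLocalizationOf.toSubring_le {T : Subring L} {S S' : LocalSubring L}
    (h : IsLocalizationOf T S) (h' : T ≤ S'.toSubring)
    (hm : ∀ z ∈ T, z ∈ maxSet S' → z ∈ maxSet S) : S.toSubring ≤ S'.toSubring := by
  intro z hz
  obtain ⟨a, ha, b, hb, hbm, rfl⟩ := h.2 z hz
  rw [div_eq_mul_inv]
  exact mul_mem (h' ha) (inv_mem_of_notMem_maxSet (h' hb) fun h => hbm (hm b hb h))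

lemma IsLocalizationOf.le {T : Subring L} {S S' : LocalSubring L}
    (h : IsLocalizationOf T S) (h' : T ≤ S'.toSubring)
    (hm : ∀ z ∈ T, z ∈ maxSet S' ↔ z ∈ maxSet S) : S ≤ S' := by
  refine le_iff_maxSet.2 ⟨h.toSubring_le h' fun z hz => (hm z hz).1, fun z hz => ?_⟩
  obtain ⟨a, ha, b, hb, hbm, rfl⟩ := h.2 z hz.1
  have hb0 := ne_zero_of_notMem_maxSet hbm
  have : a ∈ maxSet S := by
    have := mul_mem_maxSet (h.1 hb) hz
    rwa [mul_div_cancel₀ _ hb0] at this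
  rw [div_eq_inv_mul]
  exact mul_mem_maxSet (inv_mem_of_notMem_maxSet (h' hb) fun h => hbm ((hm b hb).1 h))
    ((hm a ha).2 this)

lemma IsLocalizationOf.ext {T : Subring L} {S S' : LocalSubring L}
    (h : IsLocalizationOf T S) (h' : IsLocalizationOf T S')
    (hm : ∀ z ∈ T, z ∈ maxSet S' ↔ z ∈ maxSet S) : S = S' :=
  le_antisymm (h.le h'.1 hm) (h'.le h.1 fun z hz => (hm z hz).symm)

/-- This allows the base ring of a chart to be replaced by a larger one inside `S`, for instance
k[t] by the field k(t). -/
lemma IsLocalizationOf.mono {T T' : Subring L} {S : LocalSubring L}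
    (h : IsLocalizationOf T S) (h1 : T ≤ T') (h2 : T' ≤ S.toSubring) : IsLocalizationOf T' S := by
  refine ⟨h2, fun z hz => ?_⟩
  obtain ⟨a, ha, b, hb, h3⟩ := h.2 z hz
  exact ⟨a, h1 ha, b, h1 hb, h3⟩

/-- The localization of `T` at the contraction of the maximal ideal of `S`. -/
lemma exists_center {T : Subring L} {S : LocalSubring L} (h : T ≤ S.toSubring) :
    LocalSubring.ofPrime T (contraction h) ≤ S := by
  refine (isLocalizationOf_ofPrime _).le h fun z hz => ?_
  rw [mem_maxSet_ofPrime (contraction h) (z := ⟨z, hz⟩), mem_contraction]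

lemma IsLocalizationOf.eq_ofPrime {T : Subring L} {S : LocalSubring L}
    (h : IsLocalizationOf T S) : S = LocalSubring.ofPrime T (contraction h.1) := by
  refine h.ext (isLocalizationOf_ofPrime _) fun z hz => ?_
  rw [mem_maxSet_ofPrime (contraction h.1) (z := ⟨z, hz⟩), mem_contraction]

lemma IsLocalizationOf.isNoetherianRing {T : Subring L} [IsNoetherianRing T]
    {S : LocalSubring L} (h : IsLocalizationOf T S) : IsNoetherianRing S.toSubring := by
  rw [h.eq_ofPrime]
  exact IsLocalization.isNoetherianRing (contraction h.1).primeCompl _ inferInstance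

/-- If `T` contains every element of `K` that is integral over it, so does `S`. -/
lemma IsLocalizationOf.mem_of_isIntegral {T : Subring L} {S : LocalSubring L}
    (h : IsLocalizationOf T S) {K : Set L} (hK : ∀ b ∈ T, ∀ z ∈ K, b * z ∈ K)
    (hT : ∀ z ∈ K, IsIntegral T z → z ∈ T) {z : L} (hz : z ∈ K)
    (hi : IsIntegral S.toSubring z) : z ∈ S.toSubring := by
  rw [h.eq_ofPrime] at hi ⊢
  obtain ⟨m, hm⟩ := IsIntegral.exists_multiple_integral_of_isLocalization
    (contraction h.1).primeCompl z hi
  have h1 : ((m : T) : L) * z ∈ T := hT _ (hK _ m.1.2 _ hz) hm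
  rw [mem_ofPrime_iff]
  refine ⟨⟨_, h1⟩, m, m.2, ?_⟩
  have hb0 : ((m : T) : L) ≠ 0 := by
    intro h0
    exact m.2 ((Subtype.ext h0 : (m : T) = 0) ▸ Ideal.zero_mem _)
  rw [mul_div_cancel_left₀ _ hb0]

lemma mem_valuationSubring_maxSet {V : ValuationSubring L} {z : L} (hz : z ∉ V) :
    z⁻¹ ∈ maxSet V.toLocalSubring := by
  refine ⟨(V.mem_or_inv_mem z).resolve_left hz, .inr ?_⟩
  rwa [inv_inv]

end LocalSubrings

/-! ### Regular and divisorial points; the maximal ideal of a localization of R[t]. -/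

section SurfacePoints

open Polynomial in
/-- The subring `R[t]`. -/
noncomputable def adjoinElement {L : Type*} [Field L] (R : Subring L) (t : L) : Subring L :=
  (Polynomial.eval₂RingHom R.subtype t).range

variable {L : Type*} [Field L]

lemma le_adjoinElement (R : Subring L) (t : L) : R ≤ adjoinElement R t :=
  fun r hr => ⟨Polynomial.C ⟨r, hr⟩, by simp⟩

lemma self_mem_adjoinElement (R : Subring L) (t : L) : t ∈ adjoinElement R t :=
  ⟨Polynomial.X, by simp⟩

lemma adjoinElement_le {R A : Subring L} {t : L} (hR : R ≤ A) (ht : t ∈ A) :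
    adjoinElement R t ≤ A := by
  rintro _ ⟨p, rfl⟩
  rw [Polynomial.coe_eval₂RingHom, Polynomial.eval₂_eq_sum_range]
  exact sum_mem fun i _ => mul_mem (hR (p.coeff i).2) (pow_mem ht i)

instance (R : Subring L) [IsNoetherianRing R] (t : L) : IsNoetherianRing (adjoinElement R t) :=
  isNoetherianRing_of_surjective _ _ (Polynomial.eval₂RingHom R.subtype t).rangeRestrict
    (RingHom.rangeRestrict_surjective _)

variable {k : Type*} [Field k] [Algebra k L]

/-- The elements of a local subring over `k` whose residues are algebraic over `k`. -/
def ResidueAlgebraic (k : Type*) [Field k] [Algebra k L] (S : LocalSubring L) (z : L) : Prop :=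
  ∃ p : Polynomial k, p ≠ 0 ∧ Polynomial.aeval z p ∈ maxSet S

/-- The pair `x`, `y` is a regular system of parameters of a two-dimensional local ring: it generates
the maximal ideal, and is a regular sequence. -/
structure IsParameterSystem (S : LocalSubring L) (x y : L) : Prop where
  left_mem : x ∈ maxSet S
  right_mem : y ∈ maxSet S
  right_ne_zero : y ≠ 0
  span : ∀ z ∈ maxSet S, ∃ a ∈ S.toSubring, ∃ b ∈ S.toSubring, z = a * x + b * y
  regular : ∀ a ∈ S.toSubring, ∀ b ∈ S.toSubring, a * x = b * y → ∃ c ∈ S.toSubring, a = c * y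

/-- A local subring over `k` of the function field `K` of a surface which is regular of dimension
two, with residue field algebraic over `k`. -/
structure IsRegularPoint (K : IntermediateField k L) (S : LocalSubring L) : Prop where
  noetherian : IsNoetherianRing S.toSubring
  normal : ∀ z ∈ K, IsIntegral S.toSubring z → z ∈ S.toSubring
  residueAlgebraic : ∀ z ∈ S.toSubring, ResidueAlgebraic k S z
  exists_parameters : ∃ x y, IsParameterSystem S x y

/-- A local subring of `K` which is a discrete valuation ring of `K`, or `K` itself. -/
def IsDivisorial (K : IntermediateField k L) (S : LocalSubring L) : Prop :=
  ∃ π ∈ S.toSubring, π ≠ 0 ∧ ∀ z ∈ K, z ≠ 0 → ∃ n : ℤ, z * π ^ n ∈ S.toSubring ∧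
    (z * π ^ n)⁻¹ ∈ S.toSubring

/-- The local rings occurring on regular surfaces with function field `K`. -/
structure IsSurfacePoint (K : IntermediateField k L) (S : LocalSubring L) : Prop where
  algebraMap_mem : ∀ c : k, algebraMap k L c ∈ S.toSubring
  subset : ∀ z ∈ S.toSubring, z ∈ K
  exists_div : ∀ z ∈ K, ∃ a ∈ S.toSubring, ∃ b ∈ S.toSubring, b ≠ 0 ∧ z = a / b
  divisorial_or_regular : IsDivisorial K S ∨ IsRegularPoint K S

/-- The sign of the exponent of `π` that turns z into a unit decides which of z, z⁻¹ lies in `S`. -/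
lemma IsDivisorial.mem_or_inv_mem {K : IntermediateField k L} {S : LocalSubring L}
    (h : IsDivisorial K S) {z : L} (hz : z ∈ K) : z ∈ S.toSubring ∨ z⁻¹ ∈ S.toSubring := by
  obtain ⟨π, hπ, h0, h⟩ := h
  rcases eq_or_ne z 0 with rfl | hz0
  · exact .inl (zero_mem _)
  obtain ⟨n, h1, h2⟩ := h z hz hz0
  have hp : π ^ n ≠ 0 := zpow_ne_zero _ h0
  rcases le_total 0 n with hn | hn
  · right
    lift n to ℕ using hn
    have : z⁻¹ = (z * π ^ (n : ℤ))⁻¹ * π ^ n := by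
      rw [zpow_natCast] at hp ⊢
      field_simp
    rw [this]
    exact mul_mem h2 (pow_mem hπ n)
  · left
    obtain ⟨m, rfl⟩ : ∃ m : ℕ, n = -m := ⟨n.natAbs, by omega⟩
    have : z = (z * π ^ (-(m : ℤ))) * π ^ m := by
      rw [zpow_neg, zpow_natCast] at hp ⊢
      have := pow_ne_zero m h0
      field_simp
    rw [this]
    exact mul_mem h1 (pow_mem hπ m)

/-- A Noetherian local ring whose maximal ideal is principal is divisorial. -/
lemma isDivisorial_of_principal {K : IntermediateField k L} {S : LocalSubring L}
    (hS : IsNoetherianRing S.toSubring)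
    (hfrac : ∀ z ∈ K, ∃ a ∈ S.toSubring, ∃ b ∈ S.toSubring, b ≠ 0 ∧ z = a / b)
    {x : L} (hx : x ∈ maxSet S) (hmax : ∀ z ∈ maxSet S, ∃ c ∈ S.toSubring, z = c * x) :
    IsDivisorial K S := by
  -- If x = 0, the ring is a field, hence all of `K`, and the unit 1 can serve as π.
  rcases eq_or_ne x 0 with rfl | hx0
  · have hu : ∀ a ∈ S.toSubring, a⁻¹ ∈ S.toSubring := by
      intro a ha
      by_cases h : a ∈ maxSet S
      · obtain ⟨c, -, rfl⟩ := hmax a h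
        simp
      · exact inv_mem_of_notMem_maxSet ha h
    refine ⟨1, one_mem _, one_ne_zero, fun z hz hz0 => ⟨0, ?_⟩⟩
    obtain ⟨a, ha, b, hb, hb0, rfl⟩ := hfrac z hz
    have : a / b ∈ S.toSubring := div_eq_mul_inv a b ▸ mul_mem ha (hu b hb)
    simpa using ⟨this, inv_div a b ▸ hu _ this⟩
  -- In a Noetherian domain a nonunit divides a nonzero element only finitely often; the cofactor
  -- left over is not divisible by x, hence is a unit.
  have key : ∀ a ∈ S.toSubring, a ≠ 0 → ∃ n : ℕ, ∃ u ∈ S.toSubring, u⁻¹ ∈ S.toSubring ∧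
      a = u * x ^ n := by
    intro a ha ha0
    have hnu : ¬ IsUnit (⟨x, hx.1⟩ : S.toSubring) := fun h =>
      notMem_maxSet_of_inv_mem (isUnit_subring_iff.1 h).1 (isUnit_subring_iff.1 h).2 hx
    have hfin : FiniteMultiplicity (⟨x, hx.1⟩ : S.toSubring) ⟨a, ha⟩ :=
      FiniteMultiplicity.of_not_isUnit hnu (fun h => ha0 (congrArg Subtype.val h))
    obtain ⟨u, hu, hud⟩ := hfin.exists_eq_pow_mul_and_not_dvd
    have hu' : (u : L) ∉ maxSet S := by
      intro h
      obtain ⟨c, hc, h⟩ := hmax _ h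
      exact hud ⟨⟨c, hc⟩, Subtype.ext (by simpa [mul_comm] using h)⟩
    refine ⟨multiplicity (⟨x, hx.1⟩ : S.toSubring) ⟨a, ha⟩, u, u.2, inv_mem_of_notMem_maxSet u.2 hu', ?_⟩
    have := congrArg Subtype.val hu
    simpa [mul_comm] using this
  refine ⟨x, hx.1, hx0, fun z hz hz0 => ?_⟩
  obtain ⟨a, ha, b, hb, hb0, rfl⟩ := hfrac z hz
  have ha0 : a ≠ 0 := by
    rintro rfl
    simp at hz0
  obtain ⟨n, u, hu, hu', rfl⟩ := key a ha ha0
  obtain ⟨m, v, hv, hv', rfl⟩ := key b hb hb0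
  have hu0 : u ≠ 0 := left_ne_zero_of_mul ha0
  have hv0 : v ≠ 0 := left_ne_zero_of_mul hb0
  have : u * x ^ n / (v * x ^ m) * x ^ ((m : ℤ) - n) = u * v⁻¹ := by
    rw [zpow_sub₀ hx0, zpow_natCast, zpow_natCast]
    have := pow_ne_zero n hx0
    have := pow_ne_zero m hx0
    field_simp
  refine ⟨m - n, ?_⟩
  rw [this]
  exact ⟨mul_mem hu hv', by rw [mul_inv, inv_inv]; exact mul_mem hu' hv⟩

open Polynomial in
/-- The maximal ideal of a localization of `R[t]` which contracts to a maximal ideal of `R`. -/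
lemma maxSet_of_isLocalizationOf_adjoinElement {R : Subring L} {t x : L} {S : LocalSubring L}
    (hloc : IsLocalizationOf (adjoinElement R t) S) (hx : x ∈ maxSet S)
    (hmax : ∀ r ∈ R, r ∉ maxSet S → ∃ s ∈ R, r * s - 1 ∈ maxSet S)
    (hm : ∀ r ∈ R, r ∈ maxSet S → ∃ c ∈ adjoinElement R t, r = c * x) :
    (∀ z ∈ maxSet S, ∃ c ∈ S.toSubring, z = c * x) ∨
    ∃ g : R[X], g.Monic ∧ g.eval₂ R.subtype t ∈ maxSet S ∧
      ∀ z ∈ maxSet S, ∃ a ∈ S.toSubring, ∃ b ∈ S.toSubring,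
        z = a * x + b * g.eval₂ R.subtype t := by
  have hRS : R ≤ S.toSubring := (le_adjoinElement R t).trans hloc.1
  have htS : t ∈ S.toSubring := hloc.1 (self_mem_adjoinElement R t)
  set m : Ideal R := contraction hRS
  have hmm : m.IsMaximal := by
    rw [Ideal.isMaximal_iff]
    refine ⟨fun h => one_notMem_maxSet S ((mem_contraction hRS).1 h), fun J r hmJ hrm hrJ => ?_⟩
    obtain ⟨s, hs, h⟩ := hmax r r.2 (fun h => hrm ((mem_contraction hRS).2 h))
    have h1 : r * ⟨s, hs⟩ - 1 ∈ J := hmJ ((mem_contraction hRS).2 h)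
    have := J.sub_mem (J.mul_mem_right ⟨s, hs⟩ hrJ) h1
    simpa using this
  let : Field (R ⧸ m) := Ideal.Quotient.field m
  let ev : R[X] →+* S.toSubring :=
    Polynomial.eval₂RingHom (Subring.inclusion hRS) ⟨t, htS⟩
  have hev : ∀ p : R[X], ((ev p : S.toSubring) : L) = p.eval₂ R.subtype t := by
    intro p
    have h : (S.toSubring.subtype.comp ev) p = p.eval₂ R.subtype t := by
      rw [← Polynomial.coe_eval₂RingHom]
      congr 1
      ext
      · simp [ev]
      · simp [ev]
    exact h
  let I : Ideal R[X] := (IsLocalRing.maximalIdeal S.toSubring).comap ev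
  have hI : ∀ p : R[X], p ∈ I ↔ p.eval₂ R.subtype t ∈ maxSet S := by
    intro p
    rw [Ideal.mem_comap, ← mem_maxSet_coe, hev]
  let φ : R[X] →+* (R ⧸ m)[X] := Polynomial.mapRingHom (Ideal.Quotient.mk m)
  have hφ : Function.Surjective φ :=
    Polynomial.map_surjective _ Ideal.Quotient.mk_surjective
  -- A polynomial with coefficients in `m` takes a value in x·R[t]. So, up to multiples of x, the
  -- maximal ideal of `S` can be computed in the principal ideal domain (R/m)[X].
  have hker : ∀ p : R[X], φ p = 0 → ∃ c ∈ adjoinElement R t, p.eval₂ R.subtype t = c * x := by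
    intro p hp
    have hc : ∀ i, ∃ c ∈ adjoinElement R t, ((p.coeff i : R) : L) = c * x := by
      intro i
      refine hm _ (p.coeff i).2 ((mem_contraction hRS).1 (Ideal.Quotient.eq_zero_iff_mem.1 ?_))
      have := congrArg (fun q => q.coeff i) hp
      simpa [φ] using this
    choose c hc hc' using hc
    refine ⟨∑ i ∈ Finset.range (p.natDegree + 1), c i * t ^ i, sum_mem fun i _ =>
      mul_mem (hc i) (pow_mem (self_mem_adjoinElement R t) i), ?_⟩
    rw [Polynomial.eval₂_eq_sum_range, Finset.sum_mul]
    refine Finset.sum_congr rfl fun i _ => ?_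
    rw [Subring.subtype_apply, hc']
    ring
  have hkerI : ∀ p : R[X], φ p = 0 → p ∈ I := by
    intro p hp
    obtain ⟨c, hc, h⟩ := hker p hp
    rw [hI, h]
    exact mul_mem_maxSet (hloc.1 hc) hx
  have hmapI : ∀ p, φ p ∈ I.map φ → p ∈ I := by
    intro p hp
    obtain ⟨q, hq, h⟩ := (Ideal.mem_map_iff_of_surjective φ hφ).1 hp
    have := I.add_mem (hkerI (p - q) (by rw [map_sub, h, sub_self])) hq
    simpa using this
  have hnum : ∀ z ∈ maxSet S, ∃ p ∈ I, ∃ b ∈ S.toSubring, z = b * p.eval₂ R.subtype t := by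
    intro z hz
    obtain ⟨a, ⟨p, rfl⟩, b, hb, hbm, rfl⟩ := hloc.2 z hz.1
    have hb0 := ne_zero_of_notMem_maxSet hbm
    refine ⟨p, (hI p).2 ?_, b⁻¹, inv_mem_of_notMem_maxSet (hloc.1 hb) hbm, ?_⟩
    · have := mul_mem_maxSet (hloc.1 hb) hz
      rwa [mul_div_cancel₀ _ hb0] at this
    · rw [div_eq_inv_mul]
      rfl
  obtain ⟨g₀, hg₀⟩ := (IsPrincipalIdealRing.principal (I.map φ)).principal
  rcases eq_or_ne g₀ 0 with rfl | hg0
  · left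
    intro z hz
    obtain ⟨p, hp, b, hb, rfl⟩ := hnum z hz
    have : φ p ∈ I.map φ := Ideal.mem_map_of_mem _ hp
    rw [hg₀] at this
    obtain ⟨c, hc, h⟩ := hker p (by simpa using this)
    exact ⟨b * c, mul_mem hb (hloc.1 hc), by rw [h, mul_assoc]⟩
  · right
    -- The generator is normalized and lifted to a monic polynomial: monicity later makes the
    -- residue of t integral over the residues of `R`.
    have hmon : (g₀ * Polynomial.C g₀.leadingCoeff⁻¹).Monic := Polynomial.monic_mul_leadingCoeff_inv hg0
    have hlift : g₀ * Polynomial.C g₀.leadingCoeff⁻¹ ∈ Polynomial.lifts (Ideal.Quotient.mk m) := by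
      rw [Polynomial.mem_lifts]
      exact hφ _
    obtain ⟨g, hgmap, -, hgm⟩ := Polynomial.lifts_and_natDegree_eq_and_monic hlift hmon
    have hgI : g ∈ I := hmapI g (by
      change Polynomial.map _ g ∈ _
      rw [hgmap, hg₀]
      exact Ideal.mul_mem_right _ _ (Submodule.mem_span_singleton_self _))
    refine ⟨g, hgm, (hI g).1 hgI, fun z hz => ?_⟩
    obtain ⟨p, hp, b, hb, rfl⟩ := hnum z hz
    have h1 : φ p ∈ I.map φ := Ideal.mem_map_of_mem _ hp
    rw [hg₀] at h1
    obtain ⟨q, hq⟩ := Ideal.mem_span_singleton'.1 h1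
    obtain ⟨q', hq'⟩ := hφ (q * Polynomial.C g₀.leadingCoeff)
    have h2 : φ (p - q' * g) = 0 := by
      rw [map_sub, map_mul, hq', ← hq]
      change _ - _ * Polynomial.map _ g = 0
      rw [hgmap]
      have : Polynomial.C g₀.leadingCoeff * Polynomial.C g₀.leadingCoeff⁻¹ = (1 : (R ⧸ m)[X]) := by
        rw [← Polynomial.C_mul, mul_inv_cancel₀ (leadingCoeff_ne_zero.2 hg0), Polynomial.C_1]
      linear_combination (-q * g₀) * this
    obtain ⟨c, hc, h⟩ := hker _ h2
    refine ⟨b * c, mul_mem hb (hloc.1 hc), b * q'.eval₂ R.subtype t,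
      mul_mem hb (hloc.1 ⟨q', rfl⟩), ?_⟩
    rw [Polynomial.eval₂_sub, Polynomial.eval₂_mul] at h
    linear_combination b * h

end SurfacePoints

/-! ### Algebraicity of residues, and a regularity criterion for localizations of R[t]. -/

section SurfacePoints

variable {L : Type*} [Field L] {k : Type*} [Field k] [Algebra k L]

lemma aeval_mem {A : Subring L} (hk : ∀ c : k, algebraMap k L c ∈ A) {z : L} (hz : z ∈ A)
    (p : Polynomial k) : Polynomial.aeval z p ∈ A := by
  rw [Polynomial.aeval_eq_sum_range]
  refine sum_mem fun i _ => ?_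
  rw [Algebra.smul_def]
  exact mul_mem (hk _) (pow_mem hz i)

/-- The structure map from `k` to the residue field of a local subring over `k`. -/
noncomputable def residueMap {S : LocalSubring L} (hk : ∀ c : k, algebraMap k L c ∈ S.toSubring) :
    k →+* IsLocalRing.ResidueField S.toSubring :=
  (IsLocalRing.residue S.toSubring).comp ((algebraMap k L).codRestrict S.toSubring hk)

/-- Over a field a nonzero polynomial can be made monic; in this form the ring structure and
transitivity of integral closure become available. -/
lemma residueAlgebraic_iff {S : LocalSubring L} (hk : ∀ c : k, algebraMap k L c ∈ S.toSubring)
    (z : S.toSubring) :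
    ResidueAlgebraic k S z ↔
      (residueMap hk).IsIntegralElem (IsLocalRing.residue S.toSubring z) := by
  have key : ∀ p : Polynomial k, Polynomial.aeval (z : L) p ∈ maxSet S ↔
      p.eval₂ (residueMap hk) (IsLocalRing.residue S.toSubring z) = 0 := by
    intro p
    rw [residueMap, ← Polynomial.hom_eval₂, IsLocalRing.residue_eq_zero_iff, ← mem_maxSet_coe]
    have := Polynomial.hom_eval₂ p ((algebraMap k L).codRestrict S.toSubring hk)
      S.toSubring.subtype z
    rw [show Polynomial.aeval (z : L) p = S.toSubring.subtype _ from this.symm]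
    rfl
  constructor
  · rintro ⟨p, hp, h⟩
    refine ⟨p * Polynomial.C p.leadingCoeff⁻¹, Polynomial.monic_mul_leadingCoeff_inv hp, ?_⟩
    rw [Polynomial.eval₂_mul, (key p).1 h, zero_mul]
  · rintro ⟨p, hp, h⟩
    exact ⟨p, hp.ne_zero, (key p).2 h⟩

/-- The elements of a local subring over `k` with residue algebraic over `k` form a subring. -/
noncomputable def residueAlgebraicSubring (S : LocalSubring L)
    (hk : ∀ c : k, algebraMap k L c ∈ S.toSubring) : Subring L :=
  letI := (residueMap hk).toAlgebra
  ((integralClosure k (IsLocalRing.ResidueField S.toSubring)).toSubring.comap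
    (IsLocalRing.residue S.toSubring)).map S.toSubring.subtype

lemma mem_residueAlgebraicSubring {S : LocalSubring L}
    (hk : ∀ c : k, algebraMap k L c ∈ S.toSubring) {z : L} :
    z ∈ residueAlgebraicSubring S hk ↔ z ∈ S.toSubring ∧ ResidueAlgebraic k S z := by
  let _ := (residueMap hk).toAlgebra
  constructor
  · rintro ⟨w, hw, rfl⟩
    exact ⟨w.2, (residueAlgebraic_iff hk w).2 hw⟩
  · rintro ⟨h, h'⟩
    exact ⟨⟨z, h⟩, (residueAlgebraic_iff hk ⟨z, h⟩).1 h', rfl⟩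

lemma algebraMap_mem_residueAlgebraicSubring {S : LocalSubring L}
    (hk : ∀ c : k, algebraMap k L c ∈ S.toSubring) (c : k) :
    algebraMap k L c ∈ residueAlgebraicSubring S hk :=
  (mem_residueAlgebraicSubring hk).2 ⟨hk c, Polynomial.X - Polynomial.C c,
    Polynomial.X_sub_C_ne_zero c, by simpa using zero_mem_maxSet S⟩

/-- The residue of t is a root of a monic polynomial over the integral closure of k in the residue
field, and integrality is transitive. -/
lemma mem_residueAlgebraicSubring_of_monic {S : LocalSubring L}
    (hk : ∀ c : k, algebraMap k L c ∈ S.toSubring) {R : Subring L}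
    (hR : R ≤ residueAlgebraicSubring S hk) {t : L} (ht : t ∈ S.toSubring)
    {g : Polynomial R} (hg : g.Monic) (h : g.eval₂ R.subtype t ∈ maxSet S) :
    t ∈ residueAlgebraicSubring S hk := by
  refine (mem_residueAlgebraicSubring hk).2 ⟨ht, (residueAlgebraic_iff hk ⟨t, ht⟩).2 ?_⟩
  let _ := (residueMap hk).toAlgebra
  have hRS : R ≤ S.toSubring := fun r hr => ((mem_residueAlgebraicSubring hk).1 (hR hr)).1
  let ρ : R →+* integralClosure k (IsLocalRing.ResidueField S.toSubring) :=
    ((IsLocalRing.residue S.toSubring).comp (Subring.inclusion hRS)).codRestrict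
      (integralClosure k (IsLocalRing.ResidueField S.toSubring)) (fun r =>
        (residueAlgebraic_iff hk ⟨r, hRS r.2⟩).1 ((mem_residueAlgebraicSubring hk).1 (hR r.2)).2)
  have h1 : IsIntegral (integralClosure k (IsLocalRing.ResidueField S.toSubring))
      (IsLocalRing.residue S.toSubring ⟨t, ht⟩) := by
    refine ⟨g.map ρ, hg.map ρ, ?_⟩
    rw [Polynomial.eval₂_map]
    have h2 : (algebraMap (integralClosure k (IsLocalRing.ResidueField S.toSubring))
        (IsLocalRing.ResidueField S.toSubring)).comp ρ =
        (IsLocalRing.residue S.toSubring).comp (Subring.inclusion hRS) := rfl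
    rw [h2, ← Polynomial.hom_eval₂, IsLocalRing.residue_eq_zero_iff, ← mem_maxSet_coe,
      ← Subring.subtype_apply, Polynomial.hom_eval₂]
    exact h
  exact isIntegral_trans _ h1

lemma residueAlgebraic_of_isLocalizationOf {S : LocalSubring L} {T : Subring L}
    (hk : ∀ c : k, algebraMap k L c ∈ S.toSubring) (h : IsLocalizationOf T S)
    (hT : T ≤ residueAlgebraicSubring S hk) {z : L} (hz : z ∈ S.toSubring) :
    ResidueAlgebraic k S z := by
  let _ := (residueMap hk).toAlgebra
  obtain ⟨a, ha, b, hb, hbm, rfl⟩ := h.2 z hz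
  have hb0 := ne_zero_of_notMem_maxSet hbm
  have hbi := inv_mem_of_notMem_maxSet (h.1 hb) hbm
  have h1 := ((residueAlgebraic_iff hk ⟨a, h.1 ha⟩).1 ((mem_residueAlgebraicSubring hk).1 (hT ha)).2)
  have h2 := ((residueAlgebraic_iff hk ⟨b, h.1 hb⟩).1 ((mem_residueAlgebraicSubring hk).1 (hT hb)).2)
  have h3 : IsIntegral k (IsLocalRing.residue S.toSubring ⟨b, h.1 hb⟩)⁻¹ :=
    IsIntegral.inv h2
  have h4 := IsIntegral.mul (R := k) h1 h3
  refine (residueAlgebraic_iff hk ⟨a / b, hz⟩).2 ?_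
  have hne : IsLocalRing.residue S.toSubring ⟨b, h.1 hb⟩ ≠ 0 := by
    rw [Ne, IsLocalRing.residue_eq_zero_iff, ← mem_maxSet_coe]
    exact hbm
  have heq : IsLocalRing.residue S.toSubring ⟨a / b, hz⟩ =
      IsLocalRing.residue S.toSubring ⟨a, h.1 ha⟩ *
        (IsLocalRing.residue S.toSubring ⟨b, h.1 hb⟩)⁻¹ := by
    rw [eq_mul_inv_iff_mul_eq₀ hne, ← map_mul]
    congr 1
    exact Subtype.ext (div_mul_cancel₀ a hb0)
  rw [heq]
  exact h4

/-- A local ring on a surface obtained by localizing `R[t]`, where `R` is local of dimension at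
most one or the chart of a blow-up is `R[t]`. -/
theorem isSurfacePoint_of_isLocalizationOf_adjoinElement {K : IntermediateField k L}
    {R : Subring L} {t x : L} {S : LocalSubring L}
    (hloc : IsLocalizationOf (adjoinElement R t) S) (hx : x ∈ maxSet S)
    (hmax : ∀ r ∈ R, r ∉ maxSet S → ∃ s ∈ R, r * s - 1 ∈ maxSet S)
    (hm : ∀ r ∈ R, r ∈ maxSet S → ∃ c ∈ adjoinElement R t, r = c * x)
    (hk : ∀ c : k, algebraMap k L c ∈ S.toSubring)
    (hK : ∀ z ∈ S.toSubring, z ∈ K)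
    (hfrac : ∀ z ∈ K, ∃ a ∈ S.toSubring, ∃ b ∈ S.toSubring, b ≠ 0 ∧ z = a / b)
    (hnoeth : IsNoetherianRing S.toSubring)
    (hnormal : ∀ z ∈ K, IsIntegral S.toSubring z → z ∈ S.toSubring)
    (hprime : x ≠ 0 → ∀ a ∈ adjoinElement R t, ∀ b ∈ adjoinElement R t,
      (∃ c ∈ adjoinElement R t, a * b = c * x) →
      (∃ c ∈ adjoinElement R t, a = c * x) ∨ ∃ c ∈ adjoinElement R t, b = c * x)
    (hres : x ≠ 0 → R ≤ residueAlgebraicSubring S hk) :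
    IsSurfacePoint K S := by
  refine ⟨hk, hK, hfrac, ?_⟩
  by_cases hdiv : ∀ z ∈ maxSet S, ∃ c ∈ S.toSubring, z = c * x
  · exact .inl (isDivisorial_of_principal hnoeth hfrac hx hdiv)
  obtain ⟨g, hg, hgm, hgen⟩ :=
    (maxSet_of_isLocalizationOf_adjoinElement hloc hx hmax hm).resolve_left hdiv
  set y := g.eval₂ R.subtype t with hy
  -- The value x = 0 encodes a base whose maximal ideal contracts to zero; then y alone generates
  -- the maximal ideal.
  rcases eq_or_ne x 0 with rfl | hx0
  · refine .inl (isDivisorial_of_principal hnoeth hfrac hgm fun z hz => ?_)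
    obtain ⟨a, -, b, hb, rfl⟩ := hgen z hz
    exact ⟨b, hb, by simp⟩
  right
  have htr := mem_residueAlgebraicSubring_of_monic hk (hres hx0)
    (hloc.1 (self_mem_adjoinElement R t)) hg hgm
  -- Otherwise x alone would generate the maximal ideal, which is the case already settled.
  have hyx : ¬ ∃ c ∈ adjoinElement R t, y = c * x := by
    rintro ⟨c, hc, h⟩
    refine hdiv fun z hz => ?_
    obtain ⟨a, ha, b, hb, rfl⟩ := hgen z hz
    exact ⟨a + b * c, add_mem ha (mul_mem hb (hloc.1 hc)), by rw [h]; ring⟩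
  refine ⟨hnoeth, hnormal, fun z hz => residueAlgebraic_of_isLocalizationOf hk hloc
    (adjoinElement_le (hres hx0) htr) hz, x, y, hx, hgm, fun h => hyx ⟨0, zero_mem _, by rw [h, zero_mul]⟩, hgen,
    fun a ha b hb hab => ?_⟩
  obtain ⟨a₁, ha₁, s, hs, hsm, rfl⟩ := hloc.2 a ha
  obtain ⟨b₁, hb₁, s', hs', hsm', rfl⟩ := hloc.2 b hb
  have hs0 := ne_zero_of_notMem_maxSet hsm
  have hs0' := ne_zero_of_notMem_maxSet hsm'
  have hyT : y ∈ adjoinElement R t := ⟨g, rfl⟩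
  -- With denominators cleared, x divides b₁·s·y in R[t] but not y. As x generates a prime ideal
  -- there, it divides b₁·s, and cancelling x shows that y divides the numerator a₁ up to units.
  have hyeq : b₁ * s * y = a₁ * s' * x := by
    field_simp at hab
    linear_combination -hab
  obtain ⟨c, hc, h⟩ := (hprime hx0 (b₁ * s) (mul_mem hb₁ hs) y hyT
    ⟨a₁ * s', mul_mem ha₁ hs', hyeq⟩).resolve_right hyx
  refine ⟨c * s⁻¹ * s'⁻¹, mul_mem (mul_mem (hloc.1 hc)
    (inv_mem_of_notMem_maxSet (hloc.1 hs) hsm)) (inv_mem_of_notMem_maxSet (hloc.1 hs') hsm'), ?_⟩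
  rw [h] at hyeq
  have : a₁ * s' = c * y := mul_right_cancel₀ hx0 (by linear_combination -hyeq)
  field_simp
  linear_combination this

end SurfacePoints

/-! ### The chart R[y/x] of the blow-up of a regular point: analytic independence, primality of x,
normality. -/

section BlowUpChart

variable {L : Type*} [Field L]

lemma IsParameterSystem.left_ne_zero {R : LocalSubring L} {x y : L}
    (h : IsParameterSystem R x y) : x ≠ 0 := by
  rintro rfl
  obtain ⟨c, hc, h1⟩ := h.regular 1 (one_mem _) 0 (zero_mem _) (by simp)
  exact one_notMem_maxSet R (h1 ▸ mul_mem_maxSet hc h.right_mem)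

/-- The definition is asymmetric in x and y, while both charts of the blow-up are needed. -/
lemma IsParameterSystem.symm {R : LocalSubring L} {x y : L}
    (h : IsParameterSystem R x y) : IsParameterSystem R y x where
  left_mem := h.right_mem
  right_mem := h.left_mem
  right_ne_zero := h.left_ne_zero
  span z hz := by
    obtain ⟨a, ha, b, hb, rfl⟩ := h.span z hz
    exact ⟨b, hb, a, ha, add_comm _ _⟩
  regular a ha b hb hab := by
    obtain ⟨c, hc, rfl⟩ := h.regular b hb a ha hab.symm
    exact ⟨c, hc, mul_right_cancel₀ h.right_ne_zero (by linear_combination hab)⟩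

/-- Multiplication by y is injective modulo x, by regularity of the swapped pair; this is used n
times. -/
lemma IsParameterSystem.dvd_of_mul_pow {R : LocalSubring L} {x y : L}
    (h : IsParameterSystem R x y) (n : ℕ) : ∀ a ∈ R.toSubring, ∀ b ∈ R.toSubring,
    a * y ^ n = b * x → ∃ c ∈ R.toSubring, a = c * x := by
  induction n with
  | zero => exact fun a _ b hb hab => ⟨b, hb, by simpa using hab⟩
  | succ n ih =>
    intro a ha b hb hab
    obtain ⟨c, hc, h1⟩ := h.symm.regular (a * y ^ n) (mul_mem ha (pow_mem h.right_mem.1 n)) b hb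
      (by linear_combination hab)
    exact ih a ha c hc h1

open Polynomial in
/-- If the leading coefficient `c` of every polynomial relation for `t` satisfies `c ∈ 𝔪` and
`c * t ∈ 𝔪`, then all the coefficients of such relations lie in `𝔪`. -/
lemma coeff_mem_maxSet_of_leadingCoeff {R : LocalSubring L} {t : L}
    (ht : ∀ (n : ℕ) (p : R.toSubring[X]), p.natDegree ≤ n + 1 →
      p.eval₂ R.toSubring.subtype t = 0 → ((p.coeff (n + 1) : R.toSubring) : L) ∈ maxSet R ∧
        ((p.coeff (n + 1) : R.toSubring) : L) * t ∈ maxSet R) (n : ℕ) :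
    ∀ p : R.toSubring[X], p.natDegree ≤ n → p.eval₂ R.toSubring.subtype t = 0 →
      ∀ i, ((p.coeff i : R.toSubring) : L) ∈ maxSet R := by
  induction n with
  | zero =>
    intro p hp h0 i
    rw [Polynomial.eq_C_of_natDegree_le_zero hp, Polynomial.eval₂_C, Subring.subtype_apply] at h0
    have : p = 0 := by
      rw [Polynomial.eq_C_of_natDegree_le_zero hp,
        show p.coeff 0 = 0 from Subtype.ext h0, Polynomial.C_0]
    simpa [this] using zero_mem_maxSet R
  | succ n ih =>
    intro p hp h0
    obtain ⟨hm, hmt⟩ := ht n p hp h0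
    let d : R.toSubring := ⟨_, hmt.1⟩
    -- With c the coefficient in degree n + 1, the term c·tⁿ⁺¹ is rewritten as (c·t)·tⁿ, and c·t
    -- lies in the ring. This lowers the degree, and since c·t lies in 𝔪, the coefficients of `q`
    -- and `p` in degree n agree modulo 𝔪.
    let q : R.toSubring[X] := p - Polynomial.monomial (n + 1) (p.coeff (n + 1)) +
      Polynomial.monomial n d
    have hq : ∀ i, q.coeff i = p.coeff i - (if n + 1 = i then p.coeff (n + 1) else 0) +
        if n = i then d else 0 := by
      intro i
      simp [q, Polynomial.coeff_monomial]
    have hqd : q.natDegree ≤ n := by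
      rw [Polynomial.natDegree_le_iff_coeff_eq_zero]
      intro i hi
      rw [hq]
      rcases eq_or_ne (n + 1) i with rfl | hi'
      · simp
      · rw [if_neg hi', if_neg (by omega), Polynomial.coeff_eq_zero_of_natDegree_lt (by omega)]
        simp
    have hq0 : q.eval₂ R.toSubring.subtype t = 0 := by
      simp only [q, d, Polynomial.eval₂_add, Polynomial.eval₂_sub, Polynomial.eval₂_monomial, h0,
        Subring.subtype_apply]
      ring
    intro i
    have h5 := ih q hqd hq0 i
    rw [hq] at h5
    rcases eq_or_ne (n + 1) i with rfl | hi
    · exact hm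
    rw [if_neg hi] at h5
    rcases eq_or_ne n i with rfl | hi'
    · have := sub_mem_maxSet h5 hmt
      simpa [d] using this
    · simpa [hi'] using h5

open Polynomial in
/-- Parameters are analytically independent: the coefficients of a polynomial relation satisfied by
`y / x` lie in the maximal ideal. -/
lemma IsParameterSystem.coeff_mem_maxSet {R : LocalSubring L} {x y : L}
    (h : IsParameterSystem R x y) {p : R.toSubring[X]}
    (hp : p.eval₂ R.toSubring.subtype (y / x) = 0) (i : ℕ) :
    ((p.coeff i : R.toSubring) : L) ∈ maxSet R := by
  have hx0 := h.left_ne_zero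
  refine coeff_mem_maxSet_of_leadingCoeff (fun n p hp h0 => ?_) p.natDegree p le_rfl hp i
  set c : L := ((p.coeff (n + 1) : R.toSubring) : L) with hc
  have h1 : ∑ i ∈ Finset.range (n + 1), ((p.coeff i : R.toSubring) : L) * (y / x) ^ i +
      c * (y / x) ^ (n + 1) = 0 := by
    rw [← h0, Polynomial.eval₂_eq_sum_range' _ (n := n + 2) (by omega),
      Finset.sum_range_succ _ (n + 1)]
    rfl
  -- Multiplying the relation by xⁿ⁺¹ makes every term except the top one divisible by x inside `R`.
  -- Hence x divides c, and c·(y/x) is a multiple of y.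
  have h2 : c * y ^ (n + 1) =
      (-∑ i ∈ Finset.range (n + 1), ((p.coeff i : R.toSubring) : L) * y ^ i * x ^ (n - i)) * x := by
    have h3 : c * y ^ (n + 1) = c * (y / x) ^ (n + 1) * x ^ (n + 1) := by
      rw [div_pow, mul_assoc, div_mul_cancel₀ _ (pow_ne_zero _ hx0)]
    have h4 : (∑ i ∈ Finset.range (n + 1), ((p.coeff i : R.toSubring) : L) * y ^ i * x ^ (n - i))
        * x = (∑ i ∈ Finset.range (n + 1), ((p.coeff i : R.toSubring) : L) * (y / x) ^ i)
          * x ^ (n + 1) := by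
      rw [Finset.sum_mul, Finset.sum_mul]
      refine Finset.sum_congr rfl fun i hi => ?_
      have hi' : n + 1 = i + (n - i) + 1 := by
        have := Finset.mem_range.1 hi
        omega
      rw [hi', pow_add, pow_add, div_pow]
      have := pow_ne_zero i hx0
      field_simp
    rw [neg_mul, h4, h3]
    linear_combination x ^ (n + 1) * h1
  obtain ⟨d, hd, hcd⟩ := h.dvd_of_mul_pow (n + 1) c (p.coeff (n + 1)).2 _
    (neg_mem (sum_mem fun i _ => mul_mem (mul_mem (p.coeff i).2 (pow_mem h.right_mem.1 i))
      (pow_mem h.left_mem.1 _))) h2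
  rw [hcd, mul_assoc, mul_div_cancel₀ _ hx0]
  exact ⟨mul_mem_maxSet hd h.left_mem, mul_mem_maxSet hd h.right_mem⟩

/-- Since ax + by = (a + b·(y/x))·x, the maximal ideal becomes principal in the chart; x is the
equation of the exceptional divisor. -/
lemma IsParameterSystem.span_chart {R : LocalSubring L} {x y : L}
    (h : IsParameterSystem R x y) {z : L} (hz : z ∈ maxSet R) :
    ∃ c ∈ adjoinElement R.toSubring (y / x), z = c * x := by
  have hx0 := h.left_ne_zero
  obtain ⟨a, ha, b, hb, rfl⟩ := h.span z hz
  refine ⟨a + b * (y / x), add_mem (le_adjoinElement _ _ ha) (mul_mem (le_adjoinElement _ _ hb)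
    (self_mem_adjoinElement _ _)), ?_⟩
  field_simp

open Polynomial in
/-- The exceptional divisor of the chart `R[y / x]` is reduced and irreducible. -/
lemma IsParameterSystem.prime_chart {R : LocalSubring L} {x y : L}
    (h : IsParameterSystem R x y) : ∀ a ∈ adjoinElement R.toSubring (y / x),
      ∀ b ∈ adjoinElement R.toSubring (y / x),
      (∃ c ∈ adjoinElement R.toSubring (y / x), a * b = c * x) →
      (∃ c ∈ adjoinElement R.toSubring (y / x), a = c * x) ∨
        ∃ c ∈ adjoinElement R.toSubring (y / x), b = c * x := by
  let m := IsLocalRing.maximalIdeal R.toSubring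
  -- By analytic independence the ideal x·R[y/x] pulls back to 𝔪R[X], which is prime because
  -- (R/𝔪)[X] is a domain.
  have key : ∀ p : R.toSubring[X], (∃ c ∈ adjoinElement R.toSubring (y / x),
      p.eval₂ R.toSubring.subtype (y / x) = c * x) ↔ p ∈ m.map Polynomial.C := by
    intro p
    rw [Ideal.mem_map_C_iff]
    constructor
    · rintro ⟨_, ⟨q, rfl⟩, hq⟩ i
      have h1 := h.coeff_mem_maxSet (p := p - q * Polynomial.C (⟨x, h.left_mem.1⟩ : R.toSubring)) (by
        rw [Polynomial.eval₂_sub, Polynomial.eval₂_mul, Polynomial.eval₂_C, hq]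
        exact sub_self _) i
      rw [Polynomial.coeff_sub, Polynomial.coeff_mul_C] at h1
      have h2 := add_mem_maxSet h1 (mul_mem_maxSet (q.coeff i).2 h.left_mem)
      rw [← mem_maxSet_coe]
      simpa using h2
    · intro hp
      choose c hc hc' using fun i => h.span_chart (mem_maxSet_coe.2 (hp i))
      refine ⟨∑ i ∈ Finset.range (p.natDegree + 1), c i * (y / x) ^ i, sum_mem fun i _ =>
        mul_mem (hc i) (pow_mem (self_mem_adjoinElement _ _) i), ?_⟩
      rw [Polynomial.eval₂_eq_sum_range, Finset.sum_mul]
      refine Finset.sum_congr rfl fun i _ => ?_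
      rw [Subring.subtype_apply, hc']
      ring
  rintro _ ⟨p, rfl⟩ _ ⟨q, rfl⟩ hpq
  have hprime : (m.map (Polynomial.C : R.toSubring →+* R.toSubring[X])).IsPrime :=
    Ideal.isPrime_map_C_of_isPrime
  rw [← map_mul] at hpq
  exact (hprime.mem_or_mem ((key _).1 hpq)).imp (key _).2 (key _).2

variable {k : Type*} [Field k] [Algebra k L]

open Polynomial in
/-- An element which is integral over the chart `R[y / x]` lies in it. -/
lemma IsParameterSystem.normal_chart {K : IntermediateField k L} {R : LocalSubring L} {x y : L}
    (h : IsParameterSystem R x y) (hR : ∀ z ∈ R.toSubring, z ∈ K)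
    (hnormal : ∀ z ∈ K, IsIntegral R.toSubring z → z ∈ R.toSubring) {z : L} (hz : z ∈ K)
    (hi : IsIntegral (adjoinElement R.toSubring (y / x)) z) :
    z ∈ adjoinElement R.toSubring (y / x) := by
  set T := adjoinElement R.toSubring (y / x) with hT
  have hx0 := h.left_ne_zero
  have hxT : x ∈ T := le_adjoinElement _ _ h.left_mem.1
  have hclear : ∀ w ∈ T, ∃ n : ℕ, ∀ m, n ≤ m → w * x ^ m ∈ R.toSubring := by
    rintro _ ⟨p, rfl⟩
    refine ⟨p.natDegree, fun m hm => ?_⟩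
    rw [Polynomial.coe_eval₂RingHom, Polynomial.eval₂_eq_sum_range, Finset.sum_mul]
    refine sum_mem fun i hi => ?_
    have hi' : m = i + (m - i) := by
      have := Finset.mem_range.1 hi
      omega
    have : R.toSubring.subtype (p.coeff i) * (y / x) ^ i * x ^ m =
        (p.coeff i : L) * y ^ i * x ^ (m - i) := by
      conv_lhs => rw [hi', pow_add, div_pow]
      have := pow_ne_zero i hx0
      simp only [Subring.subtype_apply]
      field_simp
    rw [this]
    exact mul_mem (mul_mem (p.coeff i).2 (pow_mem h.right_mem.1 _)) (pow_mem h.left_mem.1 _)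
  obtain ⟨q, hq, hq0⟩ := hi
  -- Here u = z·xⁿ is integral over `T` and x·u lies in `T`. The integral equation shows that x
  -- divides a power of x·u; as x·T is prime or the unit ideal, x divides x·u itself, so u lies in
  -- `T`.
  have hstep : ∀ n : ℕ, z * x ^ n ∈ T → z ∈ T := by
    intro n
    induction n with
    | zero => intro h; simpa using h
    | succ n ih =>
      intro hn
      refine ih ?_
      have hu : IsIntegral T (z * x ^ n) :=
        IsIntegral.mul ⟨q, hq, hq0⟩ (IsIntegral.pow (isIntegral_algebraMap (x := (⟨x, hxT⟩ : T))) n)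
      obtain ⟨r, hr, hr0⟩ := hu
      have hdvd := Polynomial.dvd_pow_natDegree_of_eval₂_eq_zero (f := algebraMap T L)
        Subtype.val_injective hr ⟨x, hxT⟩ ⟨z * x ^ (n + 1), hn⟩ _ hr0 (by
          change x * (z * x ^ n) = z * x ^ (n + 1)
          ring)
      have hpow : ∀ m : ℕ, (∃ c ∈ T, (z * x ^ (n + 1)) ^ m = c * x) →
          (∃ c ∈ T, z * x ^ (n + 1) = c * x) ∨ ∃ c ∈ T, 1 = c * x := by
        intro m
        induction m with
        | zero => intro h; right; simpa using h
        | succ m ihm =>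
          intro hm
          rw [pow_succ] at hm
          exact (h.prime_chart _ (pow_mem hn m) _ hn hm).elim ihm .inl
      obtain ⟨c, hc⟩ := hdvd
      have hc' := congrArg Subtype.val hc
      rcases hpow r.natDegree ⟨c, c.2, by simpa [mul_comm] using hc'⟩ with ⟨d, hd, h1⟩ | ⟨d, hd, h1⟩
      · have : z * x ^ n = d := mul_right_cancel₀ hx0 (by rw [← h1]; ring)
        rwa [this]
      · have : z * x ^ n = z * x ^ (n + 1) * d := by linear_combination z * x ^ n * h1
        rw [this]
        exact mul_mem hn hd
  choose N hN using fun i => hclear (q.coeff i) (q.coeff i).2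
  -- The sum is a common bound for the clearing exponents. Scaling roots by xᴹ multiplies the i-th
  -- coefficient by x to the power M·(deg − i), which is at least `N i` below the leading term, so
  -- z·xᴹ is integral over `R`.
  let M := ∑ i ∈ Finset.range (q.natDegree + 1), N i
  have hM : ∀ i ≤ q.natDegree, N i ≤ M := fun i hi =>
    Finset.single_le_sum (f := N) (fun _ _ => Nat.zero_le _) (Finset.mem_range.2 (by omega))
  set Q := (q.map T.subtype).scaleRoots (x ^ M) with hQ
  have hQm : Q.Monic := (Polynomial.monic_scaleRoots_iff _).2 (hq.map _)
  have hnd : (q.map T.subtype).natDegree = q.natDegree := hq.natDegree_map _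
  have hcoeff : ∀ i, Q.coeff i ∈ R.toSubring := by
    intro i
    rw [hQ, Polynomial.coeff_scaleRoots, hnd, Polynomial.coeff_map, Subring.subtype_apply]
    rcases lt_trichotomy i q.natDegree with hi | rfl | hi
    · rw [← pow_mul]
      exact hN i _ ((hM i hi.le).trans (Nat.le_mul_of_pos_right _ (by omega)))
    · have : q.coeff q.natDegree = 1 := hq
      rw [this]
      simp
    · rw [Polynomial.coeff_eq_zero_of_natDegree_lt hi]
      simp
  have hcs : (↑Q.coeffs : Set L) ⊆ R.toSubring := by
    intro c hc
    obtain ⟨i, -, rfl⟩ := Polynomial.mem_coeffs_iff.1 hc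
    exact hcoeff i
  have hint : IsIntegral R.toSubring (z * x ^ M) := by
    refine ⟨Q.toSubring R.toSubring hcs, (Polynomial.monic_toSubring _ _ _).2 hQm, ?_⟩
    have h1 : (Q.toSubring R.toSubring hcs).eval₂ R.toSubring.subtype (z * x ^ M) =
        Q.eval (z * x ^ M) := by
      rw [← Polynomial.eval_map, Polynomial.map_toSubring]
    refine h1.trans ?_
    rw [hQ, mul_comm z, Polynomial.scaleRoots_eval_mul, Polynomial.eval_map]
    rw [show q.eval₂ T.subtype z = 0 from hq0, mul_zero]
  exact hstep M (le_adjoinElement _ _ (hnormal _ (mul_mem hz (pow_mem (hR _ h.left_mem.1) M)) hint))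

end BlowUpChart

/-! ### The fibre of the blow-up: its two charts, and centers of valuation rings. -/

section BlowUpFibre

variable {L : Type*} [Field L] {k : Type*} [Field k] [Algebra k L]

lemma IsParameterSystem.le_of_isLocalizationOf {R S : LocalSubring L} {x y : L}
    (h : IsParameterSystem R x y) (hloc : IsLocalizationOf (adjoinElement R.toSubring (y / x)) S)
    (hx : x ∈ maxSet S) : R ≤ S := by
  refine le_iff_maxSet.2 ⟨(le_adjoinElement _ _).trans hloc.1, fun z hz => ?_⟩
  obtain ⟨c, hc, rfl⟩ := h.span_chart hz
  exact mul_mem_maxSet (hloc.1 hc) hx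

lemma ResidueAlgebraic.of_le {R S : LocalSubring L} (h : R ≤ S) {z : L}
    (hz : ResidueAlgebraic k R z) : ResidueAlgebraic k S z := by
  obtain ⟨p, hp, h'⟩ := hz
  exact ⟨p, hp, mem_maxSet_of_le h h'⟩

/-- The points of a chart of the blow-up of a regular point are again points of a regular
surface. -/
theorem isSurfacePoint_of_chart {K : IntermediateField k L} {R S : LocalSubring L} {x y : L}
    (hR : IsSurfacePoint K R) (hreg : IsRegularPoint K R) (h : IsParameterSystem R x y)
    (hloc : IsLocalizationOf (adjoinElement R.toSubring (y / x)) S) (hx : x ∈ maxSet S) :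
    IsSurfacePoint K S := by
  have hle := h.le_of_isLocalizationOf hloc hx
  have hxK := hR.subset x h.left_mem.1
  have hyK := hR.subset y h.right_mem.1
  have hTK : adjoinElement R.toSubring (y / x) ≤ K.toSubring :=
    adjoinElement_le (fun z hz => hR.subset z hz) (K.div_mem hyK hxK)
  have hk : ∀ c : k, algebraMap k L c ∈ S.toSubring := fun c => hle.1 (hR.algebraMap_mem c)
  have := hreg.noetherian
  refine isSurfacePoint_of_isLocalizationOf_adjoinElement hloc hx (fun r hr hrS => ?_)
    (fun r hr hrS => h.span_chart (mem_maxSet_of_mem hle.1 hr hrS)) hk (fun z hz => ?_)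
    (fun z hz => ?_) hloc.isNoetherianRing (fun z hz hi => ?_) (fun _ => h.prime_chart)
    (fun _ r hr => ?_)
  · have hrR : r ∉ maxSet R := fun h => hrS (mem_maxSet_of_le hle h)
    refine ⟨r⁻¹, inv_mem_of_notMem_maxSet hr hrR, ?_⟩
    rw [mul_inv_cancel₀ (ne_zero_of_notMem_maxSet hrR), sub_self]
    exact zero_mem_maxSet S
  · obtain ⟨a, ha, b, hb, -, rfl⟩ := hloc.2 z hz
    exact K.div_mem (hTK ha) (hTK hb)
  · obtain ⟨a, ha, b, hb, h1⟩ := hR.exists_div z hz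
    exact ⟨a, hle.1 ha, b, hle.1 hb, h1⟩
  · exact hloc.mem_of_isIntegral (K := (K : Set L)) (fun b hb z hz => mul_mem (hTK hb) hz)
      (fun z hz hi => h.normal_chart hR.subset hreg.normal hz hi) hz hi
  · exact (mem_residueAlgebraicSubring hk).2
      ⟨hle.1 hr, (hreg.residueAlgebraic r hr).of_le hle⟩

lemma le_blowUpChart (R : LocalSubring L) (a : L) : R.toSubring ≤ blowUpChart R a :=
  fun _ hz => Subring.subset_closure (.inl hz)

lemma div_mem_blowUpChart (R : LocalSubring L) (a : L) {b : L} (hb : b ∈ maxSet R) :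
    b / a ∈ blowUpChart R a :=
  Subring.subset_closure (.inr ⟨⟨b, hb.1⟩, mem_maxSet_coe.1 hb, rfl⟩)

lemma blowUpChart_le {R : LocalSubring L} {a : L} {A : Subring L} (hR : R.toSubring ≤ A)
    (h : ∀ b ∈ maxSet R, b / a ∈ A) : blowUpChart R a ≤ A := by
  refine Subring.closure_le.2 ?_
  rintro z (hz | ⟨b, hb, rfl⟩)
  · exact hR hz
  · exact h b (mem_maxSet_coe.2 hb)

lemma mem_blowUpFibre_iff {R S : LocalSubring L} : S ∈ blowUpFibre R ↔
    R ≤ S ∧ ∃ a ∈ maxSet R, a ≠ 0 ∧ IsLocalizationOf (blowUpChart R a) S := by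
  constructor
  · rintro ⟨hle, a, ha, ha0, P, hP, rfl⟩
    exact ⟨hle, a, mem_maxSet_coe.2 ha, fun h => ha0 (Subtype.ext h), isLocalizationOf_ofPrime P⟩
  · rintro ⟨hle, a, ha, ha0, hloc⟩
    exact ⟨hle, ⟨a, ha.1⟩, mem_maxSet_coe.1 ha, fun h => ha0 (congrArg Subtype.val h),
      contraction hloc.1, inferInstance, hloc.eq_ofPrime⟩

/-- Every point of the blow-up lies in the chart given by a parameter that is minimal there. -/
lemma isLocalizationOf_chart_of_div_notMem {R S : LocalSubring L} {x y a : L}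
    (h : IsParameterSystem R x y) (hle : R ≤ S) (ha : a ∈ maxSet R) (ha0 : a ≠ 0)
    (hloc : IsLocalizationOf (blowUpChart R a) S) (hx : x / a ∉ maxSet S) :
    IsLocalizationOf (adjoinElement R.toSubring (y / x)) S := by
  have hx0 := h.left_ne_zero
  have hax : a / x ∈ S.toSubring := by
    rw [← inv_div]
    exact inv_mem_of_notMem_maxSet (hloc.1 (div_mem_blowUpChart R a h.left_mem)) hx
  have haxm : a / x ∉ maxSet S := notMem_maxSet_of_inv_mem (div_ne_zero ha0 hx0)
    (by rw [inv_div]; exact hloc.1 (div_mem_blowUpChart R a h.left_mem))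
  set T := adjoinElement R.toSubring (y / x)
  have hmT : ∀ b ∈ maxSet R, b / x ∈ T := by
    intro b hb
    obtain ⟨c, hc, rfl⟩ := h.span_chart hb
    rwa [mul_div_cancel_right₀ _ hx0]
  -- The element a/x lies in `T` and is a unit of `S`, so multiplying a numerator and a denominator
  -- of R[𝔪/a] by the same power of it moves the fraction into `T`.
  have hclear : ∀ u ∈ blowUpChart R a, ∃ n : ℕ, ∀ m, n ≤ m → u * (a / x) ^ m ∈ T := by
    intro u hu
    induction hu using Subring.closure_induction with
    | mem u hu =>
      rcases hu with hu | ⟨b, hb, rfl⟩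
      · exact ⟨0, fun m _ => mul_mem (le_adjoinElement _ _ hu) (pow_mem (hmT a ha) m)⟩
      · refine ⟨1, fun m hm => ?_⟩
        obtain ⟨m, rfl⟩ := Nat.exists_eq_add_of_le hm
        have : (b : L) / a * (a / x) ^ (1 + m) = b / x * (a / x) ^ m := by
          rw [pow_add, pow_one]
          field_simp
        rw [this]
        exact mul_mem (hmT b (mem_maxSet_coe.2 hb)) (pow_mem (hmT a ha) m)
    | zero => exact ⟨0, fun m _ => by rw [zero_mul]; exact zero_mem _⟩
    | one => exact ⟨0, fun m _ => by rw [one_mul]; exact pow_mem (hmT a ha) m⟩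
    | add u v _ _ hu hv =>
      obtain ⟨n, hn⟩ := hu
      obtain ⟨n', hn'⟩ := hv
      refine ⟨n + n', fun m hm => ?_⟩
      rw [add_mul]
      exact add_mem (hn m (by omega)) (hn' m (by omega))
    | neg u _ hu =>
      obtain ⟨n, hn⟩ := hu
      refine ⟨n, fun m hm => ?_⟩
      rw [neg_mul]
      exact neg_mem (hn m hm)
    | mul u v _ _ hu hv =>
      obtain ⟨n, hn⟩ := hu
      obtain ⟨n', hn'⟩ := hv
      refine ⟨n + n', fun m hm => ?_⟩
      obtain ⟨m', rfl⟩ := Nat.exists_eq_add_of_le hm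
      have : u * v * (a / x) ^ (n + n' + m') =
          (u * (a / x) ^ n) * (v * (a / x) ^ (n' + m')) := by ring
      rw [this]
      exact mul_mem (hn n le_rfl) (hn' _ (by omega))
  refine ⟨adjoinElement_le hle.1 ?_, fun z hz => ?_⟩
  · have : y / x = y / a * (a / x) := by field_simp
    rw [this]
    exact mul_mem (hloc.1 (div_mem_blowUpChart R a h.right_mem)) hax
  · obtain ⟨u, hu, v, hv, hvm, rfl⟩ := hloc.2 z hz
    obtain ⟨n, hn⟩ := hclear u hu
    obtain ⟨n', hn'⟩ := hclear v hv
    refine ⟨_, hn (n + n') (by omega), _, hn' (n + n') (by omega), fun hm => ?_, ?_⟩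
    · exact (mem_or_mem_maxSet (hloc.1 hv) (pow_mem hax _) hm).elim hvm
        (fun h => haxm (pow_mem_maxSet hax h))
    · rw [mul_div_mul_right _ _ (pow_ne_zero _ (div_ne_zero ha0 hx0))]

/-- The blow-up of a regular point is covered by the two charts given by the parameters. -/
lemma exists_chart_of_mem_blowUpFibre {R S : LocalSubring L} {x y : L}
    (h : IsParameterSystem R x y) (hS : S ∈ blowUpFibre R) :
    IsLocalizationOf (adjoinElement R.toSubring (y / x)) S ∨
      IsLocalizationOf (adjoinElement R.toSubring (x / y)) S := by
  obtain ⟨hle, a, ha, ha0, hloc⟩ := mem_blowUpFibre_iff.1 hS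
  by_cases hx : x / a ∈ maxSet S
  · by_cases hy : y / a ∈ maxSet S
    -- From a = bx + cy follows 1 = b(x/a) + c(y/a), so x/a and y/a cannot both vanish at `S`.
    · obtain ⟨b, hb, c, hc, hab⟩ := h.span a ha
      have h1 : (1 : L) = b * (x / a) + c * (y / a) := by
        field_simp
        exact hab
      exact absurd (h1 ▸ add_mem_maxSet (mul_mem_maxSet (hle.1 hb) hx)
        (mul_mem_maxSet (hle.1 hc) hy)) (one_notMem_maxSet S)
    · exact .inr (isLocalizationOf_chart_of_div_notMem h.symm hle ha ha0 hloc hy)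
  · exact .inl (isLocalizationOf_chart_of_div_notMem h hle ha ha0 hloc hx)

/-- A divisorial point is not changed by blowing it up. -/
lemma eq_of_mem_blowUpFibre {K : IntermediateField k L} {R S : LocalSubring L}
    (hR : IsSurfacePoint K R) (hdiv : IsDivisorial K R) (hS : S ∈ blowUpFibre R) : S = R := by
  obtain ⟨hle, a, ha, ha0, hloc⟩ := mem_blowUpFibre_iff.1 hS
  have hK : S.toSubring ≤ K.toSubring := by
    have : blowUpChart R a ≤ K.toSubring := blowUpChart_le (fun z hz => hR.subset z hz)
      (fun b hb => K.div_mem (hR.subset b hb.1) (hR.subset a ha.1))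
    intro z hz
    obtain ⟨u, hu, v, hv, -, rfl⟩ := hloc.2 z hz
    exact K.div_mem (this hu) (this hv)
  refine LocalSubring.toSubring_injective (le_antisymm (fun z hz => ?_) hle.1)
  by_contra hzR
  have hz' := (hdiv.mem_or_inv_mem (hK hz)).resolve_left hzR
  have hm : z⁻¹ ∈ maxSet R := ⟨hz', .inr (by rwa [inv_inv])⟩
  have hz0 : z ≠ 0 := by
    rintro rfl
    exact hzR (zero_mem _)
  exact inv_notMem_of_mem_maxSet (inv_ne_zero hz0) (mem_maxSet_of_le hle hm) (by rwa [inv_inv])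

/-- A closed point of a model is not known in advance to be regular, so the degenerate blow-up of a
divisorial point is covered as well. -/
theorem isSurfacePoint_of_mem_blowUpFibre {K : IntermediateField k L} {R S : LocalSubring L}
    (hR : IsSurfacePoint K R) (hS : S ∈ blowUpFibre R) : IsSurfacePoint K S := by
  rcases hR.divisorial_or_regular with hdiv | hreg
  · rwa [eq_of_mem_blowUpFibre hR hdiv hS]
  · obtain ⟨x, y, h⟩ := hreg.exists_parameters
    rcases exists_chart_of_mem_blowUpFibre h hS with hloc | hloc
    · exact isSurfacePoint_of_chart hR hreg h hloc (mem_maxSet_of_le hS.1 h.left_mem)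
    · exact isSurfacePoint_of_chart hR hreg h.symm hloc (mem_maxSet_of_le hS.1 h.right_mem)

/-- A valuation ring dominates at most one point of the blow-up. -/
lemma eq_of_mem_blowUpFibre_of_le {R S S' : LocalSubring L} {V : ValuationSubring L}
    (hS : S ∈ blowUpFibre R) (hS' : S' ∈ blowUpFibre R) (hV : S ≤ V.toLocalSubring)
    (hV' : S' ≤ V.toLocalSubring) : S = S' := by
  have key : ∀ S ∈ blowUpFibre R, ∀ S' ∈ blowUpFibre R, S ≤ V.toLocalSubring →
      S' ≤ V.toLocalSubring → S.toSubring ≤ S'.toSubring := by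
    intro S hS S' hS' hV hV'
    obtain ⟨hle, a, ha, ha0, hloc⟩ := mem_blowUpFibre_iff.1 hS
    obtain ⟨hle', b, hb, hb0, hloc'⟩ := mem_blowUpFibre_iff.1 hS'
    -- The quotient a/b lies in `S'` and its inverse lies in `V`, which dominates `S'`. So a/b is a
    -- unit of `S'`, and `S'` contains the chart of `S`.
    have h1 : b / a ∈ V.toLocalSubring.toSubring := hV.1 (hloc.1 (div_mem_blowUpChart R a hb))
    have h2 : a / b ∈ S'.toSubring := hloc'.1 (div_mem_blowUpChart R b ha)
    have h3 : a / b ∉ maxSet S' := fun h => by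
      refine inv_notMem_of_mem_maxSet (div_ne_zero ha0 hb0) (mem_maxSet_of_le hV' h) ?_
      rwa [inv_div]
    have h4 : b / a ∈ S'.toSubring := by
      rw [← inv_div]
      exact inv_mem_of_notMem_maxSet h2 h3
    refine hloc.toSubring_le (blowUpChart_le hle'.1 fun c hc => ?_) fun z hz hz' => ?_
    · have : c / a = c / b * (b / a) := by field_simp
      rw [this]
      exact mul_mem (hloc'.1 (div_mem_blowUpChart R b hc)) h4
    · exact mem_maxSet_of_mem hV.1 (hloc.1 hz) (mem_maxSet_of_le hV' hz')
  exact LocalSubring.toSubring_injective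
    (le_antisymm (key S hS S' hS' hV hV') (key S' hS' S hS hV' hV))

/-- A valuation ring dominating `R` dominates a point of the blow-up of `R`. -/
lemma exists_mem_blowUpFibre_le {R : LocalSubring L} {V : ValuationSubring L} {a : L}
    (hR : R ≤ V.toLocalSubring) (ha : a ∈ maxSet R) (ha0 : a ≠ 0)
    (h : ∀ b ∈ maxSet R, b / a ∈ V) : ∃ S ∈ blowUpFibre R, S ≤ V.toLocalSubring := by
  have hle : blowUpChart R a ≤ V.toLocalSubring.toSubring := blowUpChart_le hR.1 h
  have hS := exists_center hle
  refine ⟨_, mem_blowUpFibre_iff.2 ⟨?_, a, ha, ha0, isLocalizationOf_ofPrime _⟩, hS⟩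
  have h1 := (le_blowUpChart R a).trans (LocalSubring.le_ofPrime _ (contraction hle))
  exact le_iff_maxSet.2 ⟨h1, fun z hz => mem_maxSet_of_mem hS.1 (h1 hz.1) (mem_maxSet_of_le hR hz)⟩

/-- Properness of the blow-up: the right chart is given by an element of 𝔪 of least value in `V`.
This is a uniformizer in the divisorial case, and one of the two parameters in the regular case. The
hypothesis `hne` excludes the field `K`, whose fibre is empty. -/
lemma exists_mem_blowUpFibre_le_of_isSurfacePoint {K : IntermediateField k L} {R : LocalSubring L}
    {V : ValuationSubring L} (hR : IsSurfacePoint K R) (hne : ∃ a ∈ maxSet R, a ≠ 0)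
    (hV : R ≤ V.toLocalSubring) : ∃ S ∈ blowUpFibre R, S ≤ V.toLocalSubring := by
  rcases hR.divisorial_or_regular with hdiv | hreg
  · obtain ⟨π, hπ, hπ0, h⟩ := id hdiv
    obtain ⟨a, ha, ha0⟩ := hne
    -- If π were a unit, every nonzero element of `K` would be a unit of `R`, contrary to `hne`.
    have hπm : π ∈ maxSet R := by
      by_contra hπm
      obtain ⟨n, h1, h2⟩ := h a (hR.subset a ha.1) ha0
      have hπi := inv_mem_of_notMem_maxSet hπ hπm
      refine inv_notMem_of_mem_maxSet ha0 ha ?_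
      have : a⁻¹ = (a * π ^ n)⁻¹ * π ^ n := by
        have := zpow_ne_zero n hπ0
        field_simp
      rw [this]
      refine mul_mem h2 ?_
      obtain ⟨m, rfl | rfl⟩ := n.eq_nat_or_neg
      · rw [zpow_natCast]
        exact pow_mem hπ m
      · rw [zpow_neg, zpow_natCast, ← inv_pow]
        exact pow_mem hπi m
    refine exists_mem_blowUpFibre_le hV hπm hπ0 fun b hb => ?_
    rcases eq_or_ne b 0 with rfl | hb0
    · simp
    refine hV.1 ?_
    by_contra hbπ
    obtain ⟨n, h1, h2⟩ := h b (hR.subset b hb.1) hb0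
    have hb1 := zpow_ne_zero n hπ0
    rcases le_total 0 n with hn | hn
    · refine inv_notMem_of_mem_maxSet hb0 hb ?_
      lift n to ℕ using hn
      have : b⁻¹ = (b * π ^ (n : ℤ))⁻¹ * π ^ n := by
        rw [zpow_natCast] at hb1 ⊢
        field_simp
      rw [this]
      exact mul_mem h2 (pow_mem hπ n)
    · rcases eq_or_lt_of_le hn with rfl | hn
      · refine inv_notMem_of_mem_maxSet hb0 hb ?_
        simpa using h2
      · obtain ⟨m, rfl⟩ : ∃ m : ℕ, n = -(m + 1 : ℕ) := ⟨(-n - 1).toNat, by omega⟩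
        apply hbπ
        have : b / π = b * π ^ (-((m + 1 : ℕ) : ℤ)) * π ^ m := by
          rw [zpow_neg, zpow_natCast, pow_succ]
          have := pow_ne_zero m hπ0
          field_simp
        rw [this]
        exact mul_mem h1 (pow_mem hπ m)
  · obtain ⟨x, y, h⟩ := hreg.exists_parameters
    have key : ∀ x y, IsParameterSystem R x y → y / x ∈ V →
        ∃ S ∈ blowUpFibre R, S ≤ V.toLocalSubring := by
      intro x y h hyx
      refine exists_mem_blowUpFibre_le hV h.left_mem h.left_ne_zero fun b hb => ?_
      obtain ⟨c, hc, rfl⟩ := h.span_chart hb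
      rw [mul_div_cancel_right₀ _ h.left_ne_zero]
      exact adjoinElement_le (A := V.toSubring) hV.1 hyx hc
    rcases V.mem_or_inv_mem (y / x) with hyx | hxy
    · exact key x y h hyx
    · exact key y x h.symm (by rwa [inv_div] at hxy)

end BlowUpFibre

/-! ### Points of indeterminacy of a rational function, and their finiteness on a chart. -/

section Indeterminacy

variable {L : Type*} [Field L]

/-- The rational function `f`, as a map to the projective line, is not defined at `S`. -/
def IsIndeterminate (f : L) (S : LocalSubring L) : Prop := f ∉ S.toSubring ∧ f⁻¹ ∉ S.toSubring

lemma IsIndeterminate.ne_zero {f : L} {S : LocalSubring L} (h : IsIndeterminate f S) : f ≠ 0 := by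
  rintro rfl
  exact h.1 (zero_mem _)

/-- If `f = a / b` is indeterminate at `S`, then `a` and `b` vanish at `S`. -/
lemma IsIndeterminate.mem_maxSet {f a b : L} {S : LocalSubring L} (h : IsIndeterminate f S)
    (ha : a ∈ S.toSubring) (hb : b ∈ S.toSubring) (hab : a = f * b) (hb0 : b ≠ 0) :
    a ∈ maxSet S ∧ b ∈ maxSet S := by
  have ha0 : a ≠ 0 := hab ▸ mul_ne_zero h.ne_zero hb0
  constructor
  · by_contra ham
    apply h.2
    have : f⁻¹ = b * a⁻¹ := by
      have := h.ne_zero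
      rw [hab]
      field_simp
    rw [this]
    exact mul_mem hb (inv_mem_of_notMem_maxSet ha ham)
  · by_contra hbm
    apply h.1
    have : f = a * b⁻¹ := by
      rw [hab]
      field_simp
    rw [this]
    exact mul_mem ha (inv_mem_of_notMem_maxSet hb hbm)

variable {k : Type*} [Field k] [Algebra k L]

/-- A divisorial ring contains f or f⁻¹. -/
lemma IsIndeterminate.isRegularPoint {f : L} {S : LocalSubring L} {K : IntermediateField k L}
    (h : IsIndeterminate f S) (hf : f ∈ K) (hS : IsSurfacePoint K S) : IsRegularPoint K S :=
  hS.divisorial_or_regular.resolve_left fun h' => (h'.mem_or_inv_mem hf).elim h.1 h.2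

/-- Modulo z the value p(z) is the constant term, and a nonzero constant is a unit. -/
lemma coeff_zero_eq_zero_of_aeval_mem {S : LocalSubring L}
    (hk : ∀ c : k, algebraMap k L c ∈ S.toSubring) {z : L} (hz : z ∈ maxSet S)
    {p : Polynomial k} (hp : Polynomial.aeval z p ∈ maxSet S) : p.coeff 0 = 0 := by
  by_contra h
  have h1 : algebraMap k L (p.coeff 0) ∈ maxSet S := by
    have h2 := congrArg (Polynomial.aeval z) (Polynomial.divX_mul_X_add p)
    rw [map_add, map_mul, Polynomial.aeval_X, Polynomial.aeval_C] at h2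
    rw [← add_sub_cancel_left (Polynomial.aeval z p.divX * z) (algebraMap k L (p.coeff 0)), h2]
    exact sub_mem_maxSet hp (mul_mem_maxSet (aeval_mem hk hz.1 _) hz)
  refine inv_notMem_of_mem_maxSet ?_ h1 ?_
  · simpa using h
  · rw [← map_inv₀]
    exact hk _

/-- The powers of X dividing p can be removed because z is a unit. -/
lemma ResidueAlgebraic.exists_coeff_zero_ne {S : LocalSubring L}
    (hk : ∀ c : k, algebraMap k L c ∈ S.toSubring) {z : L} (h : ResidueAlgebraic k S z)
    (hz : z ∈ S.toSubring) (hzm : z ∉ maxSet S) :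
    ∃ p : Polynomial k, p.coeff 0 ≠ 0 ∧ Polynomial.aeval z p ∈ maxSet S := by
  obtain ⟨p, hp, hpm⟩ := h
  obtain ⟨q, hq, hdvd⟩ := p.exists_eq_pow_rootMultiplicity_mul_and_not_dvd hp 0
  rw [Polynomial.C_0, sub_zero] at hq hdvd
  refine ⟨q, fun h => hdvd (Polynomial.X_dvd_iff.2 h), ?_⟩
  rw [hq, map_mul, map_pow, Polynomial.aeval_X] at hpm
  exact (mem_or_mem_maxSet (pow_mem hz _) (aeval_mem hk hz q) hpm).resolve_left
    fun h => hzm (pow_mem_maxSet hz h)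

/-- A local ring with residue field algebraic over `k` dominates every local ring over `k`
contained in it. -/
lemma le_of_toSubring_le {R S : LocalSubring L} (hk : ∀ c : k, algebraMap k L c ∈ S.toSubring)
    (hR : ∀ z ∈ R.toSubring, ResidueAlgebraic k R z) (h : S.toSubring ≤ R.toSubring) : S ≤ R := by
  refine le_iff_maxSet.2 ⟨h, fun z hz => ?_⟩
  by_contra hzR
  obtain ⟨p, hp, hpm⟩ := (hR z (h hz.1)).exists_coeff_zero_ne (fun c => h (hk c)) (h hz.1) hzR
  exact hp (coeff_zero_eq_zero_of_aeval_mem hk hz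
    (mem_maxSet_of_mem h (aeval_mem hk hz.1 p) hpm))

/-- A chart contains only finitely many points of indeterminacy. -/
theorem finite_isIndeterminate {K : IntermediateField k L} {f x : L} (hf : f ∈ K) (T : Subring L)
    [IsNoetherianRing T] (hk : ∀ c : k, algebraMap k L c ∈ T) (hx : x ∈ T)
    (hT : ∀ S, IsLocalizationOf T S → x ∈ maxSet S → IsSurfacePoint K S) :
    {S | IsLocalizationOf T S ∧ x ∈ maxSet S ∧ IsIndeterminate f S}.Finite := by
  -- The ideal is generated by x and by all denominators of f and of f⁻¹, so its zero set is the
  -- indeterminacy locus on x = 0. The choice x = 0 gives the whole chart.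
  let I : Ideal T := Ideal.span {t | (t : L) = x ∨ (t : L) * f ∈ T ∨ (t : L) * f⁻¹ ∈ T}
  have key : ∀ (S : LocalSubring L) (h : IsLocalizationOf T S),
      I ≤ contraction h.1 ↔ x ∈ maxSet S ∧ IsIndeterminate f S := by
    intro S h
    have hout : ∀ g : L, g ∉ S.toSubring ↔ ∀ t : T, (t : L) * g ∈ T → (t : L) ∈ maxSet S := by
      intro g
      constructor
      · intro hg t ht
        by_contra htm
        apply hg
        have ht0 := ne_zero_of_notMem_maxSet htm
        rw [← inv_mul_cancel_left₀ ht0 g]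
        exact mul_mem (inv_mem_of_notMem_maxSet (h.1 t.2) htm) (h.1 ht)
      · intro hg hgS
        obtain ⟨a, ha, b, hb, hbm, rfl⟩ := h.2 g hgS
        refine hbm (hg ⟨b, hb⟩ ?_)
        rwa [mul_div_cancel₀ _ (ne_zero_of_notMem_maxSet hbm)]
    rw [Ideal.span_le, IsIndeterminate, hout, hout]
    constructor
    · intro hI
      exact ⟨(mem_contraction h.1 (z := ⟨x, hx⟩)).1 (hI (.inl rfl)),
        fun t ht => (mem_contraction h.1).1 (hI (.inr (.inl ht))),
        fun t ht => (mem_contraction h.1).1 (hI (.inr (.inr ht)))⟩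
    · rintro ⟨h1, h2, h3⟩ t (ht | ht | ht)
      · exact (mem_contraction h.1).2 (ht ▸ h1)
      · exact (mem_contraction h.1).2 (h2 t ht)
      · exact (mem_contraction h.1).2 (h3 t ht)
  classical
  let g : LocalSubring L → Ideal T := fun S => if h : T ≤ S.toSubring then contraction h else ⊥
  have hg : ∀ S (h : T ≤ S.toSubring), g S = contraction h := fun S h => dif_pos h
  refine Set.Finite.of_injOn (f := g) (t := I.minimalPrimes) ?_ ?_
    (Ideal.finite_minimalPrimes_of_isNoetherianRing T I)
  · rintro S ⟨hloc, hxS, hind⟩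
    rw [hg S hloc.1]
    -- The localization at the minimal prime `Q` is itself indeterminate, hence regular with residue
    -- field algebraic over k. So no larger prime contains `Q`: an element outside `Q` satisfies
    -- modulo `Q` an equation with nonzero constant term. Every point of the locus thus comes from
    -- one of the finitely many minimal primes.
    obtain ⟨Q, hQ, hQS⟩ := Ideal.exists_minimalPrimes_le ((key S hloc).2 ⟨hxS, hind⟩)
    have := hQ.1.1
    have hQc : contraction (LocalSubring.le_ofPrime T Q) = Q := by
      ext z
      rw [mem_contraction, mem_maxSet_ofPrime]
    obtain ⟨h1, h2⟩ := (key (LocalSubring.ofPrime T Q) (isLocalizationOf_ofPrime Q)).1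
      (hQc.symm ▸ hQ.1.2)
    have hreg := h2.isRegularPoint hf (hT _ (isLocalizationOf_ofPrime Q) h1)
    have hkQ := fun c => LocalSubring.le_ofPrime T Q (hk c)
    suffices contraction hloc.1 = Q from this ▸ hQ
    refine le_antisymm (fun z hz => ?_) hQS
    rw [mem_contraction] at hz
    by_contra hzQ
    have hzT := LocalSubring.le_ofPrime T Q z.2
    obtain ⟨p, hp, hpm⟩ := (hreg.residueAlgebraic z hzT).exists_coeff_zero_ne hkQ hzT
      (fun h => hzQ ((mem_maxSet_ofPrime Q).1 h))
    refine hp (coeff_zero_eq_zero_of_aeval_mem (fun c => hloc.1 (hk c)) hz ?_)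
    have hpT : Polynomial.aeval (z : L) p ∈ T := aeval_mem hk z.2 p
    exact (mem_contraction hloc.1 (z := ⟨_, hpT⟩)).1 (hQS ((mem_maxSet_ofPrime Q).1 hpm))
  · rintro S ⟨hS, -⟩ S' ⟨hS', -⟩ h
    rw [hg S hS.1, hg S' hS'.1] at h
    refine hS.ext hS' fun z hz => ?_
    rw [← mem_contraction hS.1 (z := ⟨z, hz⟩), h, mem_contraction]

end Indeterminacy

/-! ### Residually transcendental rings, and a bound for factorizations into nonunits. -/

section Order

variable {L : Type*} [Field L] {k : Type*} [Field k] [Algebra k L]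

/-- The residue of `f` in the local ring `V` is transcendental over `k`. -/
def ResidueTranscendental (k : Type*) [Field k] [Algebra k L] (f : L) (V : LocalSubring L) : Prop :=
  f ∈ V.toSubring ∧ ∀ p : Polynomial k, p ≠ 0 → Polynomial.aeval f p ∉ maxSet V

open Polynomial in
/-- An element `t` of `K` such that neither `t` nor `t⁻¹` belongs to the normal local ring `S` is
residually transcendental. -/
lemma coeff_mem_maxSet_of_isIndeterminate {K : IntermediateField k L} {S : LocalSubring L} {f : L}
    (hK : ∀ z ∈ S.toSubring, z ∈ K) (hS : ∀ z ∈ K, IsIntegral S.toSubring z → z ∈ S.toSubring)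
    (hf : f ∈ K) (h : IsIndeterminate f S) {p : S.toSubring[X]}
    (hp : p.eval₂ S.toSubring.subtype f = 0) (i : ℕ) :
    ((p.coeff i : S.toSubring) : L) ∈ maxSet S := by
  refine coeff_mem_maxSet_of_leadingCoeff (fun n p hp h0 => ?_) p.natDegree p le_rfl hp i
  rcases hp.lt_or_eq with hlt | heq
  · rw [Polynomial.coeff_eq_zero_of_natDegree_lt hlt]
    simpa using zero_mem_maxSet S
  set c : L := ((p.coeff (n + 1) : S.toSubring) : L) with hc
  have hcS : c ∈ S.toSubring := (p.coeff (n + 1)).2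
  -- The leading coefficient c times f is integral, so it lies in the normal ring `S`. Indeterminacy
  -- of f = (c·f)/c then puts numerator and denominator into 𝔪.
  have hint : IsIntegral S.toSubring (c * f) := by
    have := isIntegral_leadingCoeff_smul p f h0
    rwa [Polynomial.leadingCoeff, heq] at this
  have hcf := hS _ (mul_mem (hK _ hcS) hf) hint
  rcases eq_or_ne c 0 with hc0 | hc0
  · rw [hc0, zero_mul]
    exact ⟨zero_mem_maxSet S, zero_mem_maxSet S⟩
  · exact (h.mem_maxSet hcf hcS (mul_comm c f) hc0).symm

open Polynomial in
/-- At a point of indeterminacy of `f`, there is a local ring dominating it at which `f` is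
residually transcendental. -/
theorem exists_residueTranscendental {K : IntermediateField k L} {S : LocalSubring L} {f : L}
    (hS : IsSurfacePoint K S) (hf : f ∈ K) (h : IsIndeterminate f S) :
    ∃ V, S ≤ V ∧ (∀ z ∈ V.toSubring, z ∈ K) ∧ ResidueTranscendental k f V := by
  have hreg := h.isRegularPoint hf hS
  let T := adjoinElement S.toSubring f
  let m := IsLocalRing.maximalIdeal S.toSubring
  let φ : S.toSubring[X] →+* T := (Polynomial.eval₂RingHom S.toSubring.subtype f).rangeRestrict
  have hφ : Function.Surjective φ := RingHom.rangeRestrict_surjective _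
  have hker : ∀ p, φ p = 0 → p ∈ m.map (Polynomial.C : S.toSubring →+* S.toSubring[X]) := by
    intro p hp
    rw [Ideal.mem_map_C_iff]
    intro i
    exact mem_maxSet_coe.1 (coeff_mem_maxSet_of_isIndeterminate hS.subset hreg.normal hf h
      (congrArg Subtype.val hp) i)
  -- Since all relations of f have coefficients in `m`, this ideal 𝔪S[f] is prime with quotient
  -- (S/𝔪)[X], in which the class of f is the variable.
  let P : Ideal T := (m.map (Polynomial.C : S.toSubring →+* S.toSubring[X])).map φ
  have hmP : (m.map (Polynomial.C : S.toSubring →+* S.toSubring[X])).IsPrime :=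
    Ideal.isPrime_map_C_of_isPrime
  have hP : P.IsPrime := Ideal.map_isPrime_of_surjective hφ fun p hp => hker p hp
  have hmem : ∀ p, φ p ∈ P ↔ p ∈ m.map (Polynomial.C : S.toSubring →+* S.toSubring[X]) := by
    intro p
    refine ⟨fun hp => ?_, Ideal.mem_map_of_mem φ⟩
    obtain ⟨q, hq, hqp⟩ := (Ideal.mem_map_iff_of_surjective φ hφ).1 hp
    have := Ideal.add_mem _ (hker (p - q) (by rw [map_sub, hqp, sub_self])) hq
    simpa using this
  have hφC : ∀ s : S.toSubring, ((φ (Polynomial.C s) : T) : L) = s := fun s => by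
    change Polynomial.eval₂ _ _ _ = _
    rw [Polynomial.eval₂_C, Subring.subtype_apply]
  have hTV := LocalSubring.le_ofPrime T P
  refine ⟨LocalSubring.ofPrime T P, le_iff_maxSet.2
    ⟨(le_adjoinElement _ _).trans hTV, fun z hz => ?_⟩, fun z hz => ?_,
    hTV (self_mem_adjoinElement _ _), fun p hp hpm => ?_⟩
  · rw [← show _ = z from hφC ⟨z, hz.1⟩, mem_maxSet_ofPrime]
    exact (hmem _).2 (Ideal.mem_map_of_mem _ (mem_maxSet_coe.1 hz))
  · have hTK : T ≤ K.toSubring := adjoinElement_le (fun z hz => hS.subset z hz) hf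
    obtain ⟨a, b, -, rfl⟩ := (mem_ofPrime_iff P).1 hz
    exact K.div_mem (hTK a.2) (hTK b.2)
  · let κ : k →+* S.toSubring := (algebraMap k L).codRestrict S.toSubring hS.algebraMap_mem
    have h1 : Polynomial.aeval f p = ((φ (p.map κ) : T) : L) := by
      change _ = Polynomial.eval₂ _ _ _
      rw [Polynomial.eval₂_map]
      rfl
    rw [h1, mem_maxSet_ofPrime, hmem, Ideal.mem_map_C_iff] at hpm
    have h2 := hpm p.natDegree
    rw [← mem_maxSet_coe, Polynomial.coeff_map] at h2
    have h3 : algebraMap k L p.leadingCoeff ≠ 0 := by simpa using hp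
    refine inv_notMem_of_mem_maxSet h3 h2 ?_
    rw [← map_inv₀]
    exact hS.algebraMap_mem _

open Polynomial in
/-- The partial products of nonunits dividing `a` are linearly independent over the polynomials
in `a` whose coefficients are zero or units. -/
lemma eq_zero_of_sum_partialProducts {A : Type*} [CommRing A] (φ : A →+* L) {V : LocalSubring L}
    (hφ : ∀ z, φ z ∈ V.toSubring) (hφm : ∀ z, φ z ∈ maxSet V → z = 0) {a r : L} (ha : a ≠ 0)
    {m : ℕ} {c : ℕ → L} (hc : ∀ i < m, c i ∈ maxSet V) (hr : r ∈ V.toSubring)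
    (har : a = (∏ i ∈ Finset.range m, c i) * r) (D : ℕ) : ∀ p : ℕ → A[X],
    (∀ i < m, (p i).natDegree ≤ D) →
    ∑ i ∈ Finset.range m, (p i).eval₂ φ a * ∏ j ∈ Finset.range i, c j = 0 →
    ∀ i < m, p i = 0 := by
  have hprod : ∀ i ≤ m, ∀ j ≤ m, i ≤ j → ∃ s ∈ V.toSubring,
      ∏ l ∈ Finset.range j, c l = (∏ l ∈ Finset.range i, c l) * s := by
    intro i hi j hj hij
    rw [← Finset.prod_range_mul_prod_Ico _ hij]
    exact ⟨_, prod_mem fun l hl => (hc l (by have := Finset.mem_Ico.1 hl; omega)).1, rfl⟩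
  have haV : a ∈ V.toSubring := by
    obtain ⟨s, hs, h⟩ := hprod 0 (Nat.zero_le _) m le_rfl (Nat.zero_le _)
    rw [har, h, Finset.prod_range_zero, one_mul]
    exact mul_mem hs hr
  have hev : ∀ q : A[X], q.eval₂ φ a ∈ V.toSubring := by
    intro q
    rw [Polynomial.eval₂_eq_sum_range]
    exact sum_mem fun i _ => mul_mem (hφ _) (pow_mem haV i)
  have hsplit : ∀ q : A[X], q.eval₂ φ a = q.divX.eval₂ φ a * a + φ (q.coeff 0) := by
    intro q
    conv_lhs => rw [← Polynomial.divX_mul_X_add q]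
    rw [Polynomial.eval₂_add, Polynomial.eval₂_mul, Polynomial.eval₂_X, Polynomial.eval₂_C]
  -- Induction on i. Once the constant terms before i vanish, the summands before i are divisible by
  -- a, hence by c₀⋯cᵢ; those after i contain c₀⋯cᵢ as well. Dividing by c₀⋯cᵢ₋₁ leaves the i-th
  -- constant term in the maximal ideal, so it is zero.
  have hcoeff : ∀ p : ℕ → A[X],
      ∑ i ∈ Finset.range m, (p i).eval₂ φ a * ∏ j ∈ Finset.range i, c j = 0 →
      ∀ i < m, (p i).coeff 0 = 0 := by
    intro p hp i
    induction i using Nat.strong_induction_on with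
    | _ i ih =>
    intro hi
    have hc0 : ∏ l ∈ Finset.range i, c l ≠ 0 := by
      intro h0
      obtain ⟨s, -, h⟩ := hprod i hi.le m le_rfl hi.le
      rw [h0, zero_mul] at h
      exact ha (by rw [har, h, zero_mul])
    have hterm : ∀ j < m, j ≠ i → ∃ s ∈ V.toSubring,
        (p j).eval₂ φ a * ∏ l ∈ Finset.range j, c l = (∏ l ∈ Finset.range (i + 1), c l) * s := by
      intro j hj hji
      rcases lt_or_gt_of_ne hji with hlt | hgt
      · obtain ⟨s, hs, h⟩ := hprod (i + 1) hi m le_rfl hi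
        refine ⟨s * r * ((p j).divX.eval₂ φ a * ∏ l ∈ Finset.range j, c l),
          mul_mem (mul_mem hs hr) (mul_mem (hev _) ?_), ?_⟩
        · exact prod_mem fun l hl => (hc l (by have := Finset.mem_range.1 hl; omega)).1
        · rw [hsplit, ih j hlt hj, map_zero, add_zero]
          have : a = (∏ l ∈ Finset.range (i + 1), c l) * s * r := by rw [← h]; exact har
          linear_combination ((p j).divX.eval₂ φ a * ∏ l ∈ Finset.range j, c l) * this
      · obtain ⟨s, hs, h⟩ := hprod (i + 1) hi j hj.le hgt
        exact ⟨(p j).eval₂ φ a * s, mul_mem (hev _) hs, by rw [h]; ring⟩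
    have hsum : ∃ s ∈ V.toSubring, ∑ j ∈ (Finset.range m).erase i,
        (p j).eval₂ φ a * ∏ l ∈ Finset.range j, c l = (∏ l ∈ Finset.range (i + 1), c l) * s := by
      choose! s hs hs' using hterm
      refine ⟨∑ j ∈ (Finset.range m).erase i, s j, sum_mem fun j hj => ?_, ?_⟩
      · rw [Finset.mem_erase, Finset.mem_range] at hj
        exact hs j hj.2 hj.1
      · rw [Finset.mul_sum]
        refine Finset.sum_congr rfl fun j hj => ?_
        rw [Finset.mem_erase, Finset.mem_range] at hj
        exact hs' j hj.2 hj.1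
    obtain ⟨s, hs, hsum⟩ := hsum
    rw [← Finset.add_sum_erase _ _ (Finset.mem_range.2 hi), hsum, Finset.prod_range_succ,
      hsplit] at hp
    obtain ⟨s', hs', h'⟩ := hprod (i + 1) hi m le_rfl hi
    have h1 : φ ((p i).coeff 0) = -(c i * s) - (p i).divX.eval₂ φ a * a := by
      apply mul_right_cancel₀ hc0
      linear_combination hp
    refine hφm _ ?_
    rw [h1]
    refine sub_mem_maxSet (neg_mem_maxSet (mul_mem_maxSet' (hc i hi) hs))
      (mul_mem_maxSet (hev _) ?_)
    rw [har, h', Finset.prod_range_succ]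
    have h2 : (∏ l ∈ Finset.range i, c l) ∈ V.toSubring :=
      prod_mem fun l hl => (hc l (by have := Finset.mem_range.1 hl; omega)).1
    exact mul_mem_maxSet' (mul_mem_maxSet' (mul_mem_maxSet h2 (hc i hi)) hs') hr
  induction D with
  | zero =>
    intro p hD hp i hi
    rw [Polynomial.eq_C_of_natDegree_le_zero (hD i hi), hcoeff p hp i hi, Polynomial.C_0]
  | succ D ih =>
    intro p hD hp i hi
    -- All constant terms vanish, so the whole relation can be divided by a, which lowers the
    -- degrees.
    have hX : ∀ i < m, p i = (p i).divX * Polynomial.X := by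
      intro i hi
      conv_lhs => rw [← Polynomial.divX_mul_X_add (p i)]
      rw [hcoeff p hp i hi, Polynomial.C_0, add_zero]
    have h1 : ∑ i ∈ Finset.range m, (p i).divX.eval₂ φ a * ∏ j ∈ Finset.range i, c j = 0 := by
      apply mul_right_cancel₀ ha
      rw [zero_mul, ← hp, Finset.sum_mul]
      refine Finset.sum_congr rfl fun i hi => ?_
      rw [hsplit (p i), hcoeff p hp i (Finset.mem_range.1 hi), map_zero, add_zero]
      ring
    have h2 := ih (fun i => (p i).divX) (fun i hi => by
      rw [Polynomial.natDegree_divX_eq_natDegree_tsub_one]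
      have := hD i hi
      omega) h1 i hi
    rw [hX i hi, h2, zero_mul]

/-- A length bound for the factorizations of `a` into nonunits, in the local rings of `K` at
which `f` is residually transcendental. -/
theorem exists_bound_of_factorization {K : IntermediateField k L} [Algebra.EssFiniteType k K]
    (htr : Algebra.trdeg k K ≤ 2) {f a : L} (hf : f ∈ K) (haK : a ∈ K) (ha0 : a ≠ 0)
    {V₀ : LocalSubring L} (hV₀ : ResidueTranscendental k f V₀)
    (hk₀ : ∀ c : k, algebraMap k L c ∈ V₀.toSubring) (ha : a ∈ maxSet V₀) :
    ∃ n : ℕ, ∀ V : LocalSubring L, (∀ z ∈ V.toSubring, z ∈ K) → ResidueTranscendental k f V →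
      (∀ c : k, algebraMap k L c ∈ V.toSubring) →
      ∀ (m : ℕ) (c : ℕ → L) (r : L), (∀ i < m, c i ∈ maxSet V) → r ∈ V.toSubring →
        a = (∏ i ∈ Finset.range m, c i) * r → m ≤ n := by
  let f' : K := ⟨f, hf⟩
  let a' : K := ⟨a, haK⟩
  let A := Algebra.adjoin k (Set.range fun _ : Unit => f')
  let φ : A →+* L := K.val.toRingHom.comp A.val.toRingHom
  have hA : ∀ z : A, ∃ p : Polynomial k, φ z = Polynomial.aeval f p := by
    intro z
    have hz : (z : K) ∈ Algebra.adjoin k (Set.range fun _ : Unit => f') := z.2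
    rw [Set.range_const, Algebra.adjoin_singleton_eq_range_aeval] at hz
    obtain ⟨p, hp⟩ := hz
    refine ⟨p, ?_⟩
    change K.val (z : K) = _
    rw [← hp]
    exact (Polynomial.aeval_algHom_apply K.val f' p).symm
  have hφ : ∀ V : LocalSubring L, ResidueTranscendental k f V →
      (∀ c : k, algebraMap k L c ∈ V.toSubring) →
      (∀ z, φ z ∈ V.toSubring) ∧ ∀ z, φ z ∈ maxSet V → z = 0 := by
    intro V hV hk
    refine ⟨fun z => ?_, fun z hz => ?_⟩
    · obtain ⟨p, hp⟩ := hA z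
      rw [hp]
      exact aeval_mem hk hV.1 p
    · obtain ⟨p, hp⟩ := hA z
      have hp0 : p = 0 := by
        by_contra h
        exact hV.2 p h (hp ▸ hz)
      have : φ z = φ 0 := by rw [hp, hp0, map_zero, map_zero]
      exact Subtype.ext (K.val.injective this)
  -- The independence statement for the one-factor factorization a = a·1: its only partial product
  -- is the empty one, so a satisfies no polynomial over k[f].
  have htrans : Transcendental A a' := by
    rintro ⟨p, hp0, hp⟩
    apply hp0
    have h1 := eq_zero_of_sum_partialProducts φ (hφ V₀ hV₀ hk₀).1 (hφ V₀ hV₀ hk₀).2 ha0 (m := 1)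
      (c := fun _ => a) (r := 1) (fun _ _ => ha) (one_mem _) (by simp) p.natDegree
      (fun _ => p) (fun _ _ => le_rfl) (by
        have h2 := congrArg K.val hp
        rw [Polynomial.aeval_def, map_zero] at h2
        have h3 := Polynomial.hom_eval₂ p (algebraMap A K) K.val.toRingHom a'
        simp only [Finset.range_one, Finset.sum_singleton, Finset.range_zero, Finset.prod_empty,
          mul_one]
        exact h3.symm.trans h2) 0 one_pos
    exact h1
  have hindep₁ : AlgebraicIndependent k (fun _ : Unit => f') := by
    rw [algebraicIndependent_unique_type_iff]
    rintro ⟨p, hp0, hp⟩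
    refine hV₀.2 p hp0 ?_
    have h1 : Polynomial.aeval f p = K.val (Polynomial.aeval f' p) :=
      Polynomial.aeval_algHom_apply K.val f' p
    rw [h1, hp, map_zero]
    exact zero_mem_maxSet V₀
  have hindep := (hindep₁.option_iff_transcendental a').2 htrans
  let x : Option Unit → K := fun o => o.elim a' fun _ => f'
  -- The transcendence degree is at most 2, so the independent pair f, a is a basis, and `K` is
  -- finite over k(f, a).
  have hbasis : IsTranscendenceBasis k x := by
    refine hindep.isTranscendenceBasis_of_lift_trdeg_le_of_finite ?_
    have h2 : Cardinal.mk (Option Unit) = 2 := by simp [one_add_one_eq_two]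
    rw [h2]
    simpa using htr
  have := hbasis.isAlgebraic_field
  let M := IntermediateField.adjoin k (Set.range x)
  have : Algebra.EssFiniteType M K := Algebra.EssFiniteType.of_comp k M K
  have : FiniteDimensional M K := Algebra.finite_of_essFiniteType_of_isAlgebraic
  refine ⟨Module.finrank M K, fun V hVK hV hk m c r hc hr har => ?_⟩
  have hrange : ∀ z ∈ Algebra.adjoin k (Set.range x), ∃ p : Polynomial A,
      p.eval₂ φ a = z := by
    intro z hz
    induction hz using Algebra.adjoin_induction with
    | mem z hz =>
      obtain ⟨o, rfl⟩ := hz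
      rcases o with _ | _
      · exact ⟨Polynomial.X, Polynomial.eval₂_X _ _⟩
      · exact ⟨Polynomial.C ⟨f', Algebra.subset_adjoin ⟨(), rfl⟩⟩, Polynomial.eval₂_C _ _⟩
    | algebraMap c => exact ⟨Polynomial.C (algebraMap k A c), Polynomial.eval₂_C _ _⟩
    | add u v _ _ hu hv =>
      obtain ⟨p, hp⟩ := hu
      obtain ⟨q, hq⟩ := hv
      exact ⟨p + q, by rw [Polynomial.eval₂_add, hp, hq]; rfl⟩
    | mul u v _ _ hu hv =>
      obtain ⟨p, hp⟩ := hu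
      obtain ⟨q, hq⟩ := hv
      exact ⟨p * q, by rw [Polynomial.eval₂_mul, hp, hq]; rfl⟩
  have hcK : ∀ i : Fin m, ∏ j ∈ Finset.range i, c j ∈ K := fun i =>
    prod_mem fun j hj => hVK _ (hc j ((Finset.mem_range.1 hj).trans i.2)).1
  -- A relation over k(f, a) is multiplied by the product of all denominators; its coefficients
  -- become polynomials in a over k[f], to which the independence of partial products applies.
  have hli : LinearIndependent M (fun i : Fin m => (⟨_, hcK i⟩ : K)) := by
    rw [Fintype.linearIndependent_iff]
    intro g hg
    have huv' : ∀ i, ∃ u ∈ Algebra.adjoin k (Set.range x), ∃ v ∈ Algebra.adjoin k (Set.range x),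
        v ≠ 0 ∧ (g i : K) * v = u := by
      intro i
      obtain ⟨u, hu, v, hv, huv⟩ := IntermediateField.mem_adjoin_iff_div.1 (g i).2
      rcases eq_or_ne v 0 with rfl | hv0
      · exact ⟨0, zero_mem _, 1, one_mem _, one_ne_zero, by simp [huv]⟩
      · exact ⟨u, hu, v, hv, hv0, by rw [huv, div_mul_cancel₀ _ hv0]⟩
    choose u hu v hv hv0 huv using huv'
    have hp : ∀ i : ℕ, ∃ p : Polynomial A, ∀ h : i < m,
        p.eval₂ φ a = ((u ⟨i, h⟩ * ∏ j ∈ Finset.univ.erase ⟨i, h⟩, v j : K) : L) := by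
      intro i
      by_cases h : i < m
      · obtain ⟨p, hp⟩ := hrange (u ⟨i, h⟩ * ∏ j ∈ Finset.univ.erase ⟨i, h⟩, v j)
          (mul_mem (hu _) (prod_mem fun j _ => hv j))
        exact ⟨p, fun _ => hp⟩
      · exact ⟨0, fun h' => absurd h' h⟩
    choose p hp using hp
    have hcoeff : ∀ i : Fin m, u i * ∏ j ∈ Finset.univ.erase i, v j =
        (g i : K) * ∏ j, v j := by
      intro i
      rw [← Finset.mul_prod_erase _ _ (Finset.mem_univ i), ← huv]
      ring
    have hsum : ∑ i ∈ Finset.range m, (p i).eval₂ φ a * ∏ j ∈ Finset.range i, c j = 0 := by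
      rw [Finset.sum_range]
      have h1 := congrArg (fun z : K => ((z * ∏ j, v j : K) : L)) hg
      simp only [zero_mul, ZeroMemClass.coe_zero] at h1
      rw [← h1, Finset.sum_mul, AddSubmonoidClass.coe_finsetSum]
      refine Finset.sum_congr rfl fun i _ => ?_
      rw [hp i i.2, hcoeff, Algebra.smul_def]
      push_cast
      simp only [IntermediateField.algebraMap_apply]
      ring
    intro i
    have h0 := eq_zero_of_sum_partialProducts φ (hφ V hV hk).1 (hφ V hV hk).2 ha0 hc hr har _ p
      (fun i hi => Finset.le_sup (f := fun i => (p i).natDegree) (Finset.mem_range.2 hi)) hsum i i.2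
    have h1 := hp i i.2
    rw [h0, Polynomial.eval₂_zero, hcoeff] at h1
    have h2 : (g i : K) * ∏ j, v j = 0 := Subtype.ext h1.symm
    exact Subtype.ext ((mul_eq_zero.1 h2).resolve_right
      (Finset.prod_ne_zero_iff.2 fun j _ => hv0 j))
  simpa using hli.fintype_card_le_finrank

end Order

/-! ### The order of indeterminacy and its decrease under blow-up. -/

section Multiplicity

variable {L : Type*} [Field L] {k : Type*} [Field k] [Algebra k L]

/-- There is a representation `f = a / b` in the local ring `S` such that `a` is the product of at
most `n` nonunits in every local ring dominating `S` where `f` is residually transcendental. -/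
def HasBound (K : IntermediateField k L) (f : L) (S : LocalSubring L) (n : ℕ) : Prop :=
  ∃ a ∈ S.toSubring, ∃ b ∈ S.toSubring, b ≠ 0 ∧ a = f * b ∧
    ∀ V : LocalSubring L, S ≤ V → (∀ z ∈ V.toSubring, z ∈ K) → ResidueTranscendental k f V →
      ∀ (m : ℕ) (c : ℕ → L) (r : L), (∀ i < m, c i ∈ maxSet V) → r ∈ V.toSubring →
        a = (∏ i ∈ Finset.range m, c i) * r → m ≤ n

/-- A measure for the complexity of the indeterminacy of `f` at `S`. -/
noncomputable def indeterminacyOrder (K : IntermediateField k L) (f : L) (S : LocalSubring L) : ℕ :=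
  sInf {n | HasBound K f S n}

/-- Any fraction a/b for f will do. One residually transcendental ring above `S`, in which a is a
nonunit, makes f and a algebraically independent, and the degree [K : k(f, a)] bounds all
factorizations at once. -/
lemma exists_hasBound {K : IntermediateField k L} [Algebra.EssFiniteType k K]
    (htr : Algebra.trdeg k K ≤ 2) {f : L} {S : LocalSubring L} (hS : IsSurfacePoint K S)
    (hf : f ∈ K) (h : IsIndeterminate f S) : ∃ n, HasBound K f S n := by
  obtain ⟨V₀, hSV₀, hK₀, hV₀⟩ := exists_residueTranscendental hS hf h
  obtain ⟨a, ha, b, hb, hb0, rfl⟩ := hS.exists_div f hf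
  have hab : a = a / b * b := (div_mul_cancel₀ a hb0).symm
  have ham := (h.mem_maxSet ha hb hab hb0).1
  have ha0 : a ≠ 0 := by
    rintro rfl
    exact h.ne_zero (zero_div b)
  obtain ⟨n, hn⟩ := exists_bound_of_factorization htr hf (hS.subset a ha) ha0 hV₀
    (fun c => hSV₀.1 (hS.algebraMap_mem c)) (mem_maxSet_of_le hSV₀ ham)
  exact ⟨n, a, ha, b, hb, hb0, hab, fun V hSV hVK hV =>
    hn V hVK hV fun c => hSV.1 (hS.algebraMap_mem c)⟩

/-- Blowing up a point of indeterminacy decreases the order of the indeterminacy. -/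
theorem indeterminacyOrder_lt {K : IntermediateField k L} [Algebra.EssFiniteType k K]
    (htr : Algebra.trdeg k K ≤ 2) {f : L} {S S' : LocalSubring L} (hS : IsSurfacePoint K S)
    (hf : f ∈ K) (h : IsIndeterminate f S) (hS' : S' ∈ blowUpFibre S) (h' : IsIndeterminate f S') :
    indeterminacyOrder K f S' < indeterminacyOrder K f S := by
  obtain ⟨a, ha, b, hb, hb0, hab, hbound⟩ := Nat.sInf_mem (exists_hasBound htr hS hf h)
  obtain ⟨ham, hbm⟩ := h.mem_maxSet ha hb hab hb0
  obtain ⟨hle, d, hd, hd0, hloc⟩ := mem_blowUpFibre_iff.1 hS'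
  -- The element d is a nonunit of `V`, so m nonunit factors of a/d give m + 1 nonunit factors of a.
  have hstep : ∀ V : LocalSubring L, S' ≤ V → (∀ z ∈ V.toSubring, z ∈ K) →
      ResidueTranscendental k f V → ∀ (m : ℕ) (c : ℕ → L) (r : L), (∀ i < m, c i ∈ maxSet V) →
        r ∈ V.toSubring → a / d = (∏ i ∈ Finset.range m, c i) * r →
        m + 1 ≤ indeterminacyOrder K f S := by
    intro V hSV hVK hV m c r hc hr har
    refine hbound V (hle.trans hSV) hVK hV (m + 1) (fun i => Nat.casesOn i d c) r ?_ hr ?_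
    · rintro (_ | i) hi
      · exact mem_maxSet_of_le (hle.trans hSV) hd
      · exact hc i (by omega)
    · rw [Finset.prod_range_succ']
      change a = (∏ i ∈ Finset.range m, c i) * d * r
      rw [div_eq_iff hd0] at har
      rw [har]
      ring
  obtain ⟨V, hSV, hVK, hV⟩ :=
    exists_residueTranscendental (isSurfacePoint_of_mem_blowUpFibre hS hS') hf h'
  -- The factorization a = d·(a/d) in one ring above `S'` shows that the order is positive, so the
  -- subtraction of 1 below is not truncated.
  have hpos : 1 ≤ indeterminacyOrder K f S := by
    have had : a / d ∈ V.toSubring := hSV.1 (hloc.1 (div_mem_blowUpChart S d ham))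
    simpa using hstep V hSV hVK hV 0 (fun _ => 0) (a / d) (by simp) had (by simp)
  have : HasBound K f S' (indeterminacyOrder K f S - 1) := by
    refine ⟨a / d, hloc.1 (div_mem_blowUpChart S d ham), b / d,
      hloc.1 (div_mem_blowUpChart S d hbm), div_ne_zero hb0 hd0, by rw [hab, mul_div_assoc],
      fun V hSV hVK hV m c r hc hr har => ?_⟩
    have := hstep V hSV hVK hV m c r hc hr har
    omega
  have h2 : indeterminacyOrder K f S' ≤ indeterminacyOrder K f S - 1 := Nat.sInf_le this
  omega

end Multiplicity

/-! ### Centers of local rings on projective space. -/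

section Centers

attribute [local instance] MvPolynomial.gradedAlgebra

variable {k : Type*} [Field k] {n : ℕ}

lemma ProjPoint.exists_X_notMem (x : ProjPoint k n) : ∃ i, X i ∉ x.asHomogeneousIdeal := by
  by_contra! h
  apply x.not_irrelevant_le
  refine (HomogeneousIdeal.toIdeal_irrelevant_le (I := x.asHomogeneousIdeal.toIdeal) _).2
    fun i hi a ha => ?_
  have h1 : Ideal.span (X '' (Set.univ : Set (Fin (n + 1))) : Set (MvPolynomial (Fin (n + 1)) k)) ≤
      x.asHomogeneousIdeal.toIdeal := by
    rw [Ideal.span_le]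
    rintro _ ⟨j, -, rfl⟩
    exact h j
  refine h1 (mem_ideal_span_X_image.2 fun m hm => ?_)
  by_contra! hm0
  have : m = 0 := Finsupp.ext fun j => hm0 j (Set.mem_univ j)
  subst this
  have h2 := IsHomogeneous.degree_eq_sum_deg_support
    ((mem_homogeneousSubmodule i a).1 ha) hm
  simp at h2
  omega

lemma ProjPoint.ext_of_isHomogeneous {x y : ProjPoint k n}
    (h : ∀ (m : ℕ) (a : MvPolynomial (Fin (n + 1)) k), a.IsHomogeneous m →
      (a ∈ x.asHomogeneousIdeal ↔ a ∈ y.asHomogeneousIdeal)) : x = y := by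
  refine ProjectiveSpectrum.ext ?_
  exact HomogeneousIdeal.ext' fun i a ha => h i a ((mem_homogeneousSubmodule i a).1 ha)

lemma ProjPoint.mul_notMem {x : ProjPoint k n} {a b : MvPolynomial (Fin (n + 1)) k}
    (ha : a ∉ x.asHomogeneousIdeal) (hb : b ∉ x.asHomogeneousIdeal) :
    a * b ∉ x.asHomogeneousIdeal := fun h => (x.isPrime.mem_or_mem h).elim ha hb

lemma ProjPoint.exists_isHomogeneous_notMem (x : ProjPoint k n) (m : ℕ) :
    ∃ b : MvPolynomial (Fin (n + 1)) k, b.IsHomogeneous m ∧ b ∉ x.asHomogeneousIdeal := by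
  obtain ⟨i, hi⟩ := x.exists_X_notMem
  exact ⟨X i ^ m, isHomogeneous_X_pow i m, fun h => hi (x.isPrime.mem_of_pow_mem m h)⟩

variable {L : Type*} [Field L] [Algebra k L]

/-- The homogeneous ideal of the forms `a` with `a(u) ∈ 𝔪`, if `𝔪` is the maximal ideal of a local
ring `V` and the `u j` are elements of `V` one of which is `1`. -/
lemma exists_projPoint_of_eval {V : LocalSubring L} (hk : ∀ c : k, algebraMap k L c ∈ V.toSubring)
    {u : Fin (n + 1) → L} (hu : ∀ j, u j ∈ V.toSubring) {i : Fin (n + 1)} (hi : u i = 1) :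
    ∃ x : ProjPoint k n, ∀ (m : ℕ) (a : MvPolynomial (Fin (n + 1)) k), a.IsHomogeneous m →
      (a ∈ x.asHomogeneousIdeal ↔ aeval u a ∈ maxSet V) := by
  let ev : MvPolynomial (Fin (n + 1)) k →+* V.toSubring :=
    eval₂Hom ((algebraMap k L).codRestrict V.toSubring hk) fun j => ⟨u j, hu j⟩
  have hev : ∀ a, ((ev a : V.toSubring) : L) = aeval u a := by
    intro a
    have h : V.toSubring.subtype.comp ev = (aeval u : _ →ₐ[k] L).toRingHom := by
      ext j
      · simp [ev]
      · simp [ev]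
    exact congrArg (fun g : _ →+* L => g a) h
  let I : Ideal (MvPolynomial (Fin (n + 1)) k) := (IsLocalRing.maximalIdeal V.toSubring).comap ev
  have hI : ∀ a, a ∈ I ↔ aeval u a ∈ maxSet V := by
    intro a
    rw [Ideal.mem_comap, ← mem_maxSet_coe, hev]
  have hIp : I.IsPrime := Ideal.IsPrime.comap ev
  -- The ideal `I` contains X i − 1, so it is not homogeneous; its homogeneous core is prime and
  -- contains the same forms.
  refine ⟨⟨I.homogeneousCore _, hIp.homogeneousCore, fun h => ?_⟩, fun m a ha => ?_⟩
  · have h1 : (X i : MvPolynomial (Fin (n + 1)) k) ∈ HomogeneousIdeal.irrelevant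
        (homogeneousSubmodule (Fin (n + 1)) k) :=
      HomogeneousIdeal.mem_irrelevant_of_mem _ one_pos (isHomogeneous_X k i)
    have h2 := (hI _).1 (Ideal.toIdeal_homogeneousCore_le _ I (h h1))
    rw [aeval_X, hi] at h2
    exact one_notMem_maxSet V h2
  · exact ⟨fun h => (hI a).1 (Ideal.toIdeal_homogeneousCore_le _ I h), fun h =>
      Ideal.mem_homogeneousCore_of_homogeneous_of_mem ⟨m, ha⟩ ((hI a).2 h)⟩

/-- The map to projective space given by `u` sends the closed point of `Spec V` to `x`. -/
def HasCenter (u : Fin (n + 1) → L) (V : LocalSubring L) (x : ProjPoint k n) : Prop :=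
  ∀ (m : ℕ) (a b : MvPolynomial (Fin (n + 1)) k), a.IsHomogeneous m → b.IsHomogeneous m →
    b ∉ x.asHomogeneousIdeal → aeval u a / aeval u b ∈ V.toSubring ∧
      (aeval u a / aeval u b ∈ maxSet V ↔ a ∈ x.asHomogeneousIdeal)

lemma aeval_smul_of_isHomogeneous {u : Fin (n + 1) → L} {m : ℕ}
    {a : MvPolynomial (Fin (n + 1)) k} (ha : a.IsHomogeneous m) (c : L) :
    aeval (fun j => c * u j) a = c ^ m * aeval u a := by
  rw [aeval_def, aeval_def, eval₂_eq, eval₂_eq, Finset.mul_sum]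
  refine Finset.sum_congr rfl fun d hd => ?_
  have h1 := ha.degree_eq_sum_deg_support hd
  simp only [mul_pow, Finset.prod_mul_distrib]
  rw [Finset.prod_pow_eq_pow_sum, ← h1]
  ring

lemma HasCenter.mono {u : Fin (n + 1) → L} {V V' : LocalSubring L} {x : ProjPoint k n}
    (h : HasCenter u V x) (hV : V ≤ V') : HasCenter u V' x := by
  intro m a b ha hb hbx
  obtain ⟨h1, h2⟩ := h m a b ha hb hbx
  exact ⟨hV.1 h1, Iff.trans
    ⟨fun h3 => mem_maxSet_of_mem hV.1 h1 h3, fun h3 => mem_maxSet_of_le hV h3⟩ h2⟩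

lemma HasCenter.aeval_ne_zero {u : Fin (n + 1) → L} {V : LocalSubring L} {x : ProjPoint k n}
    (h : HasCenter u V x) {m : ℕ} {b : MvPolynomial (Fin (n + 1)) k} (hb : b.IsHomogeneous m)
    (hbx : b ∉ x.asHomogeneousIdeal) : aeval u b ≠ 0 := by
  intro h0
  obtain ⟨-, h2⟩ := h m b b hb hb hbx
  rw [h0, zero_div] at h2
  exact hbx (h2.1 (zero_mem_maxSet V))

/-- Separatedness: if a form a vanishes at x but not at y, and b of the same degree does not vanish
at x, then a/b is a nonunit of `V` although its inverse lies in `V`. -/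
lemma HasCenter.unique {u : Fin (n + 1) → L} {V : LocalSubring L} {x y : ProjPoint k n}
    (hx : HasCenter u V x) (hy : HasCenter u V y) : x = y := by
  have key : ∀ x y : ProjPoint k n, HasCenter u V x → HasCenter u V y → ∀ (m : ℕ)
      (a : MvPolynomial (Fin (n + 1)) k), a.IsHomogeneous m → a ∈ x.asHomogeneousIdeal →
      a ∈ y.asHomogeneousIdeal := by
    intro x y hx hy m a ha hax
    by_contra hay
    obtain ⟨b, hb, hbx⟩ := x.exists_isHomogeneous_notMem m
    have h1 := (hx m a b ha hb hbx).2.2 hax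
    have h2 := (hy m b a hb ha hay).1
    have ha0 := hy.aeval_ne_zero ha hay
    have hb0 := hx.aeval_ne_zero hb hbx
    exact inv_notMem_of_mem_maxSet (div_ne_zero ha0 hb0) h1 (by rwa [inv_div])
  exact ProjPoint.ext_of_isHomogeneous fun m a ha => ⟨key x y hx hy m a ha, key y x hy hx m a ha⟩

lemma HasCenter.exists_div_mem {u : Fin (n + 1) → L} {V : LocalSubring L} {x : ProjPoint k n}
    (h : HasCenter u V x) : ∃ i, u i ≠ 0 ∧ ∀ j, u j / u i ∈ V.toSubring := by
  obtain ⟨i, hi⟩ := x.exists_X_notMem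
  refine ⟨i, ?_, fun j => ?_⟩
  · simpa using h.aeval_ne_zero (isHomogeneous_X k i) hi
  · simpa using (h 1 (X j) (X i) (isHomogeneous_X k j) (isHomogeneous_X k i) hi).1

lemma exists_hasCenter {V : LocalSubring L} (hk : ∀ c : k, algebraMap k L c ∈ V.toSubring)
    {u : Fin (n + 1) → L} {i : Fin (n + 1)} (hi : u i ≠ 0)
    (hu : ∀ j, u j / u i ∈ V.toSubring) : ∃ x : ProjPoint k n, HasCenter u V x := by
  obtain ⟨x, hx⟩ := exists_projPoint_of_eval hk (u := fun j => u j / u i) hu (div_self hi)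
  refine ⟨x, fun m a b ha hb hbx => ?_⟩
  have hscale : ∀ a : MvPolynomial (Fin (n + 1)) k, a.IsHomogeneous m →
      aeval u a = u i ^ m * aeval (fun j => u j / u i) a := by
    intro a ha
    rw [← aeval_smul_of_isHomogeneous ha]
    congr 2
    funext j
    field_simp
  have hmem : ∀ a : MvPolynomial (Fin (n + 1)) k, aeval (fun j => u j / u i) a ∈ V.toSubring := by
    intro a
    rw [aeval_def, eval₂_eq]
    exact sum_mem fun d _ => mul_mem (hk _) (prod_mem fun j _ => pow_mem (hu j) _)
  have hbm := (hx m b hb).not.1 hbx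
  rw [hscale a ha, hscale b hb, mul_div_mul_left _ _ (pow_ne_zero m hi), hx m a ha, div_eq_mul_inv]
  have hinv := inv_mem_of_notMem_maxSet (hmem b) hbm
  refine ⟨mul_mem (hmem a) hinv, fun h => ?_, fun h => mul_mem_maxSet' h hinv⟩
  have := mul_mem_maxSet' h (hmem b)
  rwa [inv_mul_cancel_right₀ (ne_zero_of_notMem_maxSet hbm)] at this

/-- The valuative criterion for projective space: divide by a coordinate of largest valuation. -/
lemma exists_div_mem_valuationSubring (V : ValuationSubring L) {u : Fin (n + 1) → L}
    (hu : ∃ i, u i ≠ 0) : ∃ i, u i ≠ 0 ∧ ∀ j, u j / u i ∈ V := by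
  obtain ⟨i, -, hi⟩ := Finset.exists_max_image Finset.univ (fun j => V.valuation (u j))
    Finset.univ_nonempty
  have hi0 : u i ≠ 0 := by
    intro h0
    obtain ⟨j, hj⟩ := hu
    have := hi j (Finset.mem_univ j)
    rw [h0, map_zero, le_zero_iff, map_eq_zero] at this
    exact hj this
  refine ⟨i, hi0, fun j => ?_⟩
  rw [← V.valuation_le_one_iff, map_div₀]
  exact div_le_one_of_le₀ (hi j (Finset.mem_univ j)) zero_le

variable {F G : MvPolynomial (Fin 3) k}

/-- The homogeneous coordinates of the map given by a pencil. -/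
noncomputable def pencilCoord (F G : MvPolynomial (Fin 3) k) : Fin 2 → Ambient k :=
  fun j => algebraMap (MvPolynomial (Fin 3) k) (Ambient k) (![F, G] j)

lemma pullback_eq (a b : MvPolynomial (Fin 2) k) :
    pullback F G a b = aeval (pencilCoord F G) a / aeval (pencilCoord F G) b := by
  have h : ∀ a : MvPolynomial (Fin 2) k, algebraMap (MvPolynomial (Fin 3) k) (Ambient k)
      (aeval ![F, G] a) = aeval (pencilCoord F G) a := by
    intro a
    have := comp_aeval_apply ![F, G]
      (IsScalarTower.toAlgHom k (MvPolynomial (Fin 3) k) (Ambient k)) a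
    exact this
  rw [pullback, h, h]

/-- The pencil and the coordinates of the plane are thereby handled by the single notion
`HasCenter`. -/
lemma mapsTo_iff_hasCenter {S : LocalSubring (Ambient k)} {q : ProjPoint k 1} :
    MapsTo F G S q ↔ HasCenter (pencilCoord F G) S q := by
  constructor
  · intro h m a b ha hb hbq
    obtain ⟨h1, h2⟩ := h m a b ha hb hbq
    rw [← pullback_eq]
    refine ⟨h1, ?_⟩
    rw [← h2]
    exact mem_maxSet_coe (z := ⟨_, h1⟩)
  · intro h m a b ha hb hbq
    obtain ⟨h1, h2⟩ := h m a b ha hb hbq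
    rw [← pullback_eq] at h1 h2
    refine ⟨h1, ?_⟩
    rw [← h2]
    exact (mem_maxSet_coe (z := ⟨_, h1⟩)).symm

end Centers

/-! ### Integrally closed subrings of a field larger than their fraction field. -/

section FractionSubring

variable {L : Type*} [Field L]

/-- The field `L` may be larger than the fraction field of `T`; integrality is pulled back along the
embedding of `FractionRing T`, whose image contains a/b. -/
lemma div_mem_of_isIntegral {T : Subring L} [IsIntegrallyClosed T] {a b : L} (ha : a ∈ T)
    (hb : b ∈ T) (h : IsIntegral T (a / b)) : a / b ∈ T := by
  have hinj : Function.Injective (algebraMap T L) := Subtype.val_injective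
  let φ : FractionRing T →ₐ[T] L := IsFractionRing.liftAlgHom (g := Algebra.ofId T L) hinj
  have hφ : Function.Injective φ := φ.toRingHom.injective
  let y : FractionRing T := algebraMap T _ ⟨a, ha⟩ / algebraMap T _ ⟨b, hb⟩
  have hy : φ y = a / b := by
    rw [map_div₀, AlgHom.commutes, AlgHom.commutes]
    rfl
  rw [← hy, isIntegral_algHom_iff φ hφ] at h
  obtain ⟨c, hc⟩ := IsIntegrallyClosed.isIntegral_iff.1 h
  rw [← hy, ← hc, AlgHom.commutes]
  exact c.2

end FractionSubring

/-! ### The local rings of the plane and its function field. -/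

section Plane

attribute [local instance] MvPolynomial.gradedAlgebra

variable {k : Type*} [Field k]

/-- The homogeneous coordinates of the plane. -/
noncomputable def coord (k : Type*) [Field k] (j : Fin 3) : Ambient k :=
  algebraMap (MvPolynomial (Fin 3) k) (Ambient k) (X j)

lemma coord_ne_zero (j : Fin 3) : coord k j ≠ 0 := by
  simp [coord, X_ne_zero]

lemma aeval_coord (a : MvPolynomial (Fin 3) k) :
    aeval (coord k) a = algebraMap (MvPolynomial (Fin 3) k) (Ambient k) a := by
  have h : aeval (coord k) = IsScalarTower.toAlgHom k (MvPolynomial (Fin 3) k) (Ambient k) := by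
    ext j
    simp [coord]
  rw [h]
  rfl

lemma stalkEmbedding_mk (x : ProjPoint k 2) (c : HomogeneousLocalization.NumDenSameDeg
    (homogeneousSubmodule (Fin 3) k) x.asHomogeneousIdeal.toIdeal.primeCompl) :
    stalkEmbedding x (HomogeneousLocalization.mk c) =
      aeval (coord k) (c.num : MvPolynomial (Fin 3) k) /
        aeval (coord k) (c.den : MvPolynomial (Fin 3) k) := by
  rw [aeval_coord, aeval_coord]
  have hc : (c.den : MvPolynomial (Fin 3) k) ≠ 0 := fun h => c.den_mem (h ▸ Ideal.zero_mem _)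
  have hc' : algebraMap (MvPolynomial (Fin 3) k) (Ambient k) c.den ≠ 0 := by simpa using hc
  rw [eq_div_iff hc', stalkEmbedding, RingHom.comp_apply, HomogeneousLocalization.algebraMap_apply,
    HomogeneousLocalization.val_mk, Localization.mk_eq_mk', IsLocalization.lift_mk']
  simp [IsUnit.coe_liftRight, hc]

lemma mem_planeLocalRing {x : ProjPoint k 2} {z : Ambient k} :
    z ∈ (planeLocalRing x).toSubring ↔ ∃ (m : ℕ) (a b : MvPolynomial (Fin 3) k),
      a.IsHomogeneous m ∧ b.IsHomogeneous m ∧ b ∉ x.asHomogeneousIdeal ∧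
        z = aeval (coord k) a / aeval (coord k) b := by
  constructor
  · rintro ⟨w, rfl⟩
    obtain ⟨c, rfl⟩ := HomogeneousLocalization.mk_surjective w
    exact ⟨c.deg, c.num, c.den, (mem_homogeneousSubmodule _ _).1 c.num.2,
      (mem_homogeneousSubmodule _ _).1 c.den.2, c.den_mem, stalkEmbedding_mk x c⟩
  · rintro ⟨m, a, b, ha, hb, hbx, rfl⟩
    exact ⟨HomogeneousLocalization.mk ⟨m, ⟨a, ha⟩, ⟨b, hb⟩, hbx⟩, stalkEmbedding_mk x _⟩

lemma aeval_coord_injective : Function.Injective (aeval (coord k) : _ →ₐ[k] Ambient k) := by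
  intro a b h
  rw [aeval_coord, aeval_coord] at h
  exact IsFractionRing.injective _ _ h

lemma aeval_coord_ne_zero {x : ProjPoint k 2} {b : MvPolynomial (Fin 3) k}
    (hb : b ∉ x.asHomogeneousIdeal) : aeval (coord k) b ≠ 0 := by
  intro h
  rw [← map_zero (aeval (coord k) : MvPolynomial (Fin 3) k →ₐ[k] Ambient k)] at h
  exact hb (aeval_coord_injective h ▸ Ideal.zero_mem x.asHomogeneousIdeal.toIdeal)

lemma hasCenter_planeLocalRing (x : ProjPoint k 2) : HasCenter (coord k) (planeLocalRing x) x := by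
  intro m a b ha hb hbx
  have hmem := mem_planeLocalRing.2 ⟨m, a, b, ha, hb, hbx, rfl⟩
  have hb0 := aeval_coord_ne_zero hbx
  refine ⟨hmem, fun h => ?_, fun hax => ?_⟩
  · by_contra hax
    have ha0 := aeval_coord_ne_zero hax
    refine inv_notMem_of_mem_maxSet (div_ne_zero ha0 hb0) h ?_
    rw [inv_div]
    exact mem_planeLocalRing.2 ⟨m, b, a, hb, ha, hax, rfl⟩
  · by_contra h
    have h0 := ne_zero_of_notMem_maxSet h
    have ha0 : aeval (coord k) a ≠ 0 := fun h => h0 (by rw [h, zero_div])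
    have hinv := inv_mem_of_notMem_maxSet hmem h
    rw [inv_div] at hinv
    obtain ⟨m', c, d, -, -, hdx, heq⟩ := mem_planeLocalRing.1 hinv
    rw [div_eq_div_iff ha0 (aeval_coord_ne_zero hdx), ← map_mul, ← map_mul] at heq
    have := aeval_coord_injective heq
    refine ProjPoint.mul_notMem hbx hdx ?_
    rw [this]
    exact Ideal.mul_mem_left x.asHomogeneousIdeal.toIdeal c hax

/-- Existence and uniqueness of centers on the plane follow from those for `HasCenter`. -/
lemma planeLocalRing_le_iff {x : ProjPoint k 2} {V : LocalSubring (Ambient k)} :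
    planeLocalRing x ≤ V ↔ HasCenter (coord k) V x := by
  refine ⟨fun h => (hasCenter_planeLocalRing x).mono h, fun h => le_iff_maxSet.2
    ⟨fun z hz => ?_, fun z hz => ?_⟩⟩
  · obtain ⟨m, a, b, ha, hb, hbx, rfl⟩ := mem_planeLocalRing.1 hz
    exact (h m a b ha hb hbx).1
  · obtain ⟨m, a, b, ha, hb, hbx, rfl⟩ := mem_planeLocalRing.1 hz.1
    exact (h m a b ha hb hbx).2.2 ((hasCenter_planeLocalRing x m a b ha hb hbx).2.1 hz)

lemma eq_of_planeLocalRing_le {x y : ProjPoint k 2} {V : LocalSubring (Ambient k)}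
    (hx : planeLocalRing x ≤ V) (hy : planeLocalRing y ≤ V) : x = y :=
  (planeLocalRing_le_iff.1 hx).unique (planeLocalRing_le_iff.1 hy)

lemma algebraMap_mem_planeLocalRing (x : ProjPoint k 2) (c : k) :
    algebraMap k (Ambient k) c ∈ (planeLocalRing x).toSubring := by
  refine mem_planeLocalRing.2 ⟨0, C c, 1, isHomogeneous_C _ c, isHomogeneous_one _ _,
    fun h => x.isPrime.ne_top ((Ideal.eq_top_iff_one _).2 h), ?_⟩
  simp

lemma exists_planeLocalRing_le (V : ValuationSubring (Ambient k))
    (hk : ∀ c : k, algebraMap k (Ambient k) c ∈ V) :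
    ∃ x : ProjPoint k 2, planeLocalRing x ≤ V.toLocalSubring := by
  obtain ⟨i, hi, h⟩ := exists_div_mem_valuationSubring V (u := coord k) ⟨0, coord_ne_zero 0⟩
  obtain ⟨x, hx⟩ := exists_hasCenter (V := V.toLocalSubring) hk hi h
  exact ⟨x, planeLocalRing_le_iff.2 hx⟩

/-- The affine coordinates of the chart where the `i`-th homogeneous coordinate does not vanish. -/
noncomputable def affineCoord (k : Type*) [Field k] (i j : Fin 3) : Ambient k :=
  coord k j / coord k i

/-- The function field of the plane. -/
noncomputable def functionField (k : Type*) [Field k] : IntermediateField k (Ambient k) :=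
  IntermediateField.adjoin k (Set.range (affineCoord k 2))

lemma adjoin_affineCoord_le (i i' : Fin 3) :
    IntermediateField.adjoin k (Set.range (affineCoord k i)) ≤
      IntermediateField.adjoin k (Set.range (affineCoord k i')) := by
  rw [IntermediateField.adjoin_le_iff]
  rintro _ ⟨j, rfl⟩
  have : affineCoord k i j = affineCoord k i' j / affineCoord k i' i := by
    have := coord_ne_zero (k := k) i
    have := coord_ne_zero (k := k) i'
    rw [affineCoord, affineCoord, affineCoord]
    field_simp
  rw [this]
  exact div_mem (IntermediateField.subset_adjoin _ _ ⟨j, rfl⟩)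
    (IntermediateField.subset_adjoin _ _ ⟨i, rfl⟩)

lemma functionField_eq (i : Fin 3) :
    functionField k = IntermediateField.adjoin k (Set.range (affineCoord k i)) :=
  le_antisymm (adjoin_affineCoord_le 2 i) (adjoin_affineCoord_le i 2)

instance : Algebra.EssFiniteType k (functionField k) := by
  rw [IntermediateField.essFiniteType_iff]
  exact IntermediateField.fg_adjoin_of_finite (Set.finite_range _)

lemma affineCoord_self (i : Fin 3) : affineCoord k i i = 1 := div_self (coord_ne_zero i)

/-- One of the three affine coordinates is 1, so two elements suffice. -/
lemma trdeg_functionField_le : Algebra.trdeg k (functionField k) ≤ 2 := by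
  have hmem : ∀ j, affineCoord k 2 j ∈ functionField k := fun j =>
    IntermediateField.subset_adjoin _ _ ⟨j, rfl⟩
  let s : Set (functionField k) := {⟨_, hmem 0⟩, ⟨_, hmem 1⟩}
  have hs : ∀ z ∈ Algebra.adjoin k (Set.range (affineCoord k 2)),
      ∃ w ∈ Algebra.adjoin k s, (w : Ambient k) = z := by
    intro z hz
    have h1 : Algebra.adjoin k (Set.range (affineCoord k 2)) ≤
        (Algebra.adjoin k s).map (functionField k).val := by
      rw [Algebra.adjoin_le_iff]
      rintro _ ⟨j, rfl⟩
      fin_cases j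
      · exact ⟨⟨_, hmem 0⟩, Algebra.subset_adjoin (.inl rfl), rfl⟩
      · exact ⟨⟨_, hmem 1⟩, Algebra.subset_adjoin (.inr rfl), rfl⟩
      · exact ⟨1, one_mem _, (affineCoord_self 2).symm⟩
    exact h1 hz
  have : Algebra.IsAlgebraic (Algebra.adjoin k s) (functionField k) := by
    refine ⟨fun z => ?_⟩
    obtain ⟨u, hu, v, hv, huv⟩ := IntermediateField.mem_adjoin_iff_div.1 z.2
    obtain ⟨u', hu', rfl⟩ := hs u hu
    obtain ⟨v', hv', rfl⟩ := hs v hv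
    have : z = algebraMap (Algebra.adjoin k s) (functionField k) ⟨u', hu'⟩ *
        (algebraMap (Algebra.adjoin k s) (functionField k) ⟨v', hv'⟩)⁻¹ := by
      rw [← div_eq_mul_inv]
      exact Subtype.ext huv
    rw [this]
    exact (isAlgebraic_algebraMap _).mul (isAlgebraic_algebraMap _).inv
  refine (Algebra.IsAlgebraic.trdeg_le_cardinalMk k s).trans ?_
  refine (Cardinal.mk_insert_le).trans ?_
  rw [Cardinal.mk_singleton, one_add_one_eq_two]

end Plane

/-! ### The affine charts of the plane: polynomial rings whose localizations are surface points. -/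

section PlaneCharts

attribute [local instance] MvPolynomial.gradedAlgebra

variable {k : Type*} [Field k]

lemma fin_three_eq (i j : Fin 3) : j = i ∨ j = i + 1 ∨ j = i + 2 := by
  decide +revert

lemma fin_three_ne (i : Fin 3) : i + 1 ≠ i ∧ i + 2 ≠ i ∧ i + 2 ≠ i + 1 := by
  decide +revert

/-- The subring `k[t]` generated by the first affine coordinate of a chart. -/
noncomputable def chartBase (k : Type*) [Field k] (i : Fin 3) : Subring (Ambient k) :=
  (Polynomial.aeval (affineCoord k i (i + 1)) : Polynomial k →ₐ[k] Ambient k).range.toSubring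

/-- The coordinate ring of the affine chart where the `i`-th coordinate does not vanish. -/
noncomputable def chartRing (k : Type*) [Field k] (i : Fin 3) : Subring (Ambient k) :=
  adjoinElement (chartBase k i) (affineCoord k i (i + 2))

instance (i : Fin 3) : IsNoetherianRing (chartBase k i) :=
  isNoetherianRing_of_surjective _ _
    (Polynomial.aeval (affineCoord k i (i + 1)) : Polynomial k →ₐ[k] Ambient k).rangeRestrict.toRingHom
    (AlgHom.rangeRestrict_surjective _)

instance (i : Fin 3) : IsNoetherianRing (chartRing k i) :=
  inferInstanceAs (IsNoetherianRing (adjoinElement _ _))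

lemma aeval_mem_chartBase (i : Fin 3) (p : Polynomial k) :
    Polynomial.aeval (affineCoord k i (i + 1)) p ∈ chartBase k i := ⟨p, rfl⟩

lemma chartBase_le_chartRing (i : Fin 3) : chartBase k i ≤ chartRing k i := le_adjoinElement _ _

lemma algebraMap_mem_chartRing (i : Fin 3) (c : k) :
    algebraMap k (Ambient k) c ∈ chartRing k i :=
  chartBase_le_chartRing i ⟨Polynomial.C c, by simp⟩

lemma affineCoord_mem_chartRing (i j : Fin 3) : affineCoord k i j ∈ chartRing k i := by
  have h0 : affineCoord k i i ∈ chartRing k i := affineCoord_self (k := k) i ▸ one_mem _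
  have h1 : affineCoord k i (i + 1) ∈ chartRing k i :=
    chartBase_le_chartRing i ⟨Polynomial.X, by simp⟩
  have h2 : affineCoord k i (i + 2) ∈ chartRing k i := self_mem_adjoinElement _ _
  rcases fin_three_eq i j with rfl | rfl | rfl <;> assumption

lemma adjoin_le_chartRing (i : Fin 3) {z : Ambient k}
    (hz : z ∈ Algebra.adjoin k (Set.range (affineCoord k i))) : z ∈ chartRing k i := by
  induction hz using Algebra.adjoin_induction with
  | mem z hz =>
    obtain ⟨j, rfl⟩ := hz
    exact affineCoord_mem_chartRing i j
  | algebraMap c => exact algebraMap_mem_chartRing i c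
  | add a b _ _ ha hb => exact add_mem ha hb
  | mul a b _ _ ha hb => exact mul_mem ha hb

lemma aeval_affineCoord_mem_chartRing (i : Fin 3) (a : MvPolynomial (Fin 3) k) :
    aeval (affineCoord k i) a ∈ chartRing k i := by
  refine adjoin_le_chartRing i ?_
  rw [Algebra.adjoin_range_eq_range_aeval]
  exact ⟨a, rfl⟩

lemma chartRing_le (i : Fin 3) {A : Subring (Ambient k)}
    (hk : ∀ c : k, algebraMap k (Ambient k) c ∈ A) (h : ∀ j, affineCoord k i j ∈ A) :
    chartRing k i ≤ A := by
  refine adjoinElement_le ?_ (h _)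
  rintro _ ⟨p, rfl⟩
  exact aeval_mem hk (h _) p

lemma affineCoord_mem_functionField (i j : Fin 3) : affineCoord k i j ∈ functionField k :=
  functionField_eq (k := k) i ▸ IntermediateField.subset_adjoin _ _ ⟨j, rfl⟩

lemma chartRing_le_functionField (i : Fin 3) : chartRing k i ≤ (functionField k).toSubring :=
  chartRing_le i (functionField k).algebraMap_mem (affineCoord_mem_functionField i)

lemma exists_div_chartRing (i : Fin 3) {z : Ambient k} (hz : z ∈ functionField k) :
    ∃ a ∈ chartRing k i, ∃ b ∈ chartRing k i, b ≠ 0 ∧ z = a / b := by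
  rw [functionField_eq i, IntermediateField.mem_adjoin_iff_div] at hz
  obtain ⟨a, ha, b, hb, rfl⟩ := hz
  rcases eq_or_ne b 0 with rfl | hb0
  · exact ⟨0, zero_mem _, 1, one_mem _, one_ne_zero, by simp⟩
  · exact ⟨a, adjoin_le_chartRing i ha, b, adjoin_le_chartRing i hb, hb0, rfl⟩

lemma aeval_affineCoord_of_isHomogeneous (i : Fin 3) {m : ℕ} {a : MvPolynomial (Fin 3) k}
    (ha : a.IsHomogeneous m) :
    aeval (affineCoord k i) a = aeval (coord k) a / coord k i ^ m := by
  have : affineCoord k i = fun j => (coord k i)⁻¹ * coord k j := by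
    ext j
    rw [affineCoord, div_eq_inv_mul]
  rw [this, aeval_smul_of_isHomogeneous ha, inv_pow, div_eq_inv_mul]

lemma isLocalizationOf_planeLocalRing {x : ProjPoint k 2} {i : Fin 3}
    (hi : X i ∉ x.asHomogeneousIdeal) : IsLocalizationOf (chartRing k i) (planeLocalRing x) := by
  have hc := hasCenter_planeLocalRing x
  refine ⟨chartRing_le i (algebraMap_mem_planeLocalRing x) fun j => ?_, fun z hz => ?_⟩
  · simpa [affineCoord] using
      (hc 1 (X j) (X i) (isHomogeneous_X k j) (isHomogeneous_X k i) hi).1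
  · obtain ⟨m, a, b, ha, hb, hbx, rfl⟩ := mem_planeLocalRing.1 hz
    refine ⟨_, aeval_affineCoord_mem_chartRing i a, _, aeval_affineCoord_mem_chartRing i b, ?_, ?_⟩
    · rw [aeval_affineCoord_of_isHomogeneous i hb]
      have := (hc m b (X i ^ m) hb (isHomogeneous_X_pow i m)
        fun h => hi (x.isPrime.mem_of_pow_mem m h)).2
      rw [map_pow, aeval_X] at this
      rwa [this]
    · rw [aeval_affineCoord_of_isHomogeneous i hb, aeval_affineCoord_of_isHomogeneous i ha,
        div_div_div_cancel_right₀ (pow_ne_zero _ (coord_ne_zero i))]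

/-- Evaluation of polynomials in two variables at the affine coordinates of a chart. -/
noncomputable def chartEval (k : Type*) [Field k] (i : Fin 3) :
    Polynomial (Polynomial k) →+* Ambient k :=
  Polynomial.eval₂RingHom
    (Polynomial.aeval (affineCoord k i (i + 1)) : Polynomial k →ₐ[k] Ambient k).toRingHom
    (affineCoord k i (i + 2))

lemma chartEval_C (i : Fin 3) (p : Polynomial k) :
    chartEval k i (Polynomial.C p) = Polynomial.aeval (affineCoord k i (i + 1)) p := by
  simp [chartEval]

lemma chartEval_X (i : Fin 3) : chartEval k i Polynomial.X = affineCoord k i (i + 2) := by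
  simp [chartEval]

/-- If p vanishes at the affine coordinates, then P vanishes at the algebraically independent
homogeneous coordinates, so P = 0, and dehomogenizing gives p = 0. No homogeneity of P is needed for
this. -/
lemma exists_homogenization (i : Fin 3) (p : Polynomial (Polynomial k)) :
    ∃ (N : ℕ) (P : MvPolynomial (Fin 3) k),
      aeval (coord k) P = coord k i ^ N * chartEval k i p ∧
      aeval (fun j => if j = i then 1 else if j = i + 1 then Polynomial.C Polynomial.X
        else (Polynomial.X : Polynomial (Polynomial k))) P = p := by
  set σ : MvPolynomial (Fin 3) k →ₐ[k] Polynomial (Polynomial k) :=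
    aeval (fun j => if j = i then 1 else if j = i + 1 then Polynomial.C Polynomial.X
        else (Polynomial.X : Polynomial (Polynomial k))) with hσ
  let Q : Polynomial (Polynomial k) → Prop := fun p => ∃ (N : ℕ) (P : MvPolynomial (Fin 3) k),
      aeval (coord k) P = coord k i ^ N * chartEval k i p ∧ σ P = p
  have hi : σ (X i) = 1 := by simp [hσ]
  have hadd : ∀ p q, Q p → Q q → Q (p + q) := by
    rintro p q ⟨N, P, h1, h2⟩ ⟨N', P', h1', h2'⟩
    refine ⟨N + N', X i ^ N' * P + X i ^ N * P', ?_, ?_⟩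
    · rw [map_add, map_mul, map_mul, map_pow, map_pow, h1, h1', aeval_X, map_add]
      ring
    · rw [map_add, map_mul, map_mul, map_pow, map_pow, h2, h2', hi]
      simp
  have hmul : ∀ p q, Q p → Q q → Q (p * q) := by
    rintro p q ⟨N, P, h1, h2⟩ ⟨N', P', h1', h2'⟩
    refine ⟨N + N', P * P', ?_, ?_⟩
    · rw [map_mul, h1, h1', map_mul]
      ring
    · rw [map_mul, h2, h2']
  have hX : Q Polynomial.X := by
    refine ⟨1, X (i + 2), ?_, ?_⟩
    · rw [aeval_X, chartEval_X, affineCoord, pow_one, mul_div_cancel₀ _ (coord_ne_zero i)]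
    · simp [hσ, fin_three_ne i]
  have hC : ∀ q : Polynomial k, Q (Polynomial.C q) := by
    intro q
    have hc : ∀ c : k, Q (Polynomial.C (Polynomial.C c)) := fun c =>
      ⟨0, C c, by rw [chartEval_C]; simp, by simp [hσ]⟩
    have hY : Q (Polynomial.C Polynomial.X) := by
      refine ⟨1, X (i + 1), ?_, ?_⟩
      · rw [aeval_X, chartEval_C, Polynomial.aeval_X, affineCoord, pow_one,
          mul_div_cancel₀ _ (coord_ne_zero i)]
      · simp [hσ, fin_three_ne i]
    induction q using Polynomial.induction_on with
    | C c => exact hc c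
    | add p q hp hq => exact Polynomial.C_add (R := Polynomial k) ▸ hadd _ _ hp hq
    | monomial n c h =>
      rw [pow_succ, ← mul_assoc, Polynomial.C_mul]
      exact hmul _ _ h hY
  change Q p
  induction p using Polynomial.induction_on with
  | C q => exact hC q
  | add p q hp hq => exact hadd _ _ hp hq
  | monomial n c h =>
    rw [pow_succ, ← mul_assoc]
    exact hmul _ _ h hX

lemma chartEval_injective (i : Fin 3) : Function.Injective (chartEval k i) := by
  rw [injective_iff_map_eq_zero]
  intro p hp
  obtain ⟨N, P, h1, h2⟩ := exists_homogenization i p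
  rw [hp, mul_zero, ← map_zero (aeval (coord k) : MvPolynomial (Fin 3) k →ₐ[k] Ambient k)] at h1
  rw [← h2, aeval_coord_injective h1, map_zero]

lemma range_chartEval (i : Fin 3) : (chartEval k i).range = chartRing k i := by
  refine le_antisymm ?_ (adjoinElement_le ?_ ⟨Polynomial.X, chartEval_X i⟩)
  · rintro _ ⟨p, rfl⟩
    rw [chartEval, Polynomial.coe_eval₂RingHom, Polynomial.eval₂_eq_sum_range]
    exact sum_mem fun n _ => mul_mem (chartBase_le_chartRing i (aeval_mem_chartBase i _))
      (pow_mem (affineCoord_mem_chartRing i _) n)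
  · rintro _ ⟨p, rfl⟩
    exact ⟨Polynomial.C p, chartEval_C i p⟩

instance (i : Fin 3) : IsIntegrallyClosed (chartRing k i) := by
  rw [← range_chartEval]
  exact IsIntegrallyClosed.of_equiv
    (RingEquiv.ofBijective (chartEval k i).rangeRestrict
      ⟨fun a b h => chartEval_injective i (congrArg Subtype.val h),
        RingHom.rangeRestrict_surjective _⟩)

lemma mem_chartRing_of_isIntegral (i : Fin 3) {z : Ambient k} (hz : z ∈ functionField k)
    (h : IsIntegral (chartRing k i) z) : z ∈ chartRing k i := by
  obtain ⟨a, ha, b, hb, -, rfl⟩ := exists_div_chartRing i hz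
  exact div_mem_of_isIntegral ha hb h

lemma exists_irreducible_mem_maxSet {S : LocalSubring (Ambient k)} {t : Ambient k}
    (hk : ∀ c : k, algebraMap k (Ambient k) c ∈ S.toSubring) (ht : t ∈ S.toSubring)
    (h : ∃ p : Polynomial k, p ≠ 0 ∧ Polynomial.aeval t p ∈ maxSet S) :
    ∃ g : Polynomial k, Irreducible g ∧
      ∀ p : Polynomial k, Polynomial.aeval t p ∈ maxSet S ↔ g ∣ p := by
  let φ : Polynomial k →+* S.toSubring :=
    (Polynomial.aeval t : Polynomial k →ₐ[k] Ambient k).toRingHom.codRestrict S.toSubring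
      (aeval_mem hk ht)
  let I := (IsLocalRing.maximalIdeal S.toSubring).comap φ
  have hI : ∀ p, Polynomial.aeval t p ∈ maxSet S ↔ p ∈ I := fun p =>
    mem_maxSet_coe (z := φ p)
  obtain ⟨p, hp, hpm⟩ := h
  have hI0 : I ≠ ⊥ := fun h => hp (by simpa [h] using (hI p).1 hpm)
  refine ⟨Submodule.IsPrincipal.generator I,
    (Submodule.IsPrincipal.prime_generator_of_isPrime I hI0).irreducible, fun p => ?_⟩
  rw [hI, Submodule.IsPrincipal.mem_iff_generator_dvd]

/-- The chart is k[t][s]. If the maximal ideal of `S` meets k[t] nontrivially, it does so in the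
multiples of an irreducible g, and the criterion applies with base k[t] and x = g(t). Otherwise `S`
contains the field k(t), which becomes the base, with x = 0. -/
theorem isSurfacePoint_of_isLocalizationOf_chartRing {i : Fin 3} {S : LocalSubring (Ambient k)}
    (hloc : IsLocalizationOf (chartRing k i) S) : IsSurfacePoint (functionField k) S := by
  have hk : ∀ c : k, algebraMap k (Ambient k) c ∈ S.toSubring := fun c =>
    hloc.1 (algebraMap_mem_chartRing i c)
  have hK : ∀ z ∈ S.toSubring, z ∈ functionField k := by
    intro z hz
    obtain ⟨a, ha, b, hb, -, rfl⟩ := hloc.2 z hz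
    exact (functionField k).div_mem (chartRing_le_functionField i ha)
      (chartRing_le_functionField i hb)
  have hfrac : ∀ z ∈ functionField k, ∃ a ∈ S.toSubring, ∃ b ∈ S.toSubring, b ≠ 0 ∧ z = a / b := by
    intro z hz
    obtain ⟨a, ha, b, hb, h⟩ := exists_div_chartRing i hz
    exact ⟨a, hloc.1 ha, b, hloc.1 hb, h⟩
  have hnoeth := hloc.isNoetherianRing
  have hnormal : ∀ z ∈ functionField k, IsIntegral S.toSubring z → z ∈ S.toSubring :=
    fun z hz h => hloc.mem_of_isIntegral (K := functionField k)
      (fun b hb z hz => mul_mem (chartRing_le_functionField i hb) hz)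
      (fun z hz h => mem_chartRing_of_isIntegral i hz h) hz h
  have ht := hloc.1 (affineCoord_mem_chartRing i (i + 1))
  have hbase := (chartBase_le_chartRing i).trans hloc.1
  by_cases h : ∃ p : Polynomial k, p ≠ 0 ∧
      Polynomial.aeval (affineCoord k i (i + 1)) p ∈ maxSet S
  · obtain ⟨g, hg, hgdvd⟩ := exists_irreducible_mem_maxSet hk ht h
    refine isSurfacePoint_of_isLocalizationOf_adjoinElement hloc ((hgdvd g).2 dvd_rfl) ?_ ?_ hk hK
      hfrac hnoeth hnormal (fun _ => ?_) (fun _ => ?_)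
    · rintro _ ⟨p, rfl⟩ hp
      -- A Bézout relation with g inverts p modulo the maximal ideal.
      obtain ⟨u, v, huv⟩ := (hg.coprime_iff_not_dvd.2 fun h => hp ((hgdvd p).2 h)).symm
      refine ⟨_, aeval_mem_chartBase i u, ?_⟩
      have := congrArg (Polynomial.aeval (affineCoord k i (i + 1))) huv
      rw [map_add, map_mul, map_mul, map_one] at this
      have h2 := mul_mem_maxSet (hbase (aeval_mem_chartBase i (-v))) ((hgdvd g).2 dvd_rfl)
      convert h2 using 1
      rw [map_neg, ← this]
      change Polynomial.aeval _ p * _ - _ = _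
      ring
    · rintro _ ⟨p, rfl⟩ hp
      obtain ⟨q, rfl⟩ := (hgdvd p).1 hp
      refine ⟨_, chartBase_le_chartRing i (aeval_mem_chartBase i q), ?_⟩
      exact (map_mul (Polynomial.aeval (affineCoord k i (i + 1))) g q).trans (mul_comm _ _)
    · have hdvd : ∀ p, Polynomial.C g ∣ p → ∃ c ∈ chartRing k i, chartEval k i p =
          c * Polynomial.aeval (affineCoord k i (i + 1)) g := by
        rintro _ ⟨q, rfl⟩
        refine ⟨chartEval k i q, range_chartEval (k := k) i ▸ ⟨q, rfl⟩, ?_⟩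
        rw [map_mul, chartEval_C, mul_comm]
      change ∀ a ∈ chartRing k i, ∀ b ∈ chartRing k i, (∃ c ∈ chartRing k i, _) →
        (∃ c ∈ chartRing k i, _) ∨ (∃ c ∈ chartRing k i, _)
      intro a ha b hb
      rintro ⟨c, hc, hab⟩
      rw [← range_chartEval] at ha hb hc
      obtain ⟨a, rfl⟩ := ha
      obtain ⟨b, rfl⟩ := hb
      obtain ⟨c, rfl⟩ := hc
      rw [← chartEval_C, ← map_mul, ← map_mul] at hab
      have hab := chartEval_injective i hab
      exact ((Polynomial.prime_C_iff.2 hg.prime).dvd_or_dvd ⟨c, by rw [hab, mul_comm]⟩).imp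
        (hdvd a) (hdvd b)
    · rintro _ ⟨p, rfl⟩
      exact aeval_mem (algebraMap_mem_residueAlgebraicSubring hk)
        ((mem_residueAlgebraicSubring hk).2 ⟨ht, g, hg.ne_zero, (hgdvd g).2 dvd_rfl⟩) p
  · push Not at h
    obtain ⟨R, hbR, hRS, hinv⟩ : ∃ R : Subring (Ambient k), chartBase k i ≤ R ∧
        R ≤ S.toSubring ∧ ∀ r ∈ R, r⁻¹ ∈ R := by
      refine ⟨(IntermediateField.adjoin k {affineCoord k i (i + 1)}).toSubring, ?_, fun z hz => ?_,
        fun r hr => IntermediateField.inv_mem _ hr⟩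
      · rintro _ ⟨p, rfl⟩
        have hself := IntermediateField.mem_adjoin_simple_self k (affineCoord k i (i + 1))
        exact aeval_mem (A := (IntermediateField.adjoin k {affineCoord k i (i + 1)}).toSubring)
          (IntermediateField.algebraMap_mem _) hself p
      obtain ⟨a, ha, b, hb, rfl⟩ := IntermediateField.mem_adjoin_iff_div.1 hz
      rw [Algebra.adjoin_singleton_eq_range_aeval] at ha hb
      obtain ⟨p, hp⟩ : ∃ p, Polynomial.aeval (affineCoord k i (i + 1)) p = a := ha
      obtain ⟨q, hq⟩ : ∃ q, Polynomial.aeval (affineCoord k i (i + 1)) q = b := hb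
      rw [div_eq_mul_inv, ← hp]
      refine mul_mem (aeval_mem hk ht p) ?_
      rcases eq_or_ne q 0 with rfl | hq0
      · rw [← hq, map_zero, inv_zero]
        exact zero_mem _
      · rw [← hq]
        exact inv_mem_of_notMem_maxSet (aeval_mem hk ht q) (h q hq0)
    have hloc' : IsLocalizationOf (adjoinElement R (affineCoord k i (i + 2))) S :=
      hloc.mono (adjoinElement_le (hbR.trans (le_adjoinElement _ _)) (self_mem_adjoinElement _ _))
        (adjoinElement_le hRS (hloc.1 (affineCoord_mem_chartRing i _)))
    refine isSurfacePoint_of_isLocalizationOf_adjoinElement hloc' (zero_mem_maxSet S) ?_ ?_ hk hK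
      hfrac hnoeth hnormal (fun h => absurd rfl h) (fun h => absurd rfl h)
    · intro r hr hrm
      refine ⟨r⁻¹, hinv r hr, ?_⟩
      rw [mul_inv_cancel₀ (ne_zero_of_notMem_maxSet hrm), sub_self]
      exact zero_mem_maxSet S
    · intro r hr hrm
      refine ⟨0, zero_mem _, ?_⟩
      rw [zero_mul]
      by_contra hr0
      exact notMem_maxSet_of_inv_mem hr0 (hRS (hinv r hr)) hrm

lemma isSurfacePoint_planeLocalRing (x : ProjPoint k 2) :
    IsSurfacePoint (functionField k) (planeLocalRing x) := by
  obtain ⟨i, hi⟩ := x.exists_X_notMem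
  exact isSurfacePoint_of_isLocalizationOf_chartRing (isLocalizationOf_planeLocalRing hi)

lemma finite_isIndeterminate_plane {f : Ambient k} (hf : f ∈ functionField k) :
    {S ∈ plane k | IsIndeterminate f S}.Finite := by
  refine (Set.finite_iUnion fun i : Fin 3 => finite_isIndeterminate hf (chartRing k i)
    (algebraMap_mem_chartRing i) (zero_mem _)
    (fun S hS _ => isSurfacePoint_of_isLocalizationOf_chartRing hS)).subset ?_
  rintro _ ⟨⟨x, rfl⟩, h⟩
  obtain ⟨i, hi⟩ := x.exists_X_notMem
  exact Set.mem_iUnion.2 ⟨i, isLocalizationOf_planeLocalRing hi, zero_mem_maxSet _, h⟩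

end PlaneCharts

/-! ### Models over the plane: properties preserved by point blow-ups. -/

section Models

attribute [local instance] MvPolynomial.gradedAlgebra

variable {k : Type*} [Field k]

/-- The properties of a regular projective surface over the plane used below. -/
structure IsRegularModel (W : Set (LocalSubring (Ambient k))) : Prop where
  isSurfacePoint : ∀ S ∈ W, IsSurfacePoint (functionField k) S
  exists_center : ∀ V : ValuationSubring (Ambient k), (∀ c : k, algebraMap k (Ambient k) c ∈ V) →
    ∃ S ∈ W, S ≤ V.toLocalSubring
  center_unique : ∀ V : ValuationSubring (Ambient k), ∀ S ∈ W, ∀ S' ∈ W,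
    S ≤ V.toLocalSubring → S' ≤ V.toLocalSubring → S = S'
  exists_planeLocalRing_le : ∀ S ∈ W, ∃ x : ProjPoint k 2, planeLocalRing x ≤ S
  finite_isIndeterminate : ∀ f ∈ functionField k, {S ∈ W | IsIndeterminate f S}.Finite

lemma isRegularModel_plane : IsRegularModel (plane k) where
  isSurfacePoint := by
    rintro _ ⟨x, rfl⟩
    exact isSurfacePoint_planeLocalRing x
  exists_center V hk := by
    obtain ⟨x, hx⟩ := exists_planeLocalRing_le V hk
    exact ⟨_, ⟨x, rfl⟩, hx⟩
  center_unique := by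
    rintro V _ ⟨x, rfl⟩ _ ⟨y, rfl⟩ hx hy
    rw [eq_of_planeLocalRing_le hx hy]
  exists_planeLocalRing_le := by
    rintro _ ⟨x, rfl⟩
    exact ⟨x, le_rfl⟩
  finite_isIndeterminate _ hf := finite_isIndeterminate_plane hf

/-- A valuation ring with the affine coordinate t in its maximal ideal omits 1/t. It shows that `K`
alone is not a complete model. -/
lemma exists_valuationSubring_notMem :
    ∃ V : ValuationSubring (Ambient k), (∀ c : k, algebraMap k (Ambient k) c ∈ V) ∧
      ∃ z ∈ functionField k, z ∉ V := by
  have ht : affineCoord k 0 (0 + 1) ∈ chartBase k 0 := ⟨Polynomial.X, by simp⟩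
  have ht0 : affineCoord k 0 (0 + 1) ≠ 0 := div_ne_zero (coord_ne_zero _) (coord_ne_zero _)
  have hI : Ideal.span {(⟨_, ht⟩ : chartBase k 0)} ≠ ⊤ := by
    rw [Ne, Ideal.eq_top_iff_one, Ideal.mem_span_singleton]
    rintro ⟨⟨_, p, rfl⟩, hp⟩
    have hp : 1 = affineCoord k 0 (0 + 1) * Polynomial.aeval (affineCoord k 0 (0 + 1)) p :=
      congrArg Subtype.val hp
    have h2 : chartEval k 0 1 = chartEval k 0 (Polynomial.C (Polynomial.X * p)) := by
      rw [chartEval_C, map_mul, Polynomial.aeval_X, ← hp, map_one]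
    have h3 := Polynomial.C_injective ((chartEval_injective 0 h2).symm.trans Polynomial.C_1.symm)
    exact Polynomial.not_isUnit_X (IsUnit.of_mul_eq_one _ h3)
  obtain ⟨V, hV, hVI⟩ := Ideal.image_subset_nonunits_valuationSubring _ hI
  refine ⟨V, fun c => hV ⟨Polynomial.C c, by simp⟩, (affineCoord k 0 (0 + 1))⁻¹,
    inv_mem (affineCoord_mem_functionField 0 _), ?_⟩
  exact (V.inv_mem_nonunits_iff.1 (by
    rw [inv_inv]
    exact hVI ⟨_, Ideal.subset_span rfl, rfl⟩)).resolve_left (inv_ne_zero ht0)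

variable {W : Set (LocalSubring (Ambient k))} {R : LocalSubring (Ambient k)}

lemma IsSurfacePoint.mem_of_maxSet_eq_zero {K : IntermediateField k (Ambient k)}
    (hR : IsSurfacePoint K R) (h : ∀ a ∈ maxSet R, a = 0) {z : Ambient k} (hz : z ∈ K) :
    z ∈ R.toSubring := by
  obtain ⟨a, ha, b, hb, hb0, rfl⟩ := hR.exists_div z hz
  rw [div_eq_mul_inv]
  exact mul_mem ha (inv_mem_of_notMem_maxSet hb fun hbm => hb0 (h b hbm))

/-- A zero maximal ideal means R = `K`, which contains every other point of `W`; closedness would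
leave only this point, and a proper valuation ring of `K` would have no center. -/
lemma IsRegularModel.exists_ne_zero_of_isClosedPoint (hW : IsRegularModel W)
    (hR : IsClosedPoint W R) : ∃ a ∈ maxSet R, a ≠ 0 := by
  by_contra! h
  have hKR : ∀ z ∈ functionField k, z ∈ R.toSubring := fun z hz =>
    (hW.isSurfacePoint R hR.1).mem_of_maxSet_eq_zero h hz
  obtain ⟨V, hkV, z, hz, hzV⟩ := exists_valuationSubring_notMem (k := k)
  obtain ⟨S, hS, hSV⟩ := hW.exists_center V hkV
  have hSR := hR.2 S hS fun z hz => hKR z ((hW.isSurfacePoint S hS).subset z hz)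
  exact hzV (hSV.1 (hSR ▸ hKR z hz))

lemma finite_isIndeterminate_blowUpFibre {f : Ambient k} (hf : f ∈ functionField k)
    (hR : IsSurfacePoint (functionField k) R) :
    {S ∈ blowUpFibre R | IsIndeterminate f S}.Finite := by
  rcases hR.divisorial_or_regular with hdiv | hreg
  · exact (Set.finite_singleton R).subset fun S hS => eq_of_mem_blowUpFibre hR hdiv hS.1
  · obtain ⟨x, y, h⟩ := hreg.exists_parameters
    have := hreg.noetherian
    have key : ∀ x y, IsParameterSystem R x y →
        {S | IsLocalizationOf (adjoinElement R.toSubring (y / x)) S ∧ x ∈ maxSet S ∧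
          IsIndeterminate f S}.Finite := fun x y h =>
      finite_isIndeterminate hf _ (fun c => le_adjoinElement _ _ (hR.algebraMap_mem c))
        (le_adjoinElement _ _ h.left_mem.1) fun S hS hx => isSurfacePoint_of_chart hR hreg h hS hx
    refine ((key x y h).union (key y x h.symm)).subset ?_
    rintro S ⟨hS, hfS⟩
    exact (exists_chart_of_mem_blowUpFibre h hS).imp
      (fun hloc => ⟨hloc, mem_maxSet_of_le hS.1 h.left_mem, hfS⟩)
      (fun hloc => ⟨hloc, mem_maxSet_of_le hS.1 h.right_mem, hfS⟩)

theorem IsRegularModel.blowUp (hW : IsRegularModel W) (hR : IsClosedPoint W R) :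
    IsRegularModel (blowUp W R) where
  isSurfacePoint := by
    rintro S (⟨hS, -⟩ | hS)
    · exact hW.isSurfacePoint S hS
    · exact isSurfacePoint_of_mem_blowUpFibre (hW.isSurfacePoint R hR.1) hS
  exists_center V hk := by
    obtain ⟨S, hS, hSV⟩ := hW.exists_center V hk
    rcases eq_or_ne S R with rfl | hne
    · obtain ⟨S', hS', hSV'⟩ := exists_mem_blowUpFibre_le_of_isSurfacePoint
        (hW.isSurfacePoint S hS) (hW.exists_ne_zero_of_isClosedPoint hR) hSV
      exact ⟨S', .inr hS', hSV'⟩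
    · exact ⟨S, .inl ⟨hS, hne⟩, hSV⟩
  center_unique := by
    have key : ∀ V : ValuationSubring (Ambient k), ∀ S ∈ W \ {R}, ∀ S' ∈ blowUpFibre R,
        S ≤ V.toLocalSubring → S' ≤ V.toLocalSubring → False := fun V S hS S' hS' h h' =>
      hS.2 (hW.center_unique V S hS.1 R hR.1 h (hS'.1.trans h'))
    rintro V S (hS | hS) S' (hS' | hS') h h'
    · exact hW.center_unique V S hS.1 S' hS'.1 h h'
    · exact (key V S hS S' hS' h h').elim
    · exact (key V S' hS' S hS h' h).elim
    · exact eq_of_mem_blowUpFibre_of_le hS hS' h h'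
  exists_planeLocalRing_le := by
    rintro S (⟨hS, -⟩ | hS)
    · exact hW.exists_planeLocalRing_le S hS
    · obtain ⟨x, hx⟩ := hW.exists_planeLocalRing_le R hR.1
      exact ⟨x, hx.trans hS.1⟩
  finite_isIndeterminate f hf := by
    refine ((hW.finite_isIndeterminate f hf).union (finite_isIndeterminate_blowUpFibre hf
      (hW.isSurfacePoint R hR.1))).subset ?_
    rintro S ⟨⟨hS, -⟩ | hS, h⟩
    · exact .inl ⟨hS, h⟩
    · exact .inr ⟨hS, h⟩

theorem IsPointBlowUpSequence.isRegularModel (hW : IsPointBlowUpSequence (plane k) W) :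
    IsRegularModel W := by
  induction hW with
  | refl => exact isRegularModel_plane
  | step W R _ hR ih => exact ih.blowUp hR

/-- A valuation ring dominating `S'` has both points as centers. -/
lemma IsRegularModel.eq_of_le (hW : IsRegularModel W) {S S' : LocalSubring (Ambient k)}
    (hS : S ∈ W) (hS' : S' ∈ W) (h : S ≤ S') : S = S' := by
  obtain ⟨V, hV⟩ := S'.exists_le_valuationSubring
  exact hW.center_unique V S hS S' hS' (h.trans hV) hV

/-- The residue field at an indeterminate point is algebraic over k, so a point of `W` contained in
it is dominated by it, hence equal to it. -/
lemma IsRegularModel.isClosedPoint_of_isIndeterminate (hW : IsRegularModel W) {f : Ambient k}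
    (hf : f ∈ functionField k) (hR : R ∈ W) (h : IsIndeterminate f R) : IsClosedPoint W R :=
  ⟨hR, fun S hS hSR => hW.eq_of_le hS hR (le_of_toSubring_le
    (hW.isSurfacePoint S hS).algebraMap_mem
    (h.isRegularPoint hf (hW.isSurfacePoint R hR)).residueAlgebraic hSR)⟩

end Models

/-! ### Existence of a resolution. -/

section Resolution

attribute [local instance] MvPolynomial.gradedAlgebra

variable {k : Type*} [Field k]

lemma exists_forall_not_isIndeterminate {f : Ambient k} (hf : f ∈ functionField k)
    {W : Set (LocalSubring (Ambient k))} (hW : IsPointBlowUpSequence (plane k) W) :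
    ∃ W', IsPointBlowUpSequence (plane k) W' ∧ ∀ S ∈ W', ¬ IsIndeterminate f S := by
  classical
  obtain ⟨s, hs⟩ : ∃ s : Multiset (LocalSubring (Ambient k)),
      ∀ S ∈ W, IsIndeterminate f S → S ∈ s :=
    ⟨(hW.isRegularModel.finite_isIndeterminate f hf).toFinset.val, fun S hS h => by
      simpa using ⟨hS, h⟩⟩
  let r : LocalSubring (Ambient k) → LocalSubring (Ambient k) → Prop := fun S S' =>
    indeterminacyOrder (functionField k) f S < indeterminacyOrder (functionField k) f S'
  have hr : WellFounded r := (measure (indeterminacyOrder (functionField k) f)).wf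
  -- The multiset only has to contain all indeterminate points. A blow-up removes one entry and
  -- inserts finitely many of smaller order, a well-founded relation on multisets.
  induction s using hr.cutExpand.induction generalizing W with
  | _ s ih =>
  by_cases hbad : ∃ R ∈ W, IsIndeterminate f R
  · obtain ⟨R, hRW, hR⟩ := hbad
    have hWm := hW.isRegularModel
    have hclosed := hWm.isClosedPoint_of_isIndeterminate hf hRW hR
    have hfin := finite_isIndeterminate_blowUpFibre hf (hWm.isSurfacePoint R hRW)
    refine ih (s.erase R + hfin.toFinset.val) ⟨hfin.toFinset.val, R, fun S hS => ?_, ?_⟩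
      (.step W R hW hclosed) ?_
    · have hS : S ∈ blowUpFibre R ∧ IsIndeterminate f S := by simpa using hS
      exact indeterminacyOrder_lt trdeg_functionField_le (hWm.isSurfacePoint R hRW) hf hR hS.1 hS.2
    · rw [add_right_comm, add_comm (s.erase R), Multiset.singleton_add,
        Multiset.cons_erase (hs R hRW hR)]
    · rintro S (⟨hS, hSR⟩ | hS) h
      · exact Multiset.mem_add.2 (.inl ((Multiset.mem_erase_of_ne hSR).2 (hs S hS h)))
      · exact Multiset.mem_add.2 (.inr (by simpa using ⟨hS, h⟩))
  · exact ⟨W, hW, fun S hS h => hbad ⟨S, hS, h⟩⟩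

variable {F G : MvPolynomial (Fin 3) k} {d : ℕ}

/-- The rational function defined by a pencil. -/
noncomputable def pencilFunction (F G : MvPolynomial (Fin 3) k) : Ambient k :=
  pencilCoord F G 0 / pencilCoord F G 1

lemma pencilCoord_zero : pencilCoord F G 0 = aeval (coord k) F := (aeval_coord F).symm

lemma pencilCoord_one : pencilCoord F G 1 = aeval (coord k) G := (aeval_coord G).symm

lemma not_isUnit_of_isHomogeneous (hd : 0 < d) (hF : F.IsHomogeneous d) : ¬ IsUnit F := by
  intro h
  have h1 : constantCoeff F = 0 := hF.coeff_eq_zero (by simpa using hd.ne)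
  exact not_isUnit_zero (h1 ▸ h.map constantCoeff)

lemma pencilCoord_ne_zero (hd : 0 < d) (hF : F.IsHomogeneous d) (hG : G.IsHomogeneous d)
    (hFG : IsRelPrime F G) (i : Fin 2) : pencilCoord F G i ≠ 0 := by
  have hinj := IsFractionRing.injective (MvPolynomial (Fin 3) k) (Ambient k)
  have hF0 : F ≠ 0 := by
    rintro rfl
    exact not_isUnit_of_isHomogeneous hd hG (hFG (dvd_zero G) dvd_rfl)
  have hG0 : G ≠ 0 := by
    rintro rfl
    exact not_isUnit_of_isHomogeneous hd hF (hFG dvd_rfl (dvd_zero F))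
  fin_cases i
  · exact (map_ne_zero_iff _ hinj).2 hF0
  · exact (map_ne_zero_iff _ hinj).2 hG0

lemma pencilFunction_mem (hF : F.IsHomogeneous d) (hG : G.IsHomogeneous d) :
    pencilFunction F G ∈ functionField k := by
  have : pencilFunction F G = aeval (affineCoord k 0) F / aeval (affineCoord k 0) G := by
    rw [pencilFunction, pencilCoord_zero, pencilCoord_one, aeval_affineCoord_of_isHomogeneous 0 hF,
      aeval_affineCoord_of_isHomogeneous 0 hG,
      div_div_div_cancel_right₀ (pow_ne_zero _ (coord_ne_zero 0))]
  rw [this]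
  exact (functionField k).div_mem
    (chartRing_le_functionField 0 (aeval_affineCoord_mem_chartRing 0 F))
    (chartRing_le_functionField 0 (aeval_affineCoord_mem_chartRing 0 G))

/-- The two affine charts of the line correspond to f and f⁻¹ lying in `S`. -/
lemma exists_mapsTo_iff {S : LocalSubring (Ambient k)} (hu : ∀ i, pencilCoord F G i ≠ 0)
    (hk : ∀ c : k, algebraMap k (Ambient k) c ∈ S.toSubring) :
    (∃ q, MapsTo F G S q) ↔ ¬ IsIndeterminate (pencilFunction F G) S := by
  constructor
  · rintro ⟨q, hq⟩ ⟨h1, h2⟩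
    obtain ⟨i, -, hi⟩ := (mapsTo_iff_hasCenter.1 hq).exists_div_mem
    fin_cases i
    · exact h2 (by simpa [pencilFunction] using hi 1)
    · exact h1 (by simpa [pencilFunction] using hi 0)
  · intro h
    rw [IsIndeterminate, not_and_or, not_not, not_not] at h
    simp only [mapsTo_iff_hasCenter]
    rcases h with h | h
    · refine exists_hasCenter hk (hu 1) fun j => ?_
      fin_cases j
      · exact h
      · exact (div_self (hu 1)).symm ▸ one_mem _
    · refine exists_hasCenter hk (hu 0) fun j => ?_
      fin_cases j
      · exact (div_self (hu 0)).symm ▸ one_mem _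
      · simpa [pencilFunction] using h

/-- Blowing up points of indeterminacy eventually resolves the pencil. -/
theorem exists_resolves (hd : 0 < d) (hF : F.IsHomogeneous d) (hG : G.IsHomogeneous d)
    (hFG : IsRelPrime F G) : ∃ W, Resolves F G W := by
  obtain ⟨W, hW, h⟩ := exists_forall_not_isIndeterminate (pencilFunction_mem hF hG) .refl
  exact ⟨W, hW, fun S hS => (exists_mapsTo_iff (pencilCoord_ne_zero hd hF hG hFG)
    (hW.isRegularModel.isSurfacePoint S hS).algebraMap_mem).2 (h S hS)⟩

end Resolution

/-! ### Composite valuation rings with a prescribed center on projective space. -/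

section CompositeValuation

attribute [local instance] MvPolynomial.gradedAlgebra

variable {k : Type*} [Field k] {n : ℕ} {L : Type*} [Field L] [Algebra k L]

lemma mem_maxSet_of_mem_nonunits {U : ValuationSubring L} {z : L} (hz : z ∈ U.nonunits) :
    z ∈ maxSet U.toLocalSubring := by
  refine ⟨U.nonunits_subset hz, ?_⟩
  rw [← inv_inv z, U.inv_mem_nonunits_iff, inv_eq_zero] at hz
  exact hz

/-- The point `u` of projective space is generic modulo the maximal ideal of `V`. -/
def HasGenericCenter (k : Type*) [Field k] [Algebra k L] (u : Fin (n + 1) → L)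
    (V : LocalSubring L) : Prop :=
  ∀ (m : ℕ) (a b : MvPolynomial (Fin (n + 1)) k), a.IsHomogeneous m → b.IsHomogeneous m →
    b ≠ 0 → aeval u a / aeval u b ∈ V.toSubring ∧ (aeval u a / aeval u b ∈ maxSet V ↔ a = 0)

lemma HasGenericCenter.aeval_ne_zero {u : Fin (n + 1) → L} {V : LocalSubring L}
    (h : HasGenericCenter k u V) {m : ℕ} {b : MvPolynomial (Fin (n + 1)) k}
    (hb : b.IsHomogeneous m) (hb0 : b ≠ 0) : aeval u b ≠ 0 := by
  intro h0
  have := (h m b b hb hb hb0).2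
  rw [h0, zero_div] at this
  exact hb0 (this.1 (zero_mem_maxSet V))

lemma ProjPoint.ne_zero_of_notMem {q : ProjPoint k n} {b : MvPolynomial (Fin (n + 1)) k}
    (hb : b ∉ q.asHomogeneousIdeal) : b ≠ 0 :=
  fun h => hb (h ▸ Ideal.zero_mem q.asHomogeneousIdeal.toIdeal)

lemma ProjPoint.one_notMem (q : ProjPoint k n) :
    (1 : MvPolynomial (Fin (n + 1)) k) ∉ q.asHomogeneousIdeal :=
  fun h => q.isPrime.ne_top ((Ideal.eq_top_iff_one _).2 h)

/-- The elements of `V` congruent, modulo the maximal ideal, to the value at `u` of an element of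
the local ring of projective space at `q`. -/
def congruenceSubring {V : LocalSubring L} {u : Fin (n + 1) → L} (h : HasGenericCenter k u V)
    (q : ProjPoint k n) : Subring L where
  carrier := {z | ∃ (m : ℕ) (a b : MvPolynomial (Fin (n + 1)) k), a.IsHomogeneous m ∧
    b.IsHomogeneous m ∧ b ∉ q.asHomogeneousIdeal ∧ z - aeval u a / aeval u b ∈ maxSet V}
  zero_mem' := ⟨0, 0, 1, isHomogeneous_zero _ _ _, isHomogeneous_one _ _, q.one_notMem, by
    simpa using zero_mem_maxSet V⟩
  one_mem' := ⟨0, 1, 1, isHomogeneous_one _ _, isHomogeneous_one _ _, q.one_notMem, by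
    simpa using zero_mem_maxSet V⟩
  add_mem' := by
    rintro z z' ⟨m, a, b, ha, hb, hbq, hz⟩ ⟨m', a', b', ha', hb', hbq', hz'⟩
    refine ⟨m + m', a * b' + b * a', b * b', (ha.mul hb').add (hb.mul ha'), hb.mul hb',
      ProjPoint.mul_notMem hbq hbq', ?_⟩
    convert add_mem_maxSet hz hz' using 1
    have h1 := h.aeval_ne_zero hb (ProjPoint.ne_zero_of_notMem hbq)
    have h2 := h.aeval_ne_zero hb' (ProjPoint.ne_zero_of_notMem hbq')
    simp only [map_add, map_mul]
    field_simp
    ring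
  neg_mem' := by
    rintro z ⟨m, a, b, ha, hb, hbq, hz⟩
    refine ⟨m, -a, b, ha.neg, hb, hbq, ?_⟩
    convert neg_mem_maxSet hz using 1
    rw [map_neg]
    ring
  mul_mem' := by
    rintro z z' ⟨m, a, b, ha, hb, hbq, hz⟩ ⟨m', a', b', ha', hb', hbq', hz'⟩
    refine ⟨m + m', a * a', b * b', ha.mul ha', hb.mul hb', ProjPoint.mul_notMem hbq hbq', ?_⟩
    have h1 := (h m a b ha hb (ProjPoint.ne_zero_of_notMem hbq)).1
    have h2 := (h m' a' b' ha' hb' (ProjPoint.ne_zero_of_notMem hbq')).1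
    have h3 : z ∈ V.toSubring := by simpa using add_mem hz.1 h1
    convert add_mem_maxSet (mul_mem_maxSet h3 hz') (mul_mem_maxSet' hz h2) using 1
    rw [map_mul, map_mul, mul_div_mul_comm]
    ring

lemma div_mem_congruenceSubring {V : LocalSubring L} {u : Fin (n + 1) → L}
    (h : HasGenericCenter k u V) {q : ProjPoint k n} {m : ℕ} {a b : MvPolynomial (Fin (n + 1)) k}
    (ha : a.IsHomogeneous m) (hb : b.IsHomogeneous m) (hbq : b ∉ q.asHomogeneousIdeal) :
    aeval u a / aeval u b ∈ congruenceSubring h q :=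
  ⟨m, a, b, ha, hb, hbq, by simpa using zero_mem_maxSet V⟩

/-- The elements of `congruenceSubring h q` whose value at `q` is zero. -/
def congruenceIdeal {V : LocalSubring L} {u : Fin (n + 1) → L} (h : HasGenericCenter k u V)
    (q : ProjPoint k n) : Ideal (congruenceSubring h q) where
  carrier := {z | ∃ (m : ℕ) (a b : MvPolynomial (Fin (n + 1)) k), a.IsHomogeneous m ∧
    b.IsHomogeneous m ∧ b ∉ q.asHomogeneousIdeal ∧ a ∈ q.asHomogeneousIdeal ∧
      (z : L) - aeval u a / aeval u b ∈ maxSet V}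
  zero_mem' := ⟨0, 0, 1, isHomogeneous_zero _ _ _, isHomogeneous_one _ _, q.one_notMem,
    Ideal.zero_mem q.asHomogeneousIdeal.toIdeal, by simpa using zero_mem_maxSet V⟩
  add_mem' := by
    rintro z z' ⟨m, a, b, ha, hb, hbq, haq, hz⟩ ⟨m', a', b', ha', hb', hbq', haq', hz'⟩
    refine ⟨m + m', a * b' + b * a', b * b', (ha.mul hb').add (hb.mul ha'), hb.mul hb',
      ProjPoint.mul_notMem hbq hbq', Ideal.add_mem q.asHomogeneousIdeal.toIdeal
        (Ideal.mul_mem_right _ _ haq) (Ideal.mul_mem_left _ _ haq'), ?_⟩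
    convert add_mem_maxSet hz hz' using 1
    have h1 := h.aeval_ne_zero hb (ProjPoint.ne_zero_of_notMem hbq)
    have h2 := h.aeval_ne_zero hb' (ProjPoint.ne_zero_of_notMem hbq')
    simp only [map_add, map_mul, Subring.coe_add]
    field_simp
    ring
  smul_mem' := by
    rintro ⟨z, m, a, b, ha, hb, hbq, hz⟩ z' ⟨m', a', b', ha', hb', hbq', haq', hz'⟩
    refine ⟨m + m', a * a', b * b', ha.mul ha', hb.mul hb', ProjPoint.mul_notMem hbq hbq',
      Ideal.mul_mem_left q.asHomogeneousIdeal.toIdeal _ haq', ?_⟩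
    have h1 := (h m a b ha hb (ProjPoint.ne_zero_of_notMem hbq)).1
    have h2 := (h m' a' b' ha' hb' (ProjPoint.ne_zero_of_notMem hbq')).1
    have h3 : z ∈ V.toSubring := by simpa using add_mem hz.1 h1
    convert add_mem_maxSet (mul_mem_maxSet h3 hz') (mul_mem_maxSet' hz h2) using 1
    rw [map_mul, map_mul, mul_div_mul_comm, smul_eq_mul, Subring.coe_mul]
    ring

/-- If 1 were congruent to a/b with a vanishing at q, genericity would force b − a = 0, and b would
vanish at q. -/
lemma congruenceIdeal_ne_top {V : LocalSubring L} {u : Fin (n + 1) → L}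
    (h : HasGenericCenter k u V) (q : ProjPoint k n) : congruenceIdeal h q ≠ ⊤ := by
  rw [Ne, Ideal.eq_top_iff_one]
  rintro ⟨m, a, b, ha, hb, hbq, haq, hz⟩
  have hb0 := ProjPoint.ne_zero_of_notMem hbq
  have h1 : (1 : L) - aeval u a / aeval u b = aeval u (b - a) / aeval u b := by
    rw [map_sub, sub_div, div_self (h.aeval_ne_zero hb hb0)]
  rw [Subring.coe_one, h1] at hz
  have h2 := (h m (b - a) b (hb.sub ha) hb hb0).2.1 hz
  exact hbq (sub_eq_zero.1 h2 ▸ haq)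

/-- A valuation ring composite with `V`, whose center on projective space is a given point. -/
theorem exists_valuationSubring_hasCenter (V : ValuationSubring L) {u : Fin (n + 1) → L}
    (h : HasGenericCenter k u V.toLocalSubring) (q : ProjPoint k n) :
    ∃ U : ValuationSubring L, U ≤ V ∧ (∀ c : k, algebraMap k L c ∈ U) ∧
      HasCenter u U.toLocalSubring q := by
  -- The maximal ideal of `V` lies in `congruenceIdeal` (take a = 0, b = 1). So it consists of
  -- nonunits of `U`, which forces U ≤ V.
  obtain ⟨U, hU, hUI⟩ := Ideal.image_subset_nonunits_valuationSubring _ (congruenceIdeal_ne_top h q)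
  have hI : ∀ (m : ℕ) (a b : MvPolynomial (Fin (n + 1)) k) (z : L), a.IsHomogeneous m →
      b.IsHomogeneous m → b ∉ q.asHomogeneousIdeal → a ∈ q.asHomogeneousIdeal →
      z - aeval u a / aeval u b ∈ maxSet V.toLocalSubring → z ∈ maxSet U.toLocalSubring :=
    fun m a b z ha hb hbq haq hz => mem_maxSet_of_mem_nonunits
      (hUI ⟨⟨z, m, a, b, ha, hb, hbq, hz⟩, ⟨m, a, b, ha, hb, hbq, haq, hz⟩, rfl⟩)
  refine ⟨U, fun z hz => ?_, fun c => ?_, fun m a b ha hb hbq => ⟨?_, fun hm => ?_, fun haq => ?_⟩⟩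
  · by_contra hzV
    have hz0 : z ≠ 0 := by
      rintro rfl
      exact hzV (zero_mem _)
    refine inv_notMem_of_mem_maxSet (inv_ne_zero hz0) (hI 0 0 1 z⁻¹ (isHomogeneous_zero _ _ _)
      (isHomogeneous_one _ _) q.one_notMem (Ideal.zero_mem q.asHomogeneousIdeal.toIdeal) ?_) ?_
    · simpa using mem_valuationSubring_maxSet hzV
    · rwa [inv_inv]
  · have := hU (div_mem_congruenceSubring h (q := q) (isHomogeneous_C _ c) (isHomogeneous_one _ _)
      q.one_notMem)
    simpa using this
  · exact hU (div_mem_congruenceSubring h ha hb hbq)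
  · by_contra haq
    refine inv_notMem_of_mem_maxSet (div_ne_zero
      (h.aeval_ne_zero ha (ProjPoint.ne_zero_of_notMem haq))
      (h.aeval_ne_zero hb (ProjPoint.ne_zero_of_notMem hbq))) hm ?_
    rw [inv_div]
    exact hU (div_mem_congruenceSubring h hb ha haq)
  · exact hI m a b _ ha hb hbq haq (by simpa using zero_mem_maxSet _)

/-- A binary form is recovered from its dehomogenization by a(X₀, X₁) = X₁ᵐ·a(X₀/X₁, 1). -/
lemma eq_zero_of_aeval_eq_zero {m : ℕ} {a : MvPolynomial (Fin 2) k} (ha : a.IsHomogeneous m)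
    (h : aeval (fun j => if j = 0 then Polynomial.X else (1 : Polynomial k)) a = 0) : a = 0 := by
  let M := FractionRing (MvPolynomial (Fin 2) k)
  let x : Fin 2 → M := fun j => algebraMap (MvPolynomial (Fin 2) k) M (X j)
  have hx1 : x 1 ≠ 0 := by simp [x, M, X_ne_zero]
  have h1 : aeval x a = algebraMap (MvPolynomial (Fin 2) k) M a := by
    have : aeval x = IsScalarTower.toAlgHom k (MvPolynomial (Fin 2) k) M := by
      ext j
      simp [x]
    rw [this]
    rfl
  have h2 : x = fun j => x 1 * Polynomial.aeval (x 0 / x 1)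
      (if j = 0 then Polynomial.X else (1 : Polynomial k)) := by
    ext j
    fin_cases j
    · simp [mul_div_cancel₀ _ hx1]
    · simp
  have h3 : aeval x a = 0 := by
    rw [h2, aeval_smul_of_isHomogeneous ha, ← comp_aeval_apply, h, map_zero, mul_zero]
  exact IsFractionRing.injective (MvPolynomial (Fin 2) k) M (by rw [← h1, h3, map_zero])

lemma ResidueTranscendental.mono {V V' : LocalSubring L} {f : L}
    (hk : ∀ c : k, algebraMap k L c ∈ V.toSubring) (h : ResidueTranscendental k f V)
    (hle : V ≤ V') : ResidueTranscendental k f V' :=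
  ⟨hle.1 h.1, fun p hp hm => h.2 p hp (mem_maxSet_of_mem hle.1 (aeval_mem hk h.1 p) hm)⟩

/-- The center on the line is its generic point: a nonzero form in its ideal would dehomogenize to
an algebraic equation for the residue of u₀/u₁. -/
lemma ResidueTranscendental.hasGenericCenter {V : LocalSubring L} {u : Fin 2 → L}
    (hk : ∀ c : k, algebraMap k L c ∈ V.toSubring) (h1 : u 1 ≠ 0)
    (h : ResidueTranscendental k (u 0 / u 1) V) : HasGenericCenter k u V := by
  have hmem : ∀ j, u j / u 1 ∈ V.toSubring := by
    intro j
    fin_cases j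
    · exact h.1
    · exact (div_self h1).symm ▸ one_mem _
  obtain ⟨x, hx⟩ := exists_hasCenter hk h1 hmem
  have key : ∀ (m : ℕ) (a : MvPolynomial (Fin 2) k), a.IsHomogeneous m → a ≠ 0 →
      aeval u a / u 1 ^ m ∉ maxSet V := by
    intro m a ha ha0 hm
    refine h.2 _ (fun h0 => ha0 (eq_zero_of_aeval_eq_zero ha h0)) ?_
    convert hm using 1
    have hu : u = fun j => u 1 * Polynomial.aeval (u 0 / u 1)
        (if j = 0 then Polynomial.X else (1 : Polynomial k)) := by
      ext j
      fin_cases j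
      · simp [mul_div_cancel₀ _ h1]
      · simp
    rw [eq_div_iff (pow_ne_zero m h1)]
    conv_rhs => rw [hu]
    rw [aeval_smul_of_isHomogeneous ha, ← comp_aeval_apply, mul_comm]
  have hX : X 1 ∉ x.asHomogeneousIdeal := by
    obtain ⟨i, hi⟩ := x.exists_X_notMem
    intro hX1
    have h2 := (hx 1 (X 1) (X i) (isHomogeneous_X k 1) (isHomogeneous_X k i) hi).2.2 hX1
    rw [aeval_X, aeval_X] at h2
    refine inv_notMem_of_mem_maxSet (div_ne_zero h1 ?_) h2 ?_
    · simpa using hx.aeval_ne_zero (isHomogeneous_X k i) hi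
    · rw [inv_div]
      exact hmem i
  have hx0 : ∀ (m : ℕ) (a : MvPolynomial (Fin 2) k), a.IsHomogeneous m →
      (a ∈ x.asHomogeneousIdeal ↔ a = 0) := by
    intro m a ha
    refine ⟨fun hax => ?_, fun h0 => h0 ▸ Ideal.zero_mem x.asHomogeneousIdeal.toIdeal⟩
    by_contra ha0
    refine key m a ha ha0 ?_
    have := (hx m a (X 1 ^ m) ha (isHomogeneous_X_pow 1 m)
      fun h => hX (x.isPrime.mem_of_pow_mem m h)).2.2 hax
    rwa [map_pow, aeval_X] at this
  intro m a b ha hb hb0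
  rw [← hx0 m a ha]
  exact hx m a b ha hb fun h => hb0 ((hx0 m b hb).1 h)

end CompositeValuation

/-! ### Dicritical divisors over the base points. -/

section Dicritical

attribute [local instance] MvPolynomial.gradedAlgebra

variable {k : Type*} [Field k] {F G : MvPolynomial (Fin 3) k} {d : ℕ}
  {W : Set (LocalSubring (Ambient k))}

/-- If G/F = a/b with b not vanishing at x, then F divides G·b, hence b, and b would vanish at x
together with F. -/
lemma div_notMem_planeLocalRing {x : ProjPoint k 2} (hFG : IsRelPrime F G) (hF0 : F ≠ 0)
    (hF : F ∈ x.asHomogeneousIdeal) :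
    aeval (coord k) G / aeval (coord k) F ∉ (planeLocalRing x).toSubring := by
  intro h
  obtain ⟨m, a, b, -, -, hbx, hab⟩ := mem_planeLocalRing.1 h
  have hF0' : aeval (coord k) F ≠ 0 := fun h0 => hF0 (aeval_coord_injective (by
    rw [h0, map_zero]))
  rw [div_eq_div_iff hF0' (aeval_coord_ne_zero hbx), ← map_mul, ← map_mul] at hab
  have hdvd : F ∣ G * b := ⟨a, by rw [aeval_coord_injective hab, mul_comm]⟩
  obtain ⟨c, rfl⟩ := hFG.dvd_of_dvd_mul_left hdvd
  exact hbx (Ideal.mul_mem_right c x.asHomogeneousIdeal.toIdeal hF)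

lemma IsBasePoint.isIndeterminate {x : ProjPoint k 2} (hx : IsBasePoint F G x)
    (hFG : IsRelPrime F G) (hu : ∀ i, pencilCoord F G i ≠ 0) :
    IsIndeterminate (pencilFunction F G) (planeLocalRing x) := by
  have hF0 : F ≠ 0 := by
    rintro rfl
    exact hu 0 (map_zero _)
  have hG0 : G ≠ 0 := by
    rintro rfl
    exact hu 1 (map_zero _)
  rw [IsIndeterminate, pencilFunction, inv_div, pencilCoord_zero, pencilCoord_one]
  exact ⟨div_notMem_planeLocalRing hFG.symm hG0 hx.2, div_notMem_planeLocalRing hFG hF0 hx.1⟩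

/-- The only subrings of `K` containing the divisorial ring `V` are `V` and `K`, and `K` is the
generic point of the plane, where no exceptional point lies. -/
lemma IsRegularModel.isExceptionalComponent (hW : IsRegularModel W)
    {V : LocalSubring (Ambient k)} (hV : V ∈ W) (hVp : V ∉ plane k)
    (hdiv : IsDivisorial (functionField k) V) : IsExceptionalComponent (plane k) W V := by
  refine ⟨hV, hVp, fun S hS hSp hVS => ?_⟩
  obtain ⟨π, hπ, hπ0, h⟩ := hdiv
  by_cases hπS : π⁻¹ ∈ S.toSubring
  · have hKS : ∀ z ∈ functionField k, z ∈ S.toSubring := by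
      intro z hz
      rcases eq_or_ne z 0 with rfl | hz0
      · exact zero_mem _
      obtain ⟨n, h1, -⟩ := h z hz hz0
      have h2 : π ^ (-n) ∈ S.toSubring := by
        obtain ⟨m, hm | hm⟩ := Int.eq_nat_or_neg (-n)
        · rw [hm, zpow_natCast]
          exact pow_mem (hVS hπ) m
        · rw [hm, zpow_neg, zpow_natCast, ← inv_pow]
          exact pow_mem hπS m
      have := mul_mem (hVS h1) h2
      rwa [mul_assoc, ← zpow_add₀ hπ0, add_neg_cancel, zpow_zero, mul_one] at this
    -- Here S = `K`; the plane point it dominates has zero maximal ideal, hence is also `K`, so `S`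
    -- would lie on the plane.
    obtain ⟨y, hy⟩ := hW.exists_planeLocalRing_le S hS
    have hymax : ∀ a ∈ maxSet (planeLocalRing y), a = 0 := by
      intro a ha
      by_contra ha0
      refine inv_notMem_of_mem_maxSet ha0 (mem_maxSet_of_le hy ha) (hKS _ (inv_mem ?_))
      exact (isSurfacePoint_planeLocalRing y).subset a ha.1
    refine absurd ⟨y, LocalSubring.toSubring_injective (le_antisymm hy.1 fun z hz => ?_)⟩ hSp
    exact (isSurfacePoint_planeLocalRing y).mem_of_maxSet_eq_zero hymax
      ((hW.isSurfacePoint S hS).subset z hz)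
  · refine LocalSubring.toSubring_injective (le_antisymm (fun z hz => ?_) hVS)
    rcases eq_or_ne z 0 with rfl | hz0
    · exact zero_mem _
    obtain ⟨n, h1, h2⟩ := h z ((hW.isSurfacePoint S hS).subset z hz) hz0
    rcases le_or_gt n 0 with hn | hn
    · obtain ⟨m, hm⟩ := Int.eq_ofNat_of_zero_le (neg_nonneg.2 hn)
      have := mul_mem h1 (pow_mem hπ m)
      rwa [← zpow_natCast, ← hm, mul_assoc, ← zpow_add₀ hπ0, add_neg_cancel, zpow_zero,
        mul_one] at this
    · refine absurd ?_ hπS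
      obtain ⟨m, rfl⟩ : ∃ m : ℕ, n = m + 1 := ⟨(n - 1).toNat, by omega⟩
      have := mul_mem (mul_mem hz (hVS h2)) (pow_mem (hVS hπ) m)
      convert this using 1
      rw [zpow_add₀ hπ0, zpow_natCast, zpow_one]
      field_simp

/-- The center on `W` of a valuation ring at which the pencil has a transcendental residue. -/
lemma isDivisorial_of_residueTranscendental {f : Ambient k} {V : ValuationSubring (Ambient k)}
    {S : LocalSubring (Ambient k)} (hS : IsSurfacePoint (functionField k) S)
    (hSV : S ≤ V.toLocalSubring) (h : ResidueTranscendental k f V.toLocalSubring)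
    (hf : ¬ IsIndeterminate f S) : f ∈ S.toSubring ∧ IsDivisorial (functionField k) S := by
  have hfS : f ∈ S.toSubring := by
    by_contra hfS
    have hf' : f⁻¹ ∈ S.toSubring := by
      by_contra hf'
      exact hf ⟨hfS, hf'⟩
    have hf0 : f ≠ 0 := by
      rintro rfl
      exact hfS (zero_mem _)
    refine hfS (inv_inv f ▸ inv_mem_of_notMem_maxSet hf' fun hm => ?_)
    exact inv_notMem_of_mem_maxSet (inv_ne_zero hf0) (mem_maxSet_of_le hSV hm)
      ((inv_inv f).symm ▸ h.1)
  refine ⟨hfS, hS.divisorial_or_regular.resolve_right fun hreg => ?_⟩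
  obtain ⟨p, hp, hpm⟩ := hreg.residueAlgebraic f hfS
  exact h.2 p hp (mem_maxSet_of_le hSV hpm)

/-- Every base point is the center of a dicritical divisor. -/
theorem exists_isDicritical (hd : 0 < d) (hF : F.IsHomogeneous d) (hG : G.IsHomogeneous d)
    (hFG : IsRelPrime F G) (hW : Resolves F G W) {x : ProjPoint k 2} (hx : IsBasePoint F G x) :
    ∃ V, IsDicritical F G W V ∧ planeLocalRing x ≤ V := by
  have hu := pencilCoord_ne_zero hd hF hG hFG
  have hWm := hW.isPointBlowUpSequence.isRegularModel
  have hfx := hx.isIndeterminate hFG hu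
  obtain ⟨V₀, hxV₀, -, hV₀⟩ := exists_residueTranscendental (isSurfacePoint_planeLocalRing x)
    (pencilFunction_mem hF hG) hfx
  obtain ⟨V', hV'⟩ := V₀.exists_le_valuationSubring
  have hk₀ : ∀ c : k, algebraMap k (Ambient k) c ∈ V₀.toSubring := fun c =>
    hxV₀.1 (algebraMap_mem_planeLocalRing x c)
  have hk' : ∀ c : k, algebraMap k (Ambient k) c ∈ V' := fun c => hV'.1 (hk₀ c)
  have htr := hV₀.mono hk₀ hV'
  obtain ⟨V, hVW, hVV'⟩ := hWm.exists_center V' hk'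
  have hV := hWm.isSurfacePoint V hVW
  have hdef := (exists_mapsTo_iff hu hV.algebraMap_mem).1 (hW.isDefined V hVW)
  obtain ⟨hfV, hdiv⟩ := isDivisorial_of_residueTranscendental hV hVV' htr hdef
  have hxV : planeLocalRing x ≤ V := by
    obtain ⟨y, hy⟩ := hWm.exists_planeLocalRing_le V hVW
    rwa [eq_of_planeLocalRing_le (hxV₀.trans hV') (hy.trans hVV')]
  -- On the plane, domination would make `V` equal to the local ring at x, which does not contain f.
  have hVp : V ∉ plane k := fun hVp =>
    hfx.1 (isRegularModel_plane.eq_of_le ⟨x, rfl⟩ hVp hxV ▸ hfV)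
  refine ⟨V, ⟨hWm.isExceptionalComponent hVW hVp hdiv, fun q => ?_⟩, hxV⟩
  -- Surjectivity over q: the center `S` of `U` on `W` maps to the center of `U` on the line, which
  -- is q.
  obtain ⟨U, hUV', hkU, hU⟩ := exists_valuationSubring_hasCenter V'
    (ResidueTranscendental.hasGenericCenter hk' (hu 1) htr) q
  obtain ⟨S, hSW, hSU⟩ := hWm.exists_center U hkU
  obtain ⟨q', hq'⟩ := hW.isDefined S hSW
  obtain rfl := ((mapsTo_iff_hasCenter.1 hq').mono hSU).unique hU
  refine ⟨S, hSW, fun z hz => ?_, hq'⟩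
  have hzV' : z ∈ V' := hUV' (hSU.1 hz)
  rcases eq_or_ne z 0 with rfl | hz0
  · exact zero_mem _
  -- That `S` lies on the component of `V` holds because S ⊆ U ⊆ V', and an element of `K` in V'
  -- lies in `V`: otherwise its inverse would be a nonunit of `V`, hence of V'.
  refine (hdiv.mem_or_inv_mem ((hWm.isSurfacePoint S hSW).subset z hz)).elim id fun h => ?_
  refine inv_inv z ▸ inv_mem_of_notMem_maxSet h fun hm => ?_
  exact inv_notMem_of_mem_maxSet (inv_ne_zero hz0) (mem_maxSet_of_le hVV' hm)
    ((inv_inv z).symm ▸ hzV')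

end Dicritical

end PlanePencil

theorem mainTheorem8 {k : Type*} [Field k] (d : ℕ) (hd : 0 < d)
    (F G : MvPolynomial (Fin 3) k) (hF : F.IsHomogeneous d) (hG : G.IsHomogeneous d)
    (hFG : IsRelPrime F G) :
    (∃ W, PlanePencil.Resolves F G W) ∧
    ∀ W, PlanePencil.Resolves F G W →
      ∀ x : PlanePencil.ProjPoint k 2, PlanePencil.IsBasePoint F G x →
        ∃ V, PlanePencil.IsDicritical F G W V ∧
          ∃ h : (PlanePencil.planeLocalRing x).toSubring ≤ V.toSubring,
            (IsLocalRing.maximalIdeal V.toSubring).comap (Subring.inclusion h) =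
              IsLocalRing.maximalIdeal (PlanePencil.planeLocalRing x).toSubring := by
  refine ⟨PlanePencil.exists_resolves hd hF hG hFG, fun W hW x hx => ?_⟩
  obtain ⟨V, hV, hxV⟩ := PlanePencil.exists_isDicritical hd hF hG hFG hW hx
  exact ⟨V, hV, hxV.1, PlanePencil.comap_maximalIdeal_of_le hxV⟩
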